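/- **Setting.** Let $n\ge 4$. Let $(N,h)$ be a compact smooth Riemannian manifold (without boundary) and let $G$ be a compact connected Lie group acting smoothly, effectively and isometrically on $(N,h)$. Fix an $\mathrm{Ad}$-invariant inner product on the Lie algebra $\mathfrak g$ of $G$ and a smooth $G$-invariant function $V:N\to\mathbb R$. For $c\in\mathfrak g$ and $y\in N$ let $c\cdot y=X_c(y)=\frac{d}{dt}\big|_{t=0}\exp(tc)\,y\in T_yN$ be the infinitesimal action, and for a tangent vector $Y$ of $N$ let $c\cdot Y=\nabla_YX_c$, with $\nabla$ the Levi-Civita connection of $h$. For $R_0>0$ put $B^*_{R_0}=\{x\in\mathbb R^n: 0<|x|<R_0\}$. A *(smooth) YMH field* on $B^*_{R_0}$ is a pair $(A,u)$ of a smooth $\mathfrak g$-valued 1-form $A$ on $B^*_{R_0}$ and a smooth map $u:B^*_{R_0}\to N$ such that $$D_A^*F_A=-u^*\nabla_Au,\qquad \nabla_A^*\nabla_Au=-\nabla V(u),$$ where $F_A=dA+\frac12[A,A]$, $\nabla_Au=du+A\cdot u$, the covariant derivative of a vector field $Y$ along $u$ is $\nabla_AY=\nabla Y+A\cdot Y$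 with $\nabla$ the pull-back of the Levi-Civita connection, $D_A^*F_A=-\sum_i\big(\partial_iF_A(e_i,\cdot)+[A(e_i),F_A(e_i,\cdot)]\big)$, $\nabla_A^*\nabla_Au=-\sum_i\nabla_{A,e_i}\big((\nabla_Au)(e_i)\big)$, and $u^*\nabla_Au$ is the $\mathfrak g$-valued 1-form with $\langle u^*\nabla_Au(v),c\rangle=\langle\nabla_Au(v),c\cdot u\rangle$ for all $v\in\mathbb R^n$, $c\in\mathfrak g$. Write $|F_A|^2=\sum_{i<j}|F_A(e_i,e_j)|^2$ and $|\nabla_Au|^2=\sum_i|(\nabla_Au)(e_i)|^2$. **Proposition 2.5.** For every $\delta>0$ there is a constant $C=C(n,\delta)>0$, depending only on $n$, $\delta$ and the fixed data ($(N,h)$, $G$ with its action and the inner product on $\mathfrak g$, and $V$), such that for every $R_0>0$ and every YMH field $(A,u)$ on $B^*_{R_0}$ the following hold on $B^*_{R_0}$. 1. For every real $p\ge\frac{n-3}{n-2}+\delta$, the function $f=\sqrt{|F_A|^2+1}$ satisfies $$\Delta f^p\ge -C\,p\,\big(|\nabla_Au|^2+f\big)f^p .$$ 2. For every real $p\ge\frac{n-2}{n-1}+\delta$,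 the function $f=\sqrt{|\nabla_Au|^2+1}$ satisfies $$\Delta f^p\ge -C\,p\,\big(|F_A|^2+f^2\big)f^p .$$ Thus, for each fixed $p$ (or for $p$ in a bounded range) the inequalities hold with a constant in place of $Cp$. -/

import Mathlib

open scoped Manifold ContDiff Laplacian

/-- Euclidean space `ℝᵐ`. -/
abbrev Eu (m : ℕ) : Type := EuclideanSpace ℝ (Fin m)

namespace YMH

noncomputable section

/-- The `i`-th standard basis vector of `ℝⁿ`. -/
def stdVec {n : ℕ} (i : Fin n) : Eu n := EuclideanSpace.single i (1 : ℝ)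

/-- The punctured ball `{x ∈ ℝⁿ : 0 < |x| < R}`. -/
def puncturedBall (n : ℕ) (R : ℝ) : Set (Eu n) := {x | 0 < ‖x‖ ∧ ‖x‖ < R}

/-! ### The Lie algebra of the structure group

The Lie algebra `𝔤 = T₁G` of a Lie group `G` modelled on `ℝᵏ` is, in Mathlib, by definition a copy
of the vector space `ℝᵏ`. In order to do calculus with `𝔤`-valued functions we write it as `Eu k`;
its bracket and its adjoint representation are those of `T₁G`. -/

section LieAlgebra

variable {k : ℕ} (G : Type*) [TopologicalSpace G] [ChartedSpace (Eu k) G] [Group G]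

/-- The Lie bracket of `𝔤 = T₁G`. -/
def lieBr (a b : Eu k) : Eu k :=
  let a' : GroupLieAlgebra (𝓡 k) G := a
  let b' : GroupLieAlgebra (𝓡 k) G := b
  (⁅a', b'⁆ : GroupLieAlgebra (𝓡 k) G)

variable {G}

/-- The adjoint action of `g` on `𝔤`: the derivative of `a ↦ g a g⁻¹` at `1`. -/
def adjointAct (g : G) (c : Eu k) : Eu k :=
  mfderiv (𝓡 k) (𝓡 k) (fun a : G => g * a * g⁻¹) 1 c

variable (G)

/-- `B` is an `Ad`-invariant inner product on `𝔤`. -/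
structure IsInvariantInner (B : Eu k →L[ℝ] Eu k →L[ℝ] ℝ) : Prop where
  symm : ∀ a b, B a b = B b a
  pos : ∀ a, a ≠ 0 → 0 < B a a
  adInvariant : ∀ (g : G) (a b : Eu k), B (adjointAct g a) (adjointAct g b) = B a b

/-- The curvature `F_A = dA + ½[A, A]` of the connection form `A`, evaluated at the point `x` on
the vectors `v, w`. -/
def curvature {n : ℕ} (A : Eu n → Eu n →L[ℝ] Eu k) (x v w : Eu n) : Eu k :=
  fderiv ℝ A x v w - fderiv ℝ A x w v + lieBr G (A x v) (A x w)

/-- The `𝔤`-valued one-form `D_A^* F_A = - ∑ᵢ (∂ᵢ F_A(eᵢ, ·) + [A(eᵢ), F_A(eᵢ, ·)])`. -/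
def codiffCurvature {n : ℕ} (A : Eu n → Eu n →L[ℝ] Eu k) (x v : Eu n) : Eu k :=
  -∑ i : Fin n, (fderiv ℝ (fun y => curvature G A y (stdVec i) v) x (stdVec i)
    + lieBr G (A x (stdVec i)) (curvature G A x (stdVec i) v))

/-- `|F_A|² = ∑_{i<j} |F_A(eᵢ, eⱼ)|²`. -/
def curvatureNormSq {n : ℕ} (B : Eu k →L[ℝ] Eu k →L[ℝ] ℝ) (A : Eu n → Eu n →L[ℝ] Eu k)
    (x : Eu n) : ℝ :=
  ∑ i : Fin n, ∑ j ∈ Finset.Ioi i,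
    B (curvature G A x (stdVec i) (stdVec j)) (curvature G A x (stdVec i) (stdVec j))

end LieAlgebra

/-! ### The fibre and the group action -/

section Fibre

/-- Smooth Riemannian metrics on a `d`-dimensional manifold `N`. -/
abbrev Metric (d : ℕ) (N : Type*) [TopologicalSpace N] [ChartedSpace (Eu d) N]
    [IsManifold (𝓡 d) ∞ N] : Type _ :=
  Bundle.ContMDiffRiemannianMetric (𝓡 d) ∞ (Eu d) (fun y : N => TangentSpace (𝓡 d) y)

variable {n d k : ℕ} {N : Type*} [TopologicalSpace N] [ChartedSpace (Eu d) N]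
  [IsManifold (𝓡 d) ∞ N]
  (G : Type*) [TopologicalSpace G] [ChartedSpace (Eu k) G] [Group G] [MulAction G N]

/-- `G` acts on `N` by isometries of `h`. -/
def IsIsometricAction (h : Metric d N) : Prop :=
  ∀ (g : G) (y : N) (v w : TangentSpace (𝓡 d) y),
    h.inner (g • y) (mfderiv (𝓡 d) (𝓡 d) (fun q : N => g • q) y v)
      (mfderiv (𝓡 d) (𝓡 d) (fun q : N => g • q) y w) = h.inner y v w

/-- The infinitesimal action `c · y = X_c(y) = d/dt|_{t=0} exp(tc) y` of `c ∈ 𝔤` at `y ∈ N`, that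
is, the derivative at `1` of `g ↦ g y`, applied to `c`. -/
def infAct (c : Eu k) (y : N) : TangentSpace (𝓡 d) y :=
  mfderiv (𝓡 k) (𝓡 d) (fun g : G => g • y) 1 c

/-- The covariant derivative `(∇_A u)(v) = du(v) + A(v) · u`, at the point `x`. -/
def covDeriv (A : Eu n → Eu n →L[ℝ] Eu k) (u : Eu n → N) (x v : Eu n) :
    TangentSpace (𝓡 d) (u x) :=
  mfderiv (𝓡 n) (𝓡 d) u x v + infAct G (A x v) (u x)

/-- `|∇_A u|² = ∑ᵢ |(∇_A u)(eᵢ)|²`. -/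
def covDerivNormSq (h : Metric d N) (A : Eu n → Eu n →L[ℝ] Eu k) (u : Eu n → N) (x : Eu n) : ℝ :=
  ∑ i : Fin n, h.inner (u x) (covDeriv G A u x (stdVec i)) (covDeriv G A u x (stdVec i))

/-! #### Computations in a chart

Below `y₀ : N` selects the chart `φ = extChartAt (𝓡 d) y₀` of `N`, and `z` is a point of the
target of `φ`. -/

/-- The metric in the chart: the inner product of `a, b ∈ ℝᵈ` at `z`. -/
def chartMetric (h : Metric d N) (y₀ : N) (z a b : Eu d) : ℝ :=
  h.inner ((extChartAt (𝓡 d) y₀).symm z)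
    (mfderiv (𝓡 d) (𝓡 d) (extChartAt (𝓡 d) y₀).symm z a)
    (mfderiv (𝓡 d) (𝓡 d) (extChartAt (𝓡 d) y₀).symm z b)

/-- The Levi-Civita connection in the chart: the Christoffel symbols of the first kind,
`⟨Γ(a, b), t⟩ = ½ (∂_a ⟨b, t⟩ + ∂_b ⟨a, t⟩ - ∂_t ⟨a, b⟩)` at `z`. -/
def chartChristoffel (h : Metric d N) (y₀ : N) (z a b t : Eu d) : ℝ :=
  (fderiv ℝ (fun z' => chartMetric h y₀ z' b t) z a
    + fderiv ℝ (fun z' => chartMetric h y₀ z' a t) z b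
    - fderiv ℝ (fun z' => chartMetric h y₀ z' a b) z t) / 2

/-- The vector field `X_c` in the chart. -/
def chartInfAct (y₀ : N) (c : Eu k) (z : Eu d) : Eu d :=
  mfderiv (𝓡 d) (𝓡 d) (extChartAt (𝓡 d) y₀) ((extChartAt (𝓡 d) y₀).symm z)
    (infAct G c ((extChartAt (𝓡 d) y₀).symm z))

/-- The representative in the chart of a vector field `Y` along `u`. -/
def chartField (u : Eu n → N) (y₀ : N) (Y : (x : Eu n) → TangentSpace (𝓡 d) (u x)) (x : Eu n) :
    Eu d :=
  mfderiv (𝓡 d) (𝓡 d) (extChartAt (𝓡 d) y₀) (u x) (Y x)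

/-- The inner product `⟨(∇_A Y)(v), t⟩` of the covariant derivative `∇_A Y = ∇Y + A · Y` of a
vector field `Y` along `u` with the coordinate vector `t`, at the point `x`. Here `∇` is the
pull-back by `u` of the Levi-Civita connection, so `∇_v Y = ∂_v Y + Γ(∂_v u, Y)`, and `𝔤` acts on
tangent vectors by `c · Y = ∇_Y X_c = ∂_Y X_c + Γ(Y, X_c)`. -/
def chartCovDerivInner (h : Metric d N) (A : Eu n → Eu n →L[ℝ] Eu k) (u : Eu n → N) (y₀ : N)
    (Y : (x : Eu n) → TangentSpace (𝓡 d) (u x)) (x v : Eu n) (t : Eu d) : ℝ :=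
  let w : Eu n → Eu d := fun x' => extChartAt (𝓡 d) y₀ (u x')
  let Y' : Eu n → Eu d := chartField u y₀ Y
  let X : Eu d → Eu d := chartInfAct G y₀ (A x v)
  (chartMetric h y₀ (w x) (fderiv ℝ Y' x v) t + chartChristoffel h y₀ (w x) (fderiv ℝ w x v) (Y' x) t)
    + (chartMetric h y₀ (w x) (fderiv ℝ X (w x) (Y' x)) t
        + chartChristoffel h y₀ (w x) (Y' x) (X (w x)) t)

/-- `⟨∇_A^* ∇_A u, t⟩ = - ∑ᵢ ⟨(∇_A ((∇_A u)(eᵢ)))(eᵢ), t⟩` at the point `x`, for a coordinate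
vector `t`. -/
def chartRoughLaplacianInner (h : Metric d N) (A : Eu n → Eu n →L[ℝ] Eu k) (u : Eu n → N) (y₀ : N)
    (x : Eu n) (t : Eu d) : ℝ :=
  -∑ i : Fin n, chartCovDerivInner G h A u y₀ (fun x' => covDeriv G A u x' (stdVec i)) x (stdVec i) t

/-- `(A, u)` is a smooth Yang-Mills-Higgs field on the open set `Ω`, for the metric `h` of the
fibre, the inner product `B` of `𝔤` and the Higgs potential `V`. -/
structure IsYMHField (h : Metric d N) (B : Eu k →L[ℝ] Eu k →L[ℝ] ℝ) (V : N → ℝ)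
    (Ω : Set (Eu n)) (A : Eu n → Eu n →L[ℝ] Eu k) (u : Eu n → N) : Prop where
  smooth_connection : ContDiffOn ℝ ∞ A Ω
  smooth_section : ContMDiffOn (𝓡 n) (𝓡 d) ∞ u Ω
  /-- `D_A^* F_A = - u^* ∇_A u`, where `⟨u^* ∇_A u, c⟩ = ⟨∇_A u, c · u⟩`. -/
  yangMills : ∀ x ∈ Ω, ∀ (v : Eu n) (c : Eu k),
    B (codiffCurvature G A x v) c = -h.inner (u x) (covDeriv G A u x v) (infAct G c (u x))
  /-- `∇_A^* ∇_A u = - ∇V(u)`, in every chart around `u x`: both sides have the same inner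
  product with every coordinate vector `t`. -/
  higgs : ∀ x ∈ Ω, ∀ y₀ : N, u x ∈ (chartAt (Eu d) y₀).source → ∀ t : Eu d,
    chartRoughLaplacianInner G h A u y₀ x t
      = -fderiv ℝ (fun z => V ((extChartAt (𝓡 d) y₀).symm z)) (extChartAt (𝓡 d) y₀ (u x)) t

end Fibre

end

end YMH

/-! Let `Y` be `F_A` or `∇_A u`, `q = |Y|²` and `f = √(q + 1)`. The Laplacian of `f ^ p` equals `p f
^ (p - 2)` times `½ Δq - (2 - p) |½ dq|² / (q + 1)`. For a metric connection `½ Δq = |∇Y|² + ⟨∑ ∇ₗ∇ₗ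
Y, Y⟩` and `½ dq = ⟨∇Y, Y⟩`. It therefore suffices to control the zeroth order part of `∑ ∇ₗ∇ₗ Y`
and to prove `(2 - p) |⟨∇Y, Y⟩|² ≤ (q + 1) (|∇Y|² + error)`, which is where `p < 1` becomes possible
(`laplacian_sqrt_rpow_ge`).

The second inequality is a refined Kato inequality. Plain Cauchy-Schwarz gives the constant `1` in
front of `|⟨∇Y, Y⟩|²`. A one-form that is closed and coclosed up to lower order allows `1 +
1/(n-1)`, and a closed two-form that is coclosed up to lower order allows `1 + 1/(n-2)`. Young's
inequality spends an arbitrary `η > 0` of the constant to absorb the defects. The conditions on `p`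
say exactly that `2 - p` stays below these constants by `δ`. See `sum_sq_first_row_le` and
`sum_sq_first_slice_le`, and their invariant forms `kato_one_form` and `kato_two_form`. The defects
come from the structure and field equations: the antisymmetric part of `∇_A ∇_A u` is the action of
`F_A`, its trace is `∇V(u)`, `F_A` obeys the Bianchi identity, and the divergence of `F_A` is a
current bounded by `|∇_A u|`.

The Weitzenböck formulas `sum_covD_covD_curv` and `sum_covD_covD_gaugedDeriv` give the zeroth order
terms. In the curvature formula the derivative of the current contains second covariant derivatives
of `u`, but only antisymmetrised, so they reduce to curvature again (`inner_covD_divCurv`). What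
remains is of size `|F|² + |∇u|²|F| + |F|³` for the curvature and `|∇u|² + |∇u|⁴ + |∇u|²|F|` for the
section, and both fit the asserted right-hand sides.

All of this is done in a chart of the fibre. There `u` becomes a map `w` into an open set of `ℝᵈ`
with a metric `g`, Christoffel symbols `Γ` and Killing fields `X`, and the connection on vector
fields along `u` is `pullConn`. It is metric by the Killing equation, and its curvature is computed
from the fact that Killing fields are affine (`IsIsometricLieAction.affine`). The coordinate data
are shown to have these properties by differentiating the group law, the isometry property and
`Ad`-invariance at the unit (`IsLocalAction.killing`, `IsLocalAction.bracket`,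
`IsLocalMul.invariant`). On a compact piece of the chart all tensors are bounded by one number `L`
(`exists_isFibreBound`), and compactness of the fibre leaves finitely many such pieces, so the
constant depends neither on the field nor on the radius. -/

namespace YMH

/-! ### Refined Kato inequalities -/

section Rotation

variable {E : Type*} [NormedAddCommGroup E] [InnerProductSpace ℝ E] {n : ℕ}

/-- The columns of the matrix `O` are orthonormal. -/
def OrthoColumns (O : Fin n → Fin n → ℝ) : Prop :=
  ∀ i j, ∑ a, O a i * O a j = if i = j then 1 else 0

/-- Complete `ξ / |ξ|` to an orthonormal basis, used as the rows of `O`; Parseval makes the columns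
orthonormal too. In the Kato inequalities `ξ` is the gradient of `½|Y|²`, and after the rotation
only its first component is left to estimate. -/
theorem exists_orthoColumns {m : ℕ} (ξ : Fin (m + 1) → ℝ) :
    ∃ O : Fin (m + 1) → Fin (m + 1) → ℝ, OrthoColumns O ∧
      (∑ i, O 0 i * ξ i) ^ 2 = ∑ i, ξ i ^ 2 := by
  classical
  let x : Eu (m + 1) := WithLp.toLp 2 ξ
  have hx : ‖x‖ ^ 2 = ∑ i, ξ i ^ 2 := by
    rw [EuclideanSpace.norm_sq_eq]; simp [x]
  have key : ∀ b : OrthonormalBasis (Fin (m + 1)) ℝ (Eu (m + 1)),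
      OrthoColumns (fun a i => b a i) := by
    intro b i j
    have := b.sum_inner_mul_inner (EuclideanSpace.single i (1 : ℝ)) (EuclideanSpace.single j 1)
    simp only [EuclideanSpace.inner_single_left, EuclideanSpace.inner_single_right] at this
    simpa [PiLp.single_apply, eq_comm] using this
  by_cases h0 : x = 0
  -- For `ξ = 0` any frame will do.
  · refine ⟨_, key (EuclideanSpace.basisFun _ ℝ), ?_⟩
    have : ∀ i, ξ i = 0 := fun i => by
      have := congrArg (fun y : Eu (m + 1) => y i) h0
      simpa [x] using this
    simp [this]
  · have hn : ‖x‖ ≠ 0 := norm_ne_zero_iff.mpr h0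
    let v : Fin (m + 1) → Eu (m + 1) := fun _ => (‖x‖⁻¹) • x
    have hv : Orthonormal ℝ (({0} : Set (Fin (m + 1))).domRestrict v) := by
      rw [orthonormal_iff_ite]
      rintro ⟨i, hi⟩ ⟨j, hj⟩
      rw [Set.mem_singleton_iff] at hi hj
      subst hi; subst hj
      simp [v, Set.domRestrict, norm_smul, hn]
    obtain ⟨b, hb⟩ := hv.exists_orthonormalBasis_extension_of_card_eq (by simp)
    refine ⟨_, key b, ?_⟩
    rw [hb 0 rfl]
    have : ∑ i, (v 0) i * ξ i = ‖x‖⁻¹ * ∑ i, ξ i ^ 2 := by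
      rw [Finset.mul_sum]
      refine Finset.sum_congr rfl fun i _ => ?_
      simp [v, x]; ring
    rw [this, ← hx]
    field_simp

/-- Change of frame in one index. -/
def rot {V : Type*} [AddCommGroup V] [Module ℝ V] (O : Fin n → Fin n → ℝ) (x : Fin n → V)
    (a : Fin n) : V := ∑ i, O a i • x i

theorem sum_inner_rot {O : Fin n → Fin n → ℝ} (hO : OrthoColumns O) (x y : Fin n → E) :
    ∑ a, inner ℝ (rot O x a) (rot O y a) = ∑ i, inner ℝ (x i) (y i) := by
  have : ∀ a, inner ℝ (rot O x a) (rot O y a)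
      = ∑ i, ∑ j, (O a i * O a j) * inner ℝ (x i) (y j) := by
    intro a
    simp only [rot, sum_inner, inner_sum, inner_smul_left, inner_smul_right, Finset.mul_sum]
    rw [Finset.sum_comm]
    refine Finset.sum_congr rfl fun i _ => Finset.sum_congr rfl fun j _ => ?_
    simp; ring
  simp only [this]
  rw [Finset.sum_comm]
  refine Finset.sum_congr rfl fun i _ => ?_
  rw [Finset.sum_comm]
  simp only [← Finset.sum_mul]
  rw [Finset.sum_eq_single i]
  · rw [hO i i]; simp
  · intro j _ hj; rw [hO i j, if_neg hj.symm]; simp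
  · simp

theorem sum_norm_sq_rot {O : Fin n → Fin n → ℝ} (hO : OrthoColumns O) (x : Fin n → E) :
    ∑ a, ‖rot O x a‖ ^ 2 = ∑ i, ‖x i‖ ^ 2 := by
  simpa only [real_inner_self_eq_norm_sq] using sum_inner_rot hO x x

variable {V : Type*} [AddCommGroup V] [Module ℝ V]

theorem rot_add (O : Fin n → Fin n → ℝ) (x y : Fin n → V) (a : Fin n) :
    rot O (fun i => x i + y i) a = rot O x a + rot O y a := by
  simp [rot, Finset.sum_add_distrib]

theorem rot_sub (O : Fin n → Fin n → ℝ) (x y : Fin n → V) (a : Fin n) :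
    rot O (fun i => x i - y i) a = rot O x a - rot O y a := by
  simp [rot, smul_sub, Finset.sum_sub_distrib]

theorem rot_neg (O : Fin n → Fin n → ℝ) (x : Fin n → V) (a : Fin n) :
    rot O (fun i => -x i) a = -rot O x a := by
  simp [rot]

theorem rot_zero (O : Fin n → Fin n → ℝ) (a : Fin n) :
    rot O (fun _ => (0 : V)) a = 0 := by
  simp [rot]

theorem rot_sum {ι : Type*} (s : Finset ι) (O : Fin n → Fin n → ℝ) (x : ι → Fin n → V) (a : Fin n) :
    rot O (fun i => ∑ l ∈ s, x l i) a = ∑ l ∈ s, rot O (x l) a := by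
  simp only [rot, Finset.smul_sum]; rw [Finset.sum_comm]

theorem rot_comm (O P : Fin n → Fin n → ℝ) (x : Fin n → Fin n → V) (a b : Fin n) :
    rot O (fun i => rot P (x i) b) a = rot P (fun j => rot O (fun i => x i j) a) b := by
  simp only [rot, Finset.smul_sum]
  rw [Finset.sum_comm]
  refine Finset.sum_congr rfl fun i _ => Finset.sum_congr rfl fun j _ => ?_
  rw [smul_comm]

theorem sum_rot_rot_diag {O : Fin n → Fin n → ℝ} (hO : OrthoColumns O) (x : Fin n → Fin n → V) :
    ∑ a, rot O (fun i => rot O (x i) a) a = ∑ i, x i i := by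
  simp only [rot, Finset.smul_sum, smul_smul]
  rw [Finset.sum_comm]
  refine Finset.sum_congr rfl fun i _ => ?_
  rw [Finset.sum_comm]
  simp only [← Finset.sum_smul]
  rw [Finset.sum_eq_single i]
  · rw [hO i i]; simp
  · intro j _ hj; rw [hO i j, if_neg hj.symm]; simp
  · simp

end Rotation

/-! ### Kato inequalities with defect, in an inner product space -/

section Kato

variable {E : Type*} [NormedAddCommGroup E] [InnerProductSpace ℝ E]

/-- Follows from `2|x||y| ≤ η|x|² + |y|²/η`. It lets an identity that holds only up to a defect `y`
be used at the cost of a factor `1 - η` and an error `|y|²/η`. -/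
theorem young_norm_sq {E : Type*} [SeminormedAddCommGroup E] {η : ℝ} (hη : 0 < η) (x y : E) :
    (1 - η) * ‖x‖ ^ 2 - 1 / η * ‖y‖ ^ 2 ≤ ‖x - y‖ ^ 2 := by
  have h1 : (‖x‖ - ‖y‖) ^ 2 ≤ ‖x - y‖ ^ 2 := by
    rw [sq_le_sq]; simpa using abs_norm_sub_norm_le x y
  have h2 : 0 ≤ (η * ‖x‖ - ‖y‖) ^ 2 / η := by positivity
  have h3 : (η * ‖x‖ - ‖y‖) ^ 2 / η = η * ‖x‖ ^ 2 - 2 * ‖x‖ * ‖y‖ + 1 / η * ‖y‖ ^ 2 := by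
    field_simp; ring
  nlinarith [sq_nonneg ‖y‖]

theorem norm_sum_sq_le {E ι : Type*} [SeminormedAddCommGroup E] (s : Finset ι) (x : ι → E) :
    ‖∑ i ∈ s, x i‖ ^ 2 ≤ s.card * ∑ i ∈ s, ‖x i‖ ^ 2 := by
  calc ‖∑ i ∈ s, x i‖ ^ 2 ≤ (∑ i ∈ s, ‖x i‖) ^ 2 := by
        gcongr; exact norm_sum_le _ _
    _ ≤ _ := sq_sum_le_card_mul_sum_sq

theorem sum_inner_sq_le {ι : Type*} (s : Finset ι) (x y : ι → E) :
    (∑ i ∈ s, inner ℝ (x i) (y i)) ^ 2 ≤ (∑ i ∈ s, ‖x i‖ ^ 2) * ∑ i ∈ s, ‖y i‖ ^ 2 := by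
  have h : |∑ i ∈ s, inner ℝ (x i) (y i)| ≤ ∑ i ∈ s, ‖x i‖ * ‖y i‖ :=
    (Finset.abs_sum_le_sum_abs _ _).trans
      (Finset.sum_le_sum fun i _ => abs_real_inner_le_norm _ _)
  calc _ = |∑ i ∈ s, inner ℝ (x i) (y i)| ^ 2 := (sq_abs _).symm
    _ ≤ (∑ i ∈ s, ‖x i‖ * ‖y i‖) ^ 2 := by gcongr
    _ ≤ _ := Finset.sum_mul_sq_le_sq_mul_sq _ _ _

/-- Suppose first that `T` is symmetric and trace free. The first column then repeats the
off-diagonal part of the first row, which is thus counted twice. The other `m` diagonal entries add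
up to `-T 0 0`, so Cauchy-Schwarz gives them square sum at least `‖T 0 0‖² / m`. Hence the total is
at least `1 + 1/m` times the first row. The antisymmetric part and the trace enter as defects
through `young_norm_sq`. -/
theorem sum_sq_first_row_le {m : ℕ} (hm : 1 ≤ m) {η : ℝ} (hη : 0 < η)
    (T : Fin (m + 1) → Fin (m + 1) → E) :
    (1 + 1 / (m : ℝ) - η) * ∑ j, ‖T 0 j‖ ^ 2 ≤ ∑ i, ∑ j, ‖T i j‖ ^ 2
      + 1 / η * (∑ i, ∑ j, ‖T i j - T j i‖ ^ 2 + ‖∑ i, T i i‖ ^ 2) := by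
  have hm0 : (1 : ℝ) ≤ m := by exact_mod_cast hm
  have hm1 : 1 / (m : ℝ) ≤ 1 := by rw [div_le_one (by linarith)]; exact hm0
  set S0 := ‖T 0 0‖ ^ 2
  set S1 := ∑ j : Fin m, ‖T 0 j.succ‖ ^ 2
  have hS1 : 0 ≤ S1 := by positivity
  have hS0 : 0 ≤ S0 := by positivity
  have hrow : ∑ j, ‖T 0 j‖ ^ 2 = S0 + S1 := Fin.sum_univ_succ _
  set t := ∑ i, T i i
  have hA : ∑ j : Fin m, ‖T 0 j.succ - T j.succ 0‖ ^ 2 ≤ ∑ i, ∑ j, ‖T i j - T j i‖ ^ 2 := by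
    calc _ ≤ ∑ j, ‖T 0 j - T j 0‖ ^ 2 := by
          rw [Fin.sum_univ_succ]; linarith [sq_nonneg ‖T 0 0 - T 0 0‖]
      _ ≤ _ := Finset.single_le_sum (f := fun i => ∑ j, ‖T i j - T j i‖ ^ 2)
          (fun i _ => by positivity) (Finset.mem_univ 0)
  have hcol : (1 - η) * S1 - 1 / η * ∑ i, ∑ j, ‖T i j - T j i‖ ^ 2
      ≤ ∑ j : Fin m, ‖T j.succ 0‖ ^ 2 := by
    have : (1 - η) * S1 - 1 / η * ∑ j : Fin m, ‖T 0 j.succ - T j.succ 0‖ ^ 2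
        ≤ ∑ j : Fin m, ‖T j.succ 0‖ ^ 2 := by
      simp only [S1, Finset.mul_sum]
      rw [← Finset.sum_sub_distrib]
      refine Finset.sum_le_sum fun j _ => ?_
      have := young_norm_sq hη (T 0 j.succ) (T 0 j.succ - T j.succ 0)
      simpa using this
    have h2 := mul_le_mul_of_nonneg_left hA (by positivity : 0 ≤ 1 / η)
    linarith
  -- `T 0 0 - t` is minus the sum of the remaining `m` diagonal entries.
  have hdiag : 1 / (m : ℝ) * ((1 - η) * S0 - 1 / η * ‖t‖ ^ 2)
      ≤ ∑ j : Fin m, ‖T j.succ j.succ‖ ^ 2 := by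
    have h1 := norm_sum_sq_le Finset.univ (fun j : Fin m => T j.succ j.succ)
    have h2 : T 0 0 - t = -∑ j : Fin m, T j.succ j.succ := by
      simp only [t]; rw [Fin.sum_univ_succ]; abel
    have h3 := young_norm_sq hη (T 0 0) t
    rw [h2, norm_neg] at h3
    simp only [Finset.card_univ, Fintype.card_fin] at h1
    rw [one_div, inv_mul_le_iff₀ (by linarith)]
    linarith
  have htot : S0 + S1 + ∑ j : Fin m, ‖T j.succ 0‖ ^ 2 + ∑ j : Fin m, ‖T j.succ j.succ‖ ^ 2
      ≤ ∑ i, ∑ j, ‖T i j‖ ^ 2 := by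
    rw [Fin.sum_univ_succ (fun i => ∑ j, ‖T i j‖ ^ 2), hrow, add_assoc,
      ← Finset.sum_add_distrib]
    gcongr with i
    rw [Fin.sum_univ_succ]
    gcongr
    exact Finset.single_le_sum (f := fun j : Fin m => ‖T i.succ j.succ‖ ^ 2)
      (fun i _ => by positivity) (Finset.mem_univ i)
  rw [hrow]
  have e1 : 1 / (m : ℝ) * (1 / η * ‖t‖ ^ 2) ≤ 1 / η * ‖t‖ ^ 2 :=
    mul_le_of_le_one_left (by positivity) hm1
  have e2 : (1 / (m : ℝ) - η) * S1 ≤ (1 - η) * S1 := by gcongr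
  have e3 : (1 / (m : ℝ) - η) * S0 ≤ 1 / (m : ℝ) * ((1 - η) * S0) := by
    have : 1 / (m : ℝ) * η * S0 ≤ η * S0 := by
      gcongr; exact mul_le_of_le_one_left hη.le hm1
    nlinarith
  nlinarith

/-- Rotate both indices of `T` and the index of `σ` so that the vector `⟨T i ·, σ⟩` points along the
first axis. Its square is then at most `|σ|²` times the square of the first row of the rotated `T`,
and `sum_sq_first_row_le` applies; the antisymmetric part, the trace and all norms are rotation
invariant. The bound `η ≤ 1` keeps the constant nonnegative. -/
theorem kato_one_form_inner {m : ℕ} (hm : 1 ≤ m) {η : ℝ} (hη : 0 < η) (hη1 : η ≤ 1)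
    (T : Fin (m + 1) → Fin (m + 1) → E) (σ : Fin (m + 1) → E) :
    (1 + 1 / (m : ℝ) - η) * ∑ i, (∑ j, inner ℝ (T i j) (σ j)) ^ 2
      ≤ (∑ j, ‖σ j‖ ^ 2) * (∑ i, ∑ j, ‖T i j‖ ^ 2
      + 1 / η * (∑ i, ∑ j, ‖T i j - T j i‖ ^ 2 + ‖∑ i, T i i‖ ^ 2)) := by
  obtain ⟨O, hO, hξ⟩ := exists_orthoColumns (fun i => ∑ j, inner ℝ (T i j) (σ j))
  have hκ : 0 ≤ 1 + 1 / (m : ℝ) - η := by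
    have : 0 ≤ 1 / (m : ℝ) := by positivity
    linarith
  rw [← hξ]
  have hrot : ∀ S : Fin (m + 1) → Fin (m + 1) → E,
      ∑ a, ∑ b, ‖rot O (fun i => rot O (S i) b) a‖ ^ 2 = ∑ i, ∑ j, ‖S i j‖ ^ 2 := by
    intro S
    rw [Finset.sum_comm]
    simp only [sum_norm_sq_rot hO (fun i => rot O (S i) _)]
    rw [Finset.sum_comm]
    simp only [sum_norm_sq_rot hO]
  set T' : Fin (m + 1) → Fin (m + 1) → E := fun a b => rot O (fun i => rot O (T i) b) a
  have h1 : ∑ i, O 0 i * ∑ j, inner ℝ (T i j) (σ j) = ∑ b, inner ℝ (T' 0 b) (rot O σ b) := by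
    have : ∀ b, T' 0 b = rot O (fun j => rot O (fun i => T i j) 0) b := fun b => by
      simp only [T']; rw [rot_comm]
    simp only [this]
    rw [sum_inner_rot hO]
    simp only [rot, sum_inner, inner_smul_left, Finset.mul_sum]
    rw [Finset.sum_comm]
    simp
  have h2 : ∀ a b, T' a b - T' b a = rot O (fun i => rot O (fun j => T i j - T j i) b) a := by
    intro a b
    simp only [rot_sub]
    congr 1
    simp only [T']
    rw [rot_comm]
  have h3 := sum_sq_first_row_le hm hη T'
  simp only [h2] at h3
  rw [hrot (fun i j => T i j - T j i), sum_rot_rot_diag hO, hrot] at h3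
  rw [h1]
  have h4 := sum_inner_sq_le Finset.univ (T' 0) (rot O σ)
  rw [sum_norm_sq_rot hO] at h4
  calc _ ≤ (1 + 1 / (m : ℝ) - η) * ((∑ i, ‖T' 0 i‖ ^ 2) * ∑ i, ‖σ i‖ ^ 2) := by gcongr
    _ = (∑ i, ‖σ i‖ ^ 2) * ((1 + 1 / (m : ℝ) - η) * ∑ i, ‖T' 0 i‖ ^ 2) := by ring
    _ ≤ _ := by gcongr

/-- Row `i` and column `i` have equal square sums and overlap only in the vanishing entry `S i i`.
-/
theorem two_mul_sum_row_le {m : ℕ} (S : Fin m → Fin m → E) (hS : ∀ i j, S i j = -S j i)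
    (i : Fin m) : 2 * ∑ j, ‖S i j‖ ^ 2 ≤ ∑ j, ∑ k, ‖S j k‖ ^ 2 := by
  have h0 : S i i = 0 := by
    have := hS i i
    have h2 : (2 : ℝ) • S i i = 0 := by rw [two_smul]; nth_rw 2 [this]; simp
    simpa using h2
  rw [two_mul, ← Finset.add_sum_erase _ (fun j => ∑ k, ‖S j k‖ ^ 2) (Finset.mem_univ i)]
  apply add_le_add_right
  rw [← Finset.add_sum_erase _ (fun j => ‖S i j‖ ^ 2) (Finset.mem_univ i), h0]
  simp only [norm_zero, ne_eq, OfNat.ofNat_ne_zero, not_false_eq_true, zero_pow, zero_add]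
  refine Finset.sum_le_sum fun j _ => ?_
  rw [hS i j, norm_neg]
  exact Finset.single_le_sum (f := fun k => ‖S j k‖ ^ 2)
      (fun i _ => by positivity) (Finset.mem_univ i)

/-- Here `T i j k` stands for `∇ᵢ F_jk`. The first slice has square sum `a + 2b`, where `b` collects
the entries `T 0 0 j` and `a` those with `j, k ≥ 1`. The other slices contain `2c`, from the entries
`T i 0 j`, and at least `2e`, from the entries `T i i j`. The Bianchi identity writes `T 0 i j` as a
difference of two entries counted by `c`, so `a ≤ 4c`. If the divergence vanishes, `T 0 0 j` is
minus a sum of `m - 1` entries counted by `e`, so `b ≤ (m - 1) e`. The other slices thus contribute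
at least `a/2 + 2b/(m - 1)`. -/
theorem sum_sq_first_slice_le {m : ℕ} (hm : 3 ≤ m) {η : ℝ} (hη : 0 < η)
    (T : Fin (m + 1) → Fin (m + 1) → Fin (m + 1) → E)
    (hT : ∀ i j k, T i j k = -T i k j) (hB : ∀ i j k, T i j k + T j k i + T k i j = 0) :
    (1 + 1 / ((m : ℝ) - 1) - η) * ∑ j, ∑ k, ‖T 0 j k‖ ^ 2 ≤ ∑ i, ∑ j, ∑ k, ‖T i j k‖ ^ 2
      + 1 / η * ∑ j, ‖∑ i, T i i j‖ ^ 2 := by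
  have hm0 : (3 : ℝ) ≤ m := by exact_mod_cast hm
  have hdiag : ∀ i j, T i j j = 0 := fun i j => by
    have := hT i j j
    have h2 : (2 : ℝ) • T i j j = 0 := by rw [two_smul]; nth_rw 2 [this]; simp
    simpa using h2
  have split : ∀ i, ∑ j, ∑ k, ‖T i j k‖ ^ 2
      = 2 * ∑ j : Fin m, ‖T i 0 j.succ‖ ^ 2 + ∑ j : Fin m, ∑ k : Fin m, ‖T i j.succ k.succ‖ ^ 2 := by
    intro i
    rw [Fin.sum_univ_succ]
    simp only [Fin.sum_univ_succ (fun k => ‖T i _ k‖ ^ 2), Finset.sum_add_distrib, hdiag]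
    have : ∀ j : Fin m, ‖T i j.succ 0‖ ^ 2 = ‖T i 0 j.succ‖ ^ 2 := fun j => by
      rw [hT, norm_neg]
    simp only [this]
    simp; ring
  set a := ∑ j : Fin m, ∑ k : Fin m, ‖T 0 j.succ k.succ‖ ^ 2
  set b := ∑ j : Fin m, ‖T 0 0 j.succ‖ ^ 2
  have ha : 0 ≤ a := by positivity
  have hb : 0 ≤ b := by positivity
  set c := ∑ i : Fin m, ∑ j : Fin m, ‖T i.succ 0 j.succ‖ ^ 2
  have hac : a ≤ 4 * c := by
    have : ∀ i j : Fin m, ‖T 0 i.succ j.succ‖ ^ 2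
        ≤ 2 * ‖T i.succ 0 j.succ‖ ^ 2 + 2 * ‖T j.succ 0 i.succ‖ ^ 2 := by
      intro i j
      have e : T 0 i.succ j.succ = T i.succ 0 j.succ - T j.succ 0 i.succ := by
        have h1 := hB 0 i.succ j.succ
        rw [hT i.succ j.succ 0] at h1
        linear_combination (norm := module) h1
      rw [e]
      have := norm_sub_le (T i.succ 0 j.succ) (T j.succ 0 i.succ)
      nlinarith [norm_nonneg (T i.succ 0 j.succ - T j.succ 0 i.succ),
        sq_nonneg (‖T i.succ 0 j.succ‖ - ‖T j.succ 0 i.succ‖)]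
    calc a ≤ ∑ i : Fin m, ∑ j : Fin m,
          (2 * ‖T i.succ 0 j.succ‖ ^ 2 + 2 * ‖T j.succ 0 i.succ‖ ^ 2) :=
        Finset.sum_le_sum fun i _ => Finset.sum_le_sum fun j _ => this i j
      _ = 4 * c := by
        simp only [Finset.sum_add_distrib, ← Finset.mul_sum]
        rw [Finset.sum_comm (f := fun i j : Fin m => ‖T j.succ 0 i.succ‖ ^ 2)]
        ring
  set e := ∑ i : Fin m, ∑ j : Fin m, ‖T i.succ i.succ j.succ‖ ^ 2
  have he : 2 * e ≤ ∑ i : Fin m, ∑ j : Fin m, ∑ k : Fin m, ‖T i.succ j.succ k.succ‖ ^ 2 := by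
    simp only [e]
    rw [Finset.mul_sum]
    refine Finset.sum_le_sum fun i _ => ?_
    exact two_mul_sum_row_le (fun j k : Fin m => T i.succ j.succ k.succ)
      (fun j k => hT _ _ _) i
  have hg : (1 - η) * b - 1 / η * ∑ j, ‖∑ i, T i i j‖ ^ 2 ≤ ((m : ℝ) - 1) * e := by
    have h1 : (1 - η) * b - 1 / η * ∑ j : Fin m, ‖∑ i, T i i j.succ‖ ^ 2 ≤ ((m : ℝ) - 1) * e := by
      simp only [b, e]
      rw [Finset.sum_comm (f := fun i j : Fin m => ‖T i.succ i.succ j.succ‖ ^ 2)]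
      simp only [Finset.mul_sum]
      rw [← Finset.sum_sub_distrib]
      refine Finset.sum_le_sum fun j _ => ?_
      rw [← Finset.mul_sum]
      have h3 := young_norm_sq hη (T 0 0 j.succ) (∑ i, T i i j.succ)
      have h2 : T 0 0 j.succ - ∑ i, T i i j.succ
          = -∑ i ∈ Finset.univ.erase j, T i.succ i.succ j.succ := by
        rw [Fin.sum_univ_succ, ← Finset.add_sum_erase _ _ (Finset.mem_univ j), hdiag]; abel
      rw [h2, norm_neg] at h3
      refine h3.trans ((norm_sum_sq_le _ _).trans ?_)
      -- Only `m - 1` terms and not `m`, since `T j j j = 0` by skewness; this produces `1/(n-2)`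
      -- for two-forms.
      have hc : ((Finset.univ.erase j).card : ℝ) = (m : ℝ) - 1 := by
        rw [Finset.card_erase_of_mem (Finset.mem_univ j), Finset.card_univ, Fintype.card_fin,
          Nat.cast_sub (by omega)]; simp
      rw [hc]
      have : (0 : ℝ) ≤ (m : ℝ) - 1 := by linarith
      gcongr
      exact Finset.erase_subset _ _
    have h2 : ∑ j : Fin m, ‖∑ i, T i i j.succ‖ ^ 2 ≤ ∑ j, ‖∑ i, T i i j‖ ^ 2 := by
      rw [Fin.sum_univ_succ (fun j => ‖∑ i, T i i j‖ ^ 2)]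
      linarith [sq_nonneg ‖∑ i, T i i 0‖]
    have h3 := mul_le_mul_of_nonneg_left h2 (by positivity : 0 ≤ 1 / η)
    linarith
  rw [Fin.sum_univ_succ (fun i => ∑ j, ∑ k, ‖T i j k‖ ^ 2)]
  simp only [split, Finset.sum_add_distrib, ← Finset.mul_sum]
  set g := ∑ j, ‖∑ i, T i i j‖ ^ 2
  have hg0 : 0 ≤ g := by positivity
  set w := 1 / ((m : ℝ) - 1)
  -- The gain `1/2` on `a` must not be smaller than the gain `1/(m-1)` on `b`. This is the use of `3
  -- ≤ m`, that is, of `n ≥ 4`.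
  have hw : w ≤ 1 / 2 := one_div_le_one_div_of_le (by norm_num) (by linarith)
  have hw0 : 0 ≤ w := by
    have : (0 : ℝ) < (m : ℝ) - 1 := by linarith
    positivity
  have hwe : w * (((m : ℝ) - 1) * e) = e := by
    have : (m : ℝ) - 1 ≠ 0 := by linarith
    simp only [w]; field_simp
  have h5 := mul_le_mul_of_nonneg_left hg hw0
  rw [hwe] at h5
  have h6 : w * (1 / η * g) ≤ 1 / 2 * (1 / η * g) := by gcongr
  have h7 : (w - η) * a ≤ 1 / 2 * a := by gcongr; linarith
  have h8 : (w - η) * b ≤ w * ((1 - η) * b) := by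
    have : w * η * b ≤ 1 * η * b := by gcongr; linarith
    nlinarith
  nlinarith

/-- As for one-forms: rotate all indices so that the vector `⟨T i, F⟩` lies on the first axis, and
apply Cauchy-Schwarz to the first slice. Skewness, the cyclic identity and the divergence survive
the rotation. -/
theorem kato_two_form_inner {m : ℕ} (hm : 3 ≤ m) {η : ℝ} (hη : 0 < η) (hη1 : η ≤ 1)
    (T : Fin (m + 1) → Fin (m + 1) → Fin (m + 1) → E) (F : Fin (m + 1) → Fin (m + 1) → E)
    (hT : ∀ i j k, T i j k = -T i k j) (hB : ∀ i j k, T i j k + T j k i + T k i j = 0) :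
    (1 + 1 / ((m : ℝ) - 1) - η) * ∑ i, (∑ j, ∑ k, inner ℝ (T i j k) (F j k)) ^ 2
      ≤ (∑ j, ∑ k, ‖F j k‖ ^ 2) * (∑ i, ∑ j, ∑ k, ‖T i j k‖ ^ 2
      + 1 / η * ∑ j, ‖∑ i, T i i j‖ ^ 2) := by
  obtain ⟨O, hO, hξ⟩ := exists_orthoColumns (fun i => ∑ j, ∑ k, inner ℝ (T i j k) (F j k))
  have hm0 : (3 : ℝ) ≤ m := by exact_mod_cast hm
  have hκ : 0 ≤ 1 + 1 / ((m : ℝ) - 1) - η := by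
    have h1 : (0 : ℝ) < (m : ℝ) - 1 := by linarith
    have : 0 ≤ 1 / ((m : ℝ) - 1) := by positivity
    linarith
  rw [← hξ]
  have hrot2 : ∀ S : Fin (m + 1) → Fin (m + 1) → E,
      ∑ a, ∑ b, ‖rot O (fun i => rot O (S i) b) a‖ ^ 2 = ∑ i, ∑ j, ‖S i j‖ ^ 2 := by
    intro S
    rw [Finset.sum_comm]
    simp only [sum_norm_sq_rot hO (fun i => rot O (S i) _)]
    rw [Finset.sum_comm]
    simp only [sum_norm_sq_rot hO]
  set T' : Fin (m + 1) → Fin (m + 1) → Fin (m + 1) → E :=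
    fun a b c => rot O (fun i => rot O (fun j => rot O (T i j) c) b) a with hT'def
  have hrot3 : ∑ a, ∑ b, ∑ c, ‖T' a b c‖ ^ 2 = ∑ i, ∑ j, ∑ k, ‖T i j k‖ ^ 2 := by
    have : ∀ b c, ∑ a, ‖T' a b c‖ ^ 2 = ∑ i, ‖rot O (fun j => rot O (T i j) c) b‖ ^ 2 :=
      fun b c => sum_norm_sq_rot hO _
    calc _ = ∑ b, ∑ a, ∑ c, ‖T' a b c‖ ^ 2 := Finset.sum_comm
      _ = ∑ b, ∑ c, ∑ a, ‖T' a b c‖ ^ 2 :=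
        Finset.sum_congr rfl fun b _ => Finset.sum_comm
      _ = ∑ b, ∑ c, ∑ i, ‖rot O (fun j => rot O (T i j) c) b‖ ^ 2 := by simp only [this]
      _ = ∑ b, ∑ i, ∑ c, ‖rot O (fun j => rot O (T i j) c) b‖ ^ 2 :=
        Finset.sum_congr rfl fun b _ => Finset.sum_comm
      _ = ∑ i, ∑ b, ∑ c, ‖rot O (fun j => rot O (T i j) c) b‖ ^ 2 := Finset.sum_comm
      _ = _ := Finset.sum_congr rfl fun i _ => hrot2 _
  have h1 : ∑ i, O 0 i * ∑ j, ∑ k, inner ℝ (T i j k) (F j k)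
      = ∑ b, ∑ c, inner ℝ (T' 0 b c) (rot O (fun j => rot O (F j) c) b) := by
    have e : ∀ b c, T' 0 b c
        = rot O (fun j => rot O (fun k => rot O (fun i => T i j k) 0) c) b := fun b c => by
      simp only [T']; rw [rot_comm]; congr 1; funext j; rw [rot_comm]
    simp only [e]
    rw [Finset.sum_comm]
    simp only [sum_inner_rot hO (fun j => rot O (fun k => rot O (fun i => T i j k) 0) _)]
    rw [Finset.sum_comm]
    simp only [sum_inner_rot hO]
    simp only [rot, sum_inner, inner_smul_left, Finset.mul_sum]
    rw [Finset.sum_comm]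
    refine Finset.sum_congr rfl fun j _ => ?_
    rw [Finset.sum_comm]
    simp
  have hT' : ∀ a b c, T' a b c = -T' a c b := by
    intro a b c
    simp only [T']
    rw [← rot_neg]
    congr 1; funext i
    rw [rot_comm, ← rot_neg]
    congr 1; funext j
    rw [← rot_neg]
    congr 1; funext k
    exact hT _ _ _
  have hB' : ∀ a b c, T' a b c + T' b c a + T' c a b = 0 := by
    intro a b c
    have e2 : T' b c a = rot O (fun i => rot O (fun j => rot O (fun k => T j k i) c) b) a := by
      simp only [T']
      rw [show (fun i => rot O (fun j => rot O (T i j) a) c)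
        = fun i => rot O (fun l => rot O (fun j => T i j l) c) a from funext fun i => by
          rw [rot_comm], rot_comm]
    have e3 : T' c a b = rot O (fun i => rot O (fun j => rot O (fun k => T k i j) c) b) a := by
      simp only [T']
      rw [rot_comm]
      congr 1; funext i
      rw [rot_comm]
    rw [e2, e3, ← rot_add, ← rot_add]
    rw [show (fun i => rot O (fun j => rot O (T i j) c) b + rot O (fun j => rot O (fun k => T j k i) c) b
        + rot O (fun j => rot O (fun k => T k i j) c) b) = fun _ => 0 from funext fun i => by
      rw [← rot_add, ← rot_add]
      rw [show (fun j => rot O (T i j) c + rot O (fun k => T j k i) c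
          + rot O (fun k => T k i j) c) = fun _ => 0 from funext fun j => by
        rw [← rot_add, ← rot_add]
        simp only [hB, rot_zero]]
      exact rot_zero _ _]
    exact rot_zero _ _
  have htr : ∀ c, ∑ a, T' a a c = rot O (fun k => ∑ i, T i i k) c := by
    intro c
    simp only [T']
    rw [sum_rot_rot_diag hO (fun i j => rot O (T i j) c), rot_sum]
  have h3 := sum_sq_first_slice_le hm hη T' hT' hB'
  simp only [htr] at h3
  rw [sum_norm_sq_rot hO, hrot3] at h3
  rw [h1]
  have h4 : (∑ b, ∑ c, inner ℝ (T' 0 b c) (rot O (fun j => rot O (F j) c) b)) ^ 2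
      ≤ (∑ b, ∑ c, ‖T' 0 b c‖ ^ 2) * ∑ j, ∑ k, ‖F j k‖ ^ 2 := by
    rw [← hrot2 F]
    simp only [← Finset.sum_product']
    exact sum_inner_sq_le _ (fun p : Fin (m + 1) × Fin (m + 1) => T' 0 p.1 p.2) _
  calc _ ≤ (1 + 1 / ((m : ℝ) - 1) - η)
        * ((∑ b, ∑ c, ‖T' 0 b c‖ ^ 2) * ∑ j, ∑ k, ‖F j k‖ ^ 2) := by gcongr
    _ = (∑ j, ∑ k, ‖F j k‖ ^ 2) * ((1 + 1 / ((m : ℝ) - 1) - η) *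
        ∑ b, ∑ c, ‖T' 0 b c‖ ^ 2) := by ring
    _ ≤ _ := by gcongr

end Kato

/-! ### The Kato inequalities for an arbitrary positive definite form -/

section BilinForm

variable {V : Type*} [AddCommGroup V] [Module ℝ V] (B : LinearMap.BilinForm ℝ V)

/-- The inner product given by a positive definite symmetric bilinear form. -/
@[reducible] def coreOfBilinForm (hsymm : ∀ a b, B a b = B b a)
    (hpos : ∀ a, a ≠ 0 → 0 < B a a) : InnerProductSpace.Core ℝ V where
  inner a b := B a b
  conj_inner_symm a b := by simp [hsymm a b]
  re_inner_nonneg a := by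
    by_cases h : a = 0
    · simp [h]
    · simpa using (hpos a h).le
  add_left a b c := by simp
  smul_left a b r := by simp
  definite a h := by
    by_contra h0
    exact (hpos a h0).ne' h

/-- The metric of the fibre varies with the point and is unrelated to the norm of the coordinate
space. Therefore `V` carries no norm here, and the inner product is installed locally from `B`. -/
theorem kato_one_form (hsymm : ∀ a b, B a b = B b a) (hpos : ∀ a, a ≠ 0 → 0 < B a a)
    {m : ℕ} (hm : 1 ≤ m) {η : ℝ} (hη : 0 < η) (hη1 : η ≤ 1)
    (T : Fin (m + 1) → Fin (m + 1) → V) (σ : Fin (m + 1) → V) :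
    (1 + 1 / (m : ℝ) - η) * ∑ i, (∑ j, B (T i j) (σ j)) ^ 2
      ≤ (∑ j, B (σ j) (σ j)) * (∑ i, ∑ j, B (T i j) (T i j)
      + 1 / η * (∑ i, ∑ j, B (T i j - T j i) (T i j - T j i)
        + B (∑ i, T i i) (∑ i, T i i))) := by
  let _ := (coreOfBilinForm B hsymm hpos).toNormedAddCommGroup
  let _ := InnerProductSpace.ofCore (coreOfBilinForm B hsymm hpos).toCore
  have h : ∀ a b : V, B a b = inner ℝ a b := fun _ _ => rfl
  simp only [h, real_inner_self_eq_norm_sq]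
  exact kato_one_form_inner hm hη hη1 T σ

theorem kato_two_form (hsymm : ∀ a b, B a b = B b a) (hpos : ∀ a, a ≠ 0 → 0 < B a a)
    {m : ℕ} (hm : 3 ≤ m) {η : ℝ} (hη : 0 < η) (hη1 : η ≤ 1)
    (T : Fin (m + 1) → Fin (m + 1) → Fin (m + 1) → V) (F : Fin (m + 1) → Fin (m + 1) → V)
    (hT : ∀ i j k, T i j k = -T i k j) (hB : ∀ i j k, T i j k + T j k i + T k i j = 0) :
    (1 + 1 / ((m : ℝ) - 1) - η) * ∑ i, (∑ j, ∑ k, B (T i j k) (F j k)) ^ 2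
      ≤ (∑ j, ∑ k, B (F j k) (F j k)) * (∑ i, ∑ j, ∑ k, B (T i j k) (T i j k)
      + 1 / η * ∑ j, B (∑ i, T i i j) (∑ i, T i i j)) := by
  let _ := (coreOfBilinForm B hsymm hpos).toNormedAddCommGroup
  let _ := InnerProductSpace.ofCore (coreOfBilinForm B hsymm hpos).toCore
  have h : ∀ a b : V, B a b = inner ℝ a b := fun _ _ => rfl
  simp only [h, real_inner_self_eq_norm_sq]
  exact kato_two_form_inner hm hη hη1 T F hT hB

end BilinForm

end YMH

namespace YMH

/-! ### Calculus on Euclidean space -/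

section Calculus

theorem two_le_infty : (2 : WithTop ℕ∞) ≤ ∞ := ENat.LEInfty.out

variable {E F G' : Type*} [NormedAddCommGroup E] [NormedSpace ℝ E]
  [NormedAddCommGroup F] [NormedSpace ℝ F] [NormedAddCommGroup G'] [NormedSpace ℝ G']

theorem fderiv_clm_apply_apply {c : E → F →L[ℝ] G'} {u : E → F} {x : E}
    (hc : DifferentiableAt ℝ c x) (hu : DifferentiableAt ℝ u x) (v : E) :
    fderiv ℝ (fun y => c y (u y)) x v = fderiv ℝ c x v (u x) + c x (fderiv ℝ u x v) := by
  rw [fderiv_clm_apply hc hu]; simp [add_comm]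

theorem fderiv_clm_apply_const {c : E → F →L[ℝ] G'} {x : E}
    (hc : DifferentiableAt ℝ c x) (u : F) (v : E) :
    fderiv ℝ (fun y => c y u) x v = fderiv ℝ c x v u := by
  rw [fderiv_clm_apply_apply hc (differentiableAt_const u)]; simp

theorem fderiv_comp_apply' {f : F → G'} {w : E → F} {x : E}
    (hf : DifferentiableAt ℝ f (w x)) (hw : DifferentiableAt ℝ w x) (v : E) :
    fderiv ℝ (fun y => f (w y)) x v = fderiv ℝ f (w x) (fderiv ℝ w x v) := by
  have := fderiv_comp x hf hw
  rw [show (fun y => f (w y)) = f ∘ w from rfl, this]; rfl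

theorem _root_.ContDiffOn.differentiableAt_of_isOpen {f : E → F} {s : Set E} (hf : ContDiffOn ℝ ∞ f s)
    (hs : IsOpen s) {x : E} (hx : x ∈ s) : DifferentiableAt ℝ f x :=
  (hf.contDiffAt (hs.mem_nhds hx)).differentiableAt (by simp)

theorem _root_.ContDiffOn.fderiv_infty {f : E → F} {s : Set E} (hf : ContDiffOn ℝ ∞ f s)
    (hs : IsOpen s) : ContDiffOn ℝ ∞ (fderiv ℝ f) s :=
  hf.fderiv_of_isOpen hs (by simp)

theorem fderiv_fderiv_comm {f : E → F} {s : Set E} (hf : ContDiffOn ℝ ∞ f s)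
    (hs : IsOpen s) {x : E} (hx : x ∈ s) (v w : E) :
    fderiv ℝ (fderiv ℝ f) x v w = fderiv ℝ (fderiv ℝ f) x w v :=
  ((hf.contDiffAt (hs.mem_nhds hx)).isSymmSndFDerivAt
    (by simp only [minSmoothness_of_isRCLikeNormedField]; exact two_le_infty)) v w

theorem _root_.Filter.EventuallyEq.fderiv_apply_eq {f g : E → F} {x : E} {s : Set E} (hs : IsOpen s)
    (hx : x ∈ s) (h : ∀ y ∈ s, f y = g y) : fderiv ℝ f x = fderiv ℝ g x :=
  Filter.EventuallyEq.fderiv_eq (Filter.eventually_of_mem (hs.mem_nhds hx) h)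

theorem laplacian_eq_sum {n : ℕ} {f : Eu n → ℝ} {x : Eu n} (hf : ContDiffAt ℝ 2 f x) :
    Δ f x = ∑ i, fderiv ℝ (fun y => fderiv ℝ f y (stdVec i)) x (stdVec i) := by
  rw [InnerProductSpace.laplacian_eq_iteratedFDeriv_orthonormalBasis f
    (EuclideanSpace.basisFun (Fin n) ℝ)]
  refine Finset.sum_congr rfl fun i _ => ?_
  have hd : DifferentiableAt ℝ (fderiv ℝ f) x :=
    (hf.fderiv_right (m := 1) (by norm_num)).differentiableAt (by simp)
  rw [iteratedFDeriv_two_apply, fderiv_clm_apply_const hd]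
  simp [stdVec]

end Calculus

/-! ### From Bochner and Kato to the Laplacian of a power -/

section PowerLaplacian

variable {n : ℕ}

theorem fderiv_rpow_apply {h : Eu n → ℝ} (hpos : ∀ y, 0 < h y) {x : Eu n}
    (hh : DifferentiableAt ℝ h x) (r : ℝ) (e : Eu n) :
    fderiv ℝ (fun y => h y ^ r) x e = r * h x ^ (r - 1) * fderiv ℝ h x e := by
  rw [(hh.hasFDerivAt.rpow_const (Or.inl (hpos x).ne')).fderiv]
  simp

theorem laplacian_rpow {h : Eu n → ℝ} (hpos : ∀ y, 0 < h y) {x : Eu n}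
    (hh : ContDiffAt ℝ 2 h x) (r : ℝ) :
    Δ (fun y => h y ^ r) x = r * h x ^ (r - 1) * Δ h x
      + r * (r - 1) * h x ^ (r - 2) * ∑ i, (fderiv ℝ h x (stdVec i)) ^ 2 := by
  have hcd : ContDiffAt ℝ 2 (fun y => h y ^ r) x := hh.rpow_const_of_ne (hpos x).ne'
  rw [laplacian_eq_sum hcd, laplacian_eq_sum hh, Finset.mul_sum, Finset.mul_sum,
    ← Finset.sum_add_distrib]
  refine Finset.sum_congr rfl fun i _ => ?_
  have hd : DifferentiableAt ℝ h x := hh.differentiableAt (by simp)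
  have hd2 : DifferentiableAt ℝ (fun y => fderiv ℝ h y (stdVec i)) x := by
    have : DifferentiableAt ℝ (fderiv ℝ h) x :=
      (hh.fderiv_right (m := 1) (by norm_num)).differentiableAt (by simp)
    exact this.clm_apply (differentiableAt_const _)
  have ev : (fun y => fderiv ℝ (fun y => h y ^ r) y (stdVec i))
      =ᶠ[nhds x] fun y => (r * h y ^ (r - 1)) * fderiv ℝ h y (stdVec i) := by
    filter_upwards [hh.eventually (by simp)] with y hy
    exact fderiv_rpow_apply hpos (hy.differentiableAt (by simp)) r _
  have hp : DifferentiableAt ℝ (fun y => h y ^ (r - 1)) x :=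
    (hd.hasFDerivAt.rpow_const (Or.inl (hpos x).ne')).differentiableAt
  rw [ev.fderiv_eq, fderiv_fun_mul (hp.const_mul r) hd2, fderiv_const_mul hp]
  simp only [add_apply, smul_apply, smul_eq_mul]
  rw [fderiv_rpow_apply hpos hd, show r - 1 - 1 = r - 2 by ring]
  ring

/-- With `q = |Y|²` and `T = |∇Y|²`, the hypothesis `hT` is the Bochner formula with its zeroth
order terms estimated and `hK` is the refined Kato inequality. The error `C * W * (q x + 1)` is paid
once in each, hence the factor `2` in the conclusion. -/
theorem laplacian_sqrt_rpow_ge {q : Eu n → ℝ} (hq : ∀ y, 0 ≤ q y) {x : Eu n}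
    (hqx : ContDiffAt ℝ 2 q x) {p T C W : ℝ} (hp : 0 ≤ p)
    (hT : T - C * W * (q x + 1) ≤ 1 / 2 * Δ q x)
    (hK : (2 - p) * ∑ i, (1 / 2 * fderiv ℝ q x (stdVec i)) ^ 2
      ≤ (q x + 1) * (T + C * W * (q x + 1))) :
    Δ (fun y => Real.sqrt (q y + 1) ^ p) x ≥ -(2 * C * p) * W * Real.sqrt (q x + 1) ^ p := by
  have hpos : ∀ y, 0 < q y + 1 := fun y => by linarith [hq y]
  have hs : ∀ y, Real.sqrt (q y + 1) ^ p = (q y + 1) ^ (p / 2) := fun y => by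
    rw [Real.sqrt_eq_rpow, ← Real.rpow_mul (hpos y).le]; ring_nf
  simp only [hs]
  have hcd : ContDiffAt ℝ 2 (fun y => q y + 1) x := hqx.add contDiffAt_const
  rw [laplacian_rpow hpos hcd]
  have hfd : ∀ y, fderiv ℝ (fun y => q y + 1) y = fderiv ℝ q y := fun y => fderiv_add_const 1
  have hlap : Δ (fun y => q y + 1) x = Δ q x := by
    rw [laplacian_eq_sum hcd, laplacian_eq_sum hqx]; simp only [hfd]
  rw [hlap, hfd]
  set g := q x + 1
  have hg : 0 < g := hpos x
  have e1 : g ^ (p / 2 - 1) = g ^ (p / 2) / g := by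
    rw [Real.rpow_sub hg, Real.rpow_one]
  have e2 : g ^ (p / 2 - 2) = g ^ (p / 2) / g / g := by
    rw [show p / 2 - 2 = p / 2 - 1 - 1 by ring, Real.rpow_sub hg, Real.rpow_one, e1]
  rw [e1, e2]
  have e3 : ∑ i, (1 / 2 * fderiv ℝ q x (stdVec i)) ^ 2
      = 1 / 4 * ∑ i, (fderiv ℝ q x (stdVec i)) ^ 2 := by
    rw [Finset.mul_sum]; exact Finset.sum_congr rfl fun i _ => by ring
  rw [e3] at hK
  set S := ∑ i, (fderiv ℝ q x (stdVec i)) ^ 2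
  have hP : 0 ≤ g ^ (p / 2) := (Real.rpow_pos_of_pos hg _).le
  have h1 : -(2 * C * W * g) ≤ 1 / 2 * Δ q x + (p - 2) * (1 / 4 * S) / g := by
    have : (2 - p) * (1 / 4 * S) / g ≤ T + C * W * g := by
      rw [div_le_iff₀ hg]; linarith
    have e : (p - 2) * (1 / 4 * S) / g = -((2 - p) * (1 / 4 * S) / g) := by ring
    rw [e]; linarith
  have h2 := mul_le_mul_of_nonneg_left h1 (by positivity : 0 ≤ p * g ^ (p / 2) / g)
  have e4 : p * g ^ (p / 2) / g * -(2 * C * W * g) = -(2 * C * p) * W * g ^ (p / 2) := by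
    field_simp
  have e5 : p * g ^ (p / 2) / g * (1 / 2 * Δ q x + (p - 2) * (1 / 4 * S) / g)
      = p / 2 * (g ^ (p / 2) / g) * Δ q x + p / 2 * (p / 2 - 1) * (g ^ (p / 2) / g / g) * S := by
    field_simp; ring
  linarith

end PowerLaplacian

/-! ### Metric connections on trivial vector bundles -/

section Connection

variable {E V : Type*} [NormedAddCommGroup E] [NormedSpace ℝ E]
  [NormedAddCommGroup V] [NormedSpace ℝ V]

/-- The covariant derivative `∂_v Y + M(v) Y`. -/
noncomputable def covD (M : E → E →L[ℝ] V →L[ℝ] V) (v : E) (Y : E → V) (x : E) : V :=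
  fderiv ℝ Y x v + M x v (Y x)

variable {M : E → E →L[ℝ] V →L[ℝ] V} {Ω : Set E} {Y Z : E → V}

theorem contDiffOn_covD (hΩ : IsOpen Ω) (hM : ContDiffOn ℝ ∞ M Ω) (hY : ContDiffOn ℝ ∞ Y Ω)
    (v : E) : ContDiffOn ℝ ∞ (covD M v Y) Ω :=
  ((hY.fderiv_infty hΩ).clm_apply contDiffOn_const).add
    ((hM.clm_apply contDiffOn_const).clm_apply hY)

theorem covD_congr (hΩ : IsOpen Ω) {x : E} (hx : x ∈ Ω) (h : ∀ y ∈ Ω, Y y = Z y) (v : E) :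
    covD M v Y x = covD M v Z x := by
  rw [covD, covD, Filter.EventuallyEq.fderiv_apply_eq hΩ hx h, h x hx]

theorem covD_add {x : E} (hY : DifferentiableAt ℝ Y x) (hZ : DifferentiableAt ℝ Z x) (v : E) :
    covD M v (fun y => Y y + Z y) x = covD M v Y x + covD M v Z x := by
  simp only [covD]; rw [fderiv_fun_add hY hZ]; simp; abel

theorem covD_neg {x : E} (v : E) :
    covD M v (fun y => -Y y) x = -covD M v Y x := by
  simp only [covD]; rw [fderiv_fun_neg]; simp; abel

theorem covD_sum {ι : Type*} (s : Finset ι) {Y : ι → E → V} {x : E}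
    (hY : ∀ i ∈ s, DifferentiableAt ℝ (Y i) x) (v : E) :
    covD M v (fun y => ∑ i ∈ s, Y i y) x = ∑ i ∈ s, covD M v (Y i) x := by
  simp only [covD]; rw [fderiv_fun_sum hY]
  simp [Finset.sum_add_distrib]

theorem covD_comm (hΩ : IsOpen Ω) (hM : ContDiffOn ℝ ∞ M Ω) (hY : ContDiffOn ℝ ∞ Y Ω)
    {x : E} (hx : x ∈ Ω) (v w : E) :
    covD M v (covD M w Y) x - covD M w (covD M v Y) x
      = (fderiv ℝ M x v w - fderiv ℝ M x w v) (Y x)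
        + (M x v (M x w (Y x)) - M x w (M x v (Y x))) := by
  have hYx := hY.differentiableAt_of_isOpen hΩ hx
  have hMx := hM.differentiableAt_of_isOpen hΩ hx
  have hY' := (hY.fderiv_infty hΩ).differentiableAt_of_isOpen hΩ hx
  have key : ∀ v w, covD M v (covD M w Y) x = fderiv ℝ (fderiv ℝ Y) x v w
      + fderiv ℝ M x v w (Y x) + M x w (fderiv ℝ Y x v)
      + M x v (fderiv ℝ Y x w) + M x v (M x w (Y x)) := by
    intro v w
    have h1 : fderiv ℝ (covD M w Y) x v = fderiv ℝ (fderiv ℝ Y) x v w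
        + (fderiv ℝ M x v w (Y x) + M x w (fderiv ℝ Y x v)) := by
      have hMw : DifferentiableAt ℝ (fun y => M y w) x := hMx.clm_apply (differentiableAt_const _)
      rw [show covD M w Y = fun y => fderiv ℝ Y y w + M y w (Y y) from rfl,
        fderiv_fun_add (hY'.clm_apply (differentiableAt_const _)) (hMw.clm_apply hYx),
        add_apply, fderiv_clm_apply_const hY',
        fderiv_clm_apply_apply hMw hYx, fderiv_clm_apply_const hMx]
    rw [covD, h1, covD, map_add]; abel
  rw [key, key, fderiv_fderiv_comm hY hΩ hx v w, sub_apply]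
  abel

/-- `M` is a metric connection for `g` on `Ω`. -/
def IsMetricConnection (g : E → V →L[ℝ] V →L[ℝ] ℝ) (M : E → E →L[ℝ] V →L[ℝ] V) (Ω : Set E) :
    Prop :=
  ∀ x ∈ Ω, ∀ v a b, fderiv ℝ g x v a b = g x (M x v a) b + g x a (M x v b)

variable {g : E → V →L[ℝ] V →L[ℝ] ℝ}

theorem fderiv_metric (hΩ : IsOpen Ω) (hg : ContDiffOn ℝ ∞ g Ω) (hM : IsMetricConnection g M Ω)
    (hY : ContDiffOn ℝ ∞ Y Ω) (hZ : ContDiffOn ℝ ∞ Z Ω) {x : E} (hx : x ∈ Ω) (v : E) :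
    fderiv ℝ (fun y => g y (Y y) (Z y)) x v
      = g x (covD M v Y x) (Z x) + g x (Y x) (covD M v Z x) := by
  have hgx := hg.differentiableAt_of_isOpen hΩ hx
  have hYx := hY.differentiableAt_of_isOpen hΩ hx
  have hZx := hZ.differentiableAt_of_isOpen hΩ hx
  rw [fderiv_clm_apply_apply (hgx.clm_apply hYx) hZx, fderiv_clm_apply_apply hgx hYx]
  simp only [covD, add_apply, map_add, hM x hx]
  ring

theorem contDiffOn_metric (hg : ContDiffOn ℝ ∞ g Ω) (hY : ContDiffOn ℝ ∞ Y Ω)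
    (hZ : ContDiffOn ℝ ∞ Z Ω) : ContDiffOn ℝ ∞ (fun y => g y (Y y) (Z y)) Ω :=
  (hg.clm_apply hY).clm_apply hZ

theorem fderiv_fderiv_metric_self (hΩ : IsOpen Ω) (hg : ContDiffOn ℝ ∞ g Ω)
    (hs : ∀ x ∈ Ω, ∀ a b, g x a b = g x b a) (hM : IsMetricConnection g M Ω)
    (hMs : ContDiffOn ℝ ∞ M Ω) (hY : ContDiffOn ℝ ∞ Y Ω) {x : E} (hx : x ∈ Ω) (v : E) :
    fderiv ℝ (fun y => fderiv ℝ (fun y => g y (Y y) (Y y)) y v) x v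
      = 2 * (g x (covD M v (covD M v Y) x) (Y x) + g x (covD M v Y x) (covD M v Y x)) := by
  have h1 : ∀ y ∈ Ω, fderiv ℝ (fun y => g y (Y y) (Y y)) y v
      = 2 * g y (covD M v Y y) (Y y) := fun y hy => by
    rw [fderiv_metric hΩ hg hM hY hY hy, hs y hy (Y y)]; ring
  have hY1 := contDiffOn_covD hΩ hMs hY v
  rw [Filter.EventuallyEq.fderiv_apply_eq hΩ hx h1, fderiv_const_mul
    ((contDiffOn_metric hg hY1 hY).differentiableAt_of_isOpen hΩ hx),
    smul_apply, fderiv_metric hΩ hg hM hY1 hY hx, smul_eq_mul]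

/-- The Laplacian of the squared norm of a finite family of sections. -/
theorem half_laplacian_sum_metric {n : ℕ} {ι : Type*} (s : Finset ι) {Ω : Set (Eu n)}
    {M : Eu n → Eu n →L[ℝ] V →L[ℝ] V} {g : Eu n → V →L[ℝ] V →L[ℝ] ℝ} {Y : ι → Eu n → V}
    (hΩ : IsOpen Ω) (hg : ContDiffOn ℝ ∞ g Ω)
    (hs : ∀ x ∈ Ω, ∀ a b, g x a b = g x b a) (hM : IsMetricConnection g M Ω)
    (hMs : ContDiffOn ℝ ∞ M Ω) (hY : ∀ i, ContDiffOn ℝ ∞ (Y i) Ω) {x : Eu n} (hx : x ∈ Ω) :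
    1 / 2 * Δ (fun y => ∑ i ∈ s, g y (Y i y) (Y i y)) x
      = ∑ l, ∑ i ∈ s, g x (covD M (stdVec l) (Y i) x) (covD M (stdVec l) (Y i) x)
        + ∑ i ∈ s, g x (∑ l, covD M (stdVec l) (covD M (stdVec l) (Y i)) x) (Y i x) := by
  have hc : ∀ i, ContDiffOn ℝ ∞ (fun y => g y (Y i y) (Y i y)) Ω := fun i =>
    contDiffOn_metric hg (hY i) (hY i)
  have hcs : ContDiffOn ℝ ∞ (fun y => ∑ i ∈ s, g y (Y i y) (Y i y)) Ω :=
    ContDiffOn.sum fun i _ => hc i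
  rw [laplacian_eq_sum ((hcs.contDiffAt (hΩ.mem_nhds hx)).of_le two_le_infty)]
  have h1 : ∀ l, fderiv ℝ (fun y => fderiv ℝ (fun y => ∑ i ∈ s, g y (Y i y) (Y i y)) y (stdVec l)) x
      (stdVec l) = ∑ i ∈ s, 2 * (g x (covD M (stdVec l) (covD M (stdVec l) (Y i)) x) (Y i x)
        + g x (covD M (stdVec l) (Y i) x) (covD M (stdVec l) (Y i) x)) := by
    intro l
    have h2 : ∀ y ∈ Ω, fderiv ℝ (fun y => ∑ i ∈ s, g y (Y i y) (Y i y)) y (stdVec l)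
        = ∑ i ∈ s, fderiv ℝ (fun y => g y (Y i y) (Y i y)) y (stdVec l) := fun y hy => by
      rw [fderiv_fun_sum fun i _ => (hc i).differentiableAt_of_isOpen hΩ hy]
      simp
    rw [Filter.EventuallyEq.fderiv_apply_eq hΩ hx h2, fderiv_fun_sum]
    · simp only [sum_apply]
      exact Finset.sum_congr rfl fun i _ => fderiv_fderiv_metric_self hΩ hg hs hM hMs (hY i) hx _
    · intro i _
      exact (((hc i).fderiv_infty hΩ).clm_apply contDiffOn_const).differentiableAt_of_isOpen hΩ hx
  simp only [h1, map_sum, sum_apply, Finset.mul_sum]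
  rw [Finset.sum_comm (s := s), ← Finset.sum_add_distrib]
  refine Finset.sum_congr rfl fun l _ => ?_
  rw [← Finset.sum_add_distrib]
  exact Finset.sum_congr rfl fun i _ => by ring

theorem half_fderiv_sum_metric {ι : Type*} (s : Finset ι) {Y : ι → E → V}
    (hΩ : IsOpen Ω) (hg : ContDiffOn ℝ ∞ g Ω)
    (hs : ∀ x ∈ Ω, ∀ a b, g x a b = g x b a) (hM : IsMetricConnection g M Ω)
    (hY : ∀ i, ContDiffOn ℝ ∞ (Y i) Ω) {x : E} (hx : x ∈ Ω) (v : E) :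
    1 / 2 * fderiv ℝ (fun y => ∑ i ∈ s, g y (Y i y) (Y i y)) x v
      = ∑ i ∈ s, g x (covD M v (Y i) x) (Y i x) := by
  rw [fderiv_fun_sum fun i _ => (contDiffOn_metric hg (hY i) (hY i)).differentiableAt_of_isOpen hΩ hx]
  simp only [sum_apply, Finset.mul_sum]
  refine Finset.sum_congr rfl fun i _ => ?_
  rw [fderiv_metric hΩ hg hM (hY i) (hY i) hx, hs x hx (Y i x)]; ring

end Connection

end YMH

namespace YMH

noncomputable section

/-! ### Connections with structure Lie algebra `W` -/

section Gauge

variable {E W : Type*} [NormedAddCommGroup E] [NormedSpace ℝ E]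
  [NormedAddCommGroup W] [NormedSpace ℝ W]

/-- `br` is a Lie bracket and `B` an invariant inner product for it. -/
structure IsMetricLieBracket (br : W →L[ℝ] W →L[ℝ] W) (B : W →L[ℝ] W →L[ℝ] ℝ) : Prop where
  skew : ∀ a b, br a b = -br b a
  jacobi : ∀ a b c, br a (br b c) = br (br a b) c + br b (br a c)
  symm : ∀ a b, B a b = B b a
  pos : ∀ a, a ≠ 0 → 0 < B a a
  invariant : ∀ a b c, B (br a b) c + B b (br a c) = 0

/-- The curvature `dA + ½[A, A]` for the bracket `br`. -/
def curv (br : W →L[ℝ] W →L[ℝ] W) (A : E → E →L[ℝ] W) (v w : E) (x : E) : W :=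
  fderiv ℝ A x v w - fderiv ℝ A x w v + br (A x v) (A x w)

/-- The connection `d + [A, ·]`. -/
def adConn (br : W →L[ℝ] W →L[ℝ] W) (A : E → E →L[ℝ] W) (x : E) : E →L[ℝ] W →L[ℝ] W :=
  br.comp (A x)

variable {br : W →L[ℝ] W →L[ℝ] W} {B : W →L[ℝ] W →L[ℝ] ℝ} {A : E → E →L[ℝ] W} {Ω : Set E}

@[simp] theorem adConn_apply (x v : E) (c : W) : adConn br A x v c = br (A x v) c := rfl

theorem contDiffOn_adConn (hA : ContDiffOn ℝ ∞ A Ω) : ContDiffOn ℝ ∞ (adConn br A) Ω :=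
  contDiffOn_const.clm_comp hA

theorem contDiffOn_curv (hΩ : IsOpen Ω) (hA : ContDiffOn ℝ ∞ A Ω) (v w : E) :
    ContDiffOn ℝ ∞ (curv br A v w) Ω := by
  have h := hA.fderiv_infty hΩ
  exact (((h.clm_apply contDiffOn_const).clm_apply contDiffOn_const).sub
    ((h.clm_apply contDiffOn_const).clm_apply contDiffOn_const)).add
    ((contDiffOn_const.clm_apply (hA.clm_apply contDiffOn_const)).clm_apply
      (hA.clm_apply contDiffOn_const))

theorem fderiv_clm_apply₂ {F₁ F₂ H : Type*} [NormedAddCommGroup F₁] [NormedSpace ℝ F₁]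
    [NormedAddCommGroup F₂] [NormedSpace ℝ F₂] [NormedAddCommGroup H] [NormedSpace ℝ H]
    {c : E → F₁ →L[ℝ] F₂ →L[ℝ] H} {u : E → F₁} {v : E → F₂} {x : E}
    (hc : DifferentiableAt ℝ c x) (hu : DifferentiableAt ℝ u x) (hv : DifferentiableAt ℝ v x)
    (e : E) : fderiv ℝ (fun y => c y (u y) (v y)) x e
      = fderiv ℝ c x e (u x) (v x) + c x (fderiv ℝ u x e) (v x) + c x (u x) (fderiv ℝ v x e) := by
  rw [fderiv_clm_apply_apply (hc.clm_apply hu) hv, fderiv_clm_apply_apply hc hu]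
  simp

theorem fderiv_curv (hΩ : IsOpen Ω) (hA : ContDiffOn ℝ ∞ A Ω) {x : E} (hx : x ∈ Ω) (u v w : E) :
    fderiv ℝ (curv br A v w) x u
      = fderiv ℝ (fderiv ℝ A) x u v w - fderiv ℝ (fderiv ℝ A) x u w v
        + br (fderiv ℝ A x u v) (A x w) + br (A x v) (fderiv ℝ A x u w) := by
  have hA0 := hA.differentiableAt_of_isOpen hΩ hx
  have hA1 := (hA.fderiv_infty hΩ).differentiableAt_of_isOpen hΩ hx
  have h0 : ∀ v, DifferentiableAt ℝ (fun y => A y v) x :=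
    fun v => hA0.clm_apply (differentiableAt_const _)
  have h1 : ∀ v w, DifferentiableAt ℝ (fun y => fderiv ℝ A y v w) x := fun v w =>
    (hA1.clm_apply (differentiableAt_const _)).clm_apply (differentiableAt_const _)
  have e1 : ∀ v w, fderiv ℝ (fun y => fderiv ℝ A y v w) x u = fderiv ℝ (fderiv ℝ A) x u v w := by
    intro v w
    rw [fderiv_clm_apply₂ hA1 (differentiableAt_const _) (differentiableAt_const _)]; simp
  have h2 : DifferentiableAt ℝ (fun y => br (A y v) (A y w)) x :=
    ((differentiableAt_const br).clm_apply (h0 v)).clm_apply (h0 w)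
  rw [show curv br A v w = fun y => (fderiv ℝ A y v w - fderiv ℝ A y w v) + br (A y v) (A y w)
    from rfl, fderiv_fun_add ((h1 v w).fun_sub (h1 w v)) h2, fderiv_fun_sub (h1 v w) (h1 w v),
    add_apply, sub_apply, e1, e1, fderiv_clm_apply₂ (differentiableAt_const _) (h0 v) (h0 w),
    fderiv_clm_apply_const hA0, fderiv_clm_apply_const hA0]
  simp; abel

theorem curv_skew (hb : IsMetricLieBracket br B) (v w x : E) :
    curv br A v w x = -curv br A w v x := by
  simp only [curv]; rw [hb.skew (A x w)]; abel

/-- The second derivatives of `A` cancel by their symmetry, the terms `[dA, A]` by skewness of the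
bracket, and the cubic terms by the Jacobi identity. -/
theorem bianchi (hb : IsMetricLieBracket br B) (hΩ : IsOpen Ω) (hA : ContDiffOn ℝ ∞ A Ω) {x : E}
    (hx : x ∈ Ω) (u v w : E) :
    covD (adConn br A) u (curv br A v w) x + covD (adConn br A) v (curv br A w u) x
      + covD (adConn br A) w (curv br A u v) x = 0 := by
  simp only [covD, fderiv_curv hΩ hA hx, adConn_apply, curv, map_add, map_sub]
  have s := fun a b => congrArg (fun L : E →L[ℝ] W => L) (fderiv_fderiv_comm hA hΩ hx a b)
  rw [s v u, s w u, s w v]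
  have j := hb.jacobi (A x u) (A x v) (A x w)
  rw [hb.skew (br (A x u) (A x v)), hb.skew (A x u) (A x w), map_neg] at j
  rw [hb.skew (fderiv ℝ A x u v), hb.skew (fderiv ℝ A x v w), hb.skew (fderiv ℝ A x w u)]
  linear_combination (norm := module) j

/-- By the Jacobi identity the commutator of `ad A(v)` and `ad A(w)` is `ad [A(v), A(w)]`, so the
curvature of `d + ad A` is `ad F_A`. -/
theorem covD_adConn_comm (hb : IsMetricLieBracket br B) (hΩ : IsOpen Ω) (hA : ContDiffOn ℝ ∞ A Ω)
    {Y : E → W} (hY : ContDiffOn ℝ ∞ Y Ω) {x : E} (hx : x ∈ Ω) (v w : E) :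
    covD (adConn br A) v (covD (adConn br A) w Y) x
      = covD (adConn br A) w (covD (adConn br A) v Y) x + br (curv br A v w x) (Y x) := by
  have h := covD_comm hΩ (contDiffOn_adConn (br := br) hA) hY hx v w
  have hA0 := hA.differentiableAt_of_isOpen hΩ hx
  have hM0 := (contDiffOn_adConn (br := br) hA).differentiableAt_of_isOpen hΩ hx
  have e : ∀ v w c, fderiv ℝ (adConn br A) x v w c = br (fderiv ℝ A x v w) c := by
    intro v w c
    have h1 : fderiv ℝ (fun y => adConn br A y w c) x v = fderiv ℝ (adConn br A) x v w c := by
      rw [fderiv_clm_apply₂ hM0 (differentiableAt_const _) (differentiableAt_const _)]; simp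
    rw [← h1]
    simp only [adConn_apply]
    rw [fderiv_clm_apply₂ (differentiableAt_const _) (hA0.clm_apply (differentiableAt_const _))
      (differentiableAt_const _), fderiv_clm_apply_const hA0]
    simp
  rw [sub_apply, e, e] at h
  simp only [adConn_apply] at h
  have j := hb.jacobi (A x v) (A x w) (Y x)
  simp only [curv, map_add, map_sub, add_apply, sub_apply]
  linear_combination (norm := module) h + j

theorem isMetricConnection_adConn (hb : IsMetricLieBracket br B) :
    IsMetricConnection (fun _ => B) (adConn br A) Ω := by
  intro x _ v a b
  simp only [adConn_apply, hb.invariant]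
  simp

/-- The divergence `∑ₗ D_l F(e_l, v)`. -/
def divCurv {n : ℕ} (br : W →L[ℝ] W →L[ℝ] W) (A : Eu n → Eu n →L[ℝ] W) (v x : Eu n) : W :=
  ∑ l, covD (adConn br A) (stdVec l) (curv br A (stdVec l) v) x

theorem contDiffOn_divCurv {n : ℕ} {A : Eu n → Eu n →L[ℝ] W} {Ω : Set (Eu n)} (hΩ : IsOpen Ω)
    (hA : ContDiffOn ℝ ∞ A Ω) (v : Eu n) : ContDiffOn ℝ ∞ (divCurv br A v) Ω :=
  ContDiffOn.sum fun _ _ => contDiffOn_covD hΩ (contDiffOn_adConn hA) (contDiffOn_curv hΩ hA _ _) _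

/-- The Weitzenböck formula for the curvature. -/
theorem sum_covD_covD_curv {n : ℕ} {A : Eu n → Eu n →L[ℝ] W} {Ω : Set (Eu n)}
    (hb : IsMetricLieBracket br B) (hΩ : IsOpen Ω) (hA : ContDiffOn ℝ ∞ A Ω) {x : Eu n}
    (hx : x ∈ Ω) (v w : Eu n) :
    ∑ l, covD (adConn br A) (stdVec l) (covD (adConn br A) (stdVec l) (curv br A v w)) x
      = covD (adConn br A) v (divCurv br A w) x - covD (adConn br A) w (divCurv br A v) x
        + (2 : ℝ) • ∑ l, br (curv br A (stdVec l) v x) (curv br A (stdVec l) w x) := by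
  have hM := contDiffOn_adConn (br := br) hA
  have hF := fun v w => contDiffOn_curv (br := br) hΩ hA v w
  have hD := fun l v w => contDiffOn_covD hΩ hM (hF v w) l
  have e1 : ∀ v w, covD (adConn br A) v (divCurv br A w) x
      = ∑ l, covD (adConn br A) v (covD (adConn br A) (stdVec l) (curv br A (stdVec l) w)) x :=
    fun v w => covD_sum _ (fun i _ => (hD _ _ _).differentiableAt_of_isOpen hΩ hx) v
  rw [e1, e1, Finset.smul_sum, ← Finset.sum_sub_distrib, ← Finset.sum_add_distrib]
  refine Finset.sum_congr rfl fun l _ => ?_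
  -- The Bianchi identity moves the inner derivative off the index `l`. Commuting the outer
  -- derivative past it then yields two divergences and two brackets, which coincide by skewness and
  -- give the factor `2`.
  have e2 : ∀ y ∈ Ω, covD (adConn br A) (stdVec l) (curv br A v w) y
      = covD (adConn br A) v (curv br A (stdVec l) w) y
        + -covD (adConn br A) w (curv br A (stdVec l) v) y := by
    intro y hy
    have h1 := bianchi hb hΩ hA hy (stdVec l) v w
    have h2 : covD (adConn br A) v (curv br A w (stdVec l)) y
        = -covD (adConn br A) v (curv br A (stdVec l) w) y := by
      rw [← covD_neg]
      exact covD_congr hΩ hy (fun z _ => curv_skew hb _ _ _) v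
    rw [h2] at h1
    linear_combination (norm := module) h1
  rw [covD_congr hΩ hx e2, covD_add ((hD _ _ _).differentiableAt_of_isOpen hΩ hx)
    ((hD _ _ _).neg.differentiableAt_of_isOpen hΩ hx), covD_neg,
    covD_adConn_comm hb hΩ hA (hF _ _) hx _ v, covD_adConn_comm hb hΩ hA (hF _ _) hx _ w,
    hb.skew (curv br A (stdVec l) w x)]
  module

end Gauge

end

end YMH

namespace YMH

noncomputable section

/-! ### Killing fields of a Riemannian metric on an open set, and maps into it -/

section Fibre

set_option maxSynthPendingDepth 3

variable {D W : Type*} [NormedAddCommGroup D] [NormedSpace ℝ D]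
  [NormedAddCommGroup W] [NormedSpace ℝ W]

/-- A Riemannian metric `g` on `U` with Levi-Civita connection `Γ` and a Lie algebra `W` of
infinitesimal isometries `z ↦ X z c`. -/
structure IsIsometricLieAction (U : Set D) (g : D → D →L[ℝ] D →L[ℝ] ℝ) (Γ : D → D →L[ℝ] D →L[ℝ] D)
    (X : D → W →L[ℝ] D) (br : W →L[ℝ] W →L[ℝ] W) : Prop where
  isOpen : IsOpen U
  smooth_metric : ContDiffOn ℝ ∞ g U
  smooth_conn : ContDiffOn ℝ ∞ Γ U
  smooth_action : ContDiffOn ℝ ∞ X U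
  symm : ∀ z ∈ U, ∀ a b, g z a b = g z b a
  pos : ∀ z ∈ U, ∀ a, a ≠ 0 → 0 < g z a a
  torsionFree : ∀ z ∈ U, ∀ a b, Γ z a b = Γ z b a
  metric : ∀ z ∈ U, ∀ c a b, fderiv ℝ g z c a b = g z (Γ z c a) b + g z a (Γ z c b)
  killing : ∀ z ∈ U, ∀ c a b,
    fderiv ℝ g z (X z c) a b + g z (fderiv ℝ X z a c) b + g z a (fderiv ℝ X z b c) = 0
  bracket : ∀ z ∈ U, ∀ a b,
    fderiv ℝ X z (X z b) a - fderiv ℝ X z (X z a) b = X z (br a b)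

/-- The covariant derivative `∇_a X_c`. -/
def covKilling (Γ : D → D →L[ℝ] D →L[ℝ] D) (X : D → W →L[ℝ] D) (z : D) : D →L[ℝ] W →L[ℝ] D :=
  fderiv ℝ X z + ((ContinuousLinearMap.compL ℝ W D D).flip (X z)).comp (Γ z)

/-- The Riemann curvature tensor `R(a, b) e` of the connection `Γ`. -/
def riem (Γ : D → D →L[ℝ] D →L[ℝ] D) (z a b e : D) : D :=
  fderiv ℝ Γ z a b e - fderiv ℝ Γ z b a e + (Γ z a (Γ z b e) - Γ z b (Γ z a e))

variable {U : Set D} {g : D → D →L[ℝ] D →L[ℝ] ℝ} {Γ : D → D →L[ℝ] D →L[ℝ] D}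
    {X : D → W →L[ℝ] D} {br : W →L[ℝ] W →L[ℝ] W}

@[simp] theorem covKilling_apply (z a : D) (c : W) :
    covKilling Γ X z a c = fderiv ℝ X z a c + Γ z a (X z c) := rfl

theorem eq_of_forall_metric_eq {z : D} (pos : ∀ a, a ≠ 0 → 0 < g z a a) {a b : D}
    (h : ∀ t, g z a t = g z b t) : a = b := by
  by_contra hne
  have := pos (a - b) (sub_ne_zero.mpr hne)
  have h2 : g z (a - b) (a - b) = 0 := by
    rw [(g z).map_sub, sub_apply, h, sub_self]
  linarith

/-- Infinitesimal isometries are affine. -/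
theorem IsIsometricLieAction.affine (H : IsIsometricLieAction U g Γ X br) {z : D} (hz : z ∈ U)
    (a b : D) (c : W) :
    fderiv ℝ (fderiv ℝ X) z a b c + fderiv ℝ Γ z (X z c) a b + Γ z (fderiv ℝ X z a c) b
      + Γ z a (fderiv ℝ X z b c) - fderiv ℝ X z (Γ z a b) c = 0 := by
  have hU := H.isOpen
  have dg := H.smooth_metric.differentiableAt_of_isOpen hU hz
  have ddg := (H.smooth_metric.fderiv_infty hU).differentiableAt_of_isOpen hU hz
  have dX := H.smooth_action.differentiableAt_of_isOpen hU hz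
  have ddX := (H.smooth_action.fderiv_infty hU).differentiableAt_of_isOpen hU hz
  have dΓ := H.smooth_conn.differentiableAt_of_isOpen hU hz
  have dc : ∀ v : D, DifferentiableAt ℝ (fun _ : D => v) z := fun v => differentiableAt_const v
  have dw : DifferentiableAt ℝ (fun _ : D => c) z := differentiableAt_const c
  have s2X := fun a b => fderiv_fderiv_comm H.smooth_action hU hz a b
  have s2g := fun a b => fderiv_fderiv_comm H.smooth_metric hU hz a b
  -- the derivative of the Killing equation
  have K : ∀ e a b : D,
      fderiv ℝ (fderiv ℝ g) z e (X z c) a b + fderiv ℝ g z (fderiv ℝ X z e c) a b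
      + fderiv ℝ g z e (fderiv ℝ X z a c) b + g z (fderiv ℝ (fderiv ℝ X) z e a c) b
      + fderiv ℝ g z e a (fderiv ℝ X z b c) + g z a (fderiv ℝ (fderiv ℝ X) z e b c) = 0 := by
    intro e a b
    have h0 : fderiv ℝ (fun z => fderiv ℝ g z (X z c) a b + g z (fderiv ℝ X z a c) b
        + g z a (fderiv ℝ X z b c)) z e = 0 := by
      rw [Filter.EventuallyEq.fderiv_apply_eq (g := fun _ => (0 : ℝ)) hU hz
        fun y hy => H.killing y hy c a b]
      simp
    have dXc : DifferentiableAt ℝ (fun z => X z c) z := dX.clm_apply dw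
    have dXa : ∀ a, DifferentiableAt ℝ (fun z => fderiv ℝ X z a c) z := fun a =>
      (ddX.clm_apply (dc a)).clm_apply dw
    have dgX : DifferentiableAt ℝ (fun z => fderiv ℝ g z (X z c)) z := ddg.clm_apply dXc
    have e1 : ∀ a, fderiv ℝ (fun z => fderiv ℝ X z a c) z e = fderiv ℝ (fderiv ℝ X) z e a c := by
      intro a; rw [fderiv_clm_apply₂ ddX (dc a) dw]; simp
    rw [fderiv_fun_add (((dgX.clm_apply (dc a)).clm_apply (dc b)).fun_add
        ((dg.clm_apply (dXa a)).clm_apply (dc b))) ((dg.clm_apply (dc a)).clm_apply (dXa b)),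
      fderiv_fun_add ((dgX.clm_apply (dc a)).clm_apply (dc b))
        ((dg.clm_apply (dXa a)).clm_apply (dc b)),
      add_apply, add_apply, fderiv_clm_apply₂ dgX (dc a) (dc b),
      fderiv_clm_apply₂ dg (dXa a) (dc b), fderiv_clm_apply₂ dg (dc a) (dXa b),
      fderiv_clm_apply_apply ddg dXc, fderiv_clm_apply_const dX, e1, e1] at h0
    simp only [fderiv_fun_const, Pi.zero_apply, zero_apply, map_zero, add_zero, add_apply]
      at h0
    linarith
  -- the Koszul formula
  have Z : ∀ y ∈ U, ∀ a b t, fderiv ℝ g y a b t + fderiv ℝ g y b a t - fderiv ℝ g y t a b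
      = 2 * g y (Γ y a b) t := by
    intro y hy a b t
    rw [H.metric y hy, H.metric y hy, H.metric y hy, H.torsionFree y hy b a,
      H.torsionFree y hy t a, H.torsionFree y hy t b, H.symm y hy (Γ y a t) b]
    ring
  have L : ∀ a b t e, fderiv ℝ (fderiv ℝ g) z e a b t + fderiv ℝ (fderiv ℝ g) z e b a t
      - fderiv ℝ (fderiv ℝ g) z e t a b
      = 2 * (fderiv ℝ g z e (Γ z a b) t + g z (fderiv ℝ Γ z e a b) t) := by
    intro a b t e
    have dga : ∀ a, DifferentiableAt ℝ (fun z => fderiv ℝ g z a) z := fun a => ddg.clm_apply (dc a)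
    have dgab : ∀ a b t, DifferentiableAt ℝ (fun z => fderiv ℝ g z a b t) z := fun a b t =>
      ((dga a).clm_apply (dc b)).clm_apply (dc t)
    have h1 : ∀ a b t, fderiv ℝ (fun z => fderiv ℝ g z a b t) z e
        = fderiv ℝ (fderiv ℝ g) z e a b t := by
      intro a b t
      rw [fderiv_clm_apply₂ (dga a) (dc b) (dc t), fderiv_clm_apply_const ddg]; simp
    have dG : DifferentiableAt ℝ (fun z => Γ z a b) z := (dΓ.clm_apply (dc a)).clm_apply (dc b)
    have h2 : fderiv ℝ (fun z => 2 * g z (Γ z a b) t) z e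
        = 2 * (fderiv ℝ g z e (Γ z a b) t + g z (fderiv ℝ Γ z e a b) t) := by
      rw [fderiv_const_mul ((dg.clm_apply dG).clm_apply (dc t)), smul_apply,
        fderiv_clm_apply₂ dg dG (dc t), fderiv_clm_apply₂ dΓ (dc a) (dc b)]
      simp
    rw [← h2, ← Filter.EventuallyEq.fderiv_apply_eq hU hz fun y hy => Z y hy a b t,
      fderiv_fun_sub ((dgab a b t).fun_add (dgab b a t)) (dgab t a b),
      fderiv_fun_add (dgab a b t) (dgab b a t)]
    simp [h1]
  refine eq_of_forall_metric_eq (H.pos z hz) fun t => ?_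
  -- The Koszul combination `k1 + k2 - k3` of differentiated Killing equations is compared with the
  -- derivative `l` of the Koszul formula along `X_c`. The Koszul formula at the arguments moved by
  -- `∂X_c` (`z1`, `z2`, `z3`) and the Killing equation `kk` convert what remains into `Γ`.
  have k1 := K a b t
  have k2 := K b a t
  have k3 := K t a b
  have l := L a b t (X z c)
  rw [s2g (X z c) a, s2g (X z c) b, s2g (X z c) t] at l
  rw [s2X b a] at k2
  rw [s2X t a, s2X t b] at k3
  have z1 := Z z hz (fderiv ℝ X z a c) b t
  have z2 := Z z hz a (fderiv ℝ X z b c) t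
  have z3 := Z z hz a b (fderiv ℝ X z t c)
  have kk := H.killing z hz c (Γ z a b) t
  have y1 : ∀ e a b, fderiv ℝ g z e a b = fderiv ℝ g z e b a := by
    intro e a b
    rw [H.metric z hz, H.metric z hz, H.symm z hz a, H.symm z hz b]; ring
  rw [H.symm z hz b] at k1
  rw [H.symm z hz a] at k2
  rw [H.symm z hz a] at k3
  rw [y1 t a (fderiv ℝ X z b c)] at *
  simp only [map_add, map_sub, add_apply, sub_apply, map_zero, zero_apply]
  linarith

/-- The bracket relation holds on an open set and may be differentiated. In the curvature of
`pullConn` this accounts for the terms quadratic in the connection form. -/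
theorem IsIsometricLieAction.fderiv_bracket (H : IsIsometricLieAction U g Γ X br) {z : D}
    (hz : z ∈ U) (e : D) (a b : W) :
    fderiv ℝ (fderiv ℝ X) z e (X z b) a + fderiv ℝ X z (fderiv ℝ X z e b) a
      - (fderiv ℝ (fderiv ℝ X) z e (X z a) b + fderiv ℝ X z (fderiv ℝ X z e a) b)
      = fderiv ℝ X z e (br a b) := by
  have hU := H.isOpen
  have dX := H.smooth_action.differentiableAt_of_isOpen hU hz
  have ddX := (H.smooth_action.fderiv_infty hU).differentiableAt_of_isOpen hU hz
  have dXc : ∀ c, DifferentiableAt ℝ (fun z => X z c) z := fun c =>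
    dX.clm_apply (differentiableAt_const c)
  have h1 : ∀ a b, fderiv ℝ (fun z => fderiv ℝ X z (X z b) a) z e
      = fderiv ℝ (fderiv ℝ X) z e (X z b) a + fderiv ℝ X z (fderiv ℝ X z e b) a := by
    intro a b
    rw [fderiv_clm_apply₂ ddX (dXc b) (differentiableAt_const a), fderiv_clm_apply_const dX]
    simp
  have h2 : ∀ a b, DifferentiableAt ℝ (fun z => fderiv ℝ X z (X z b) a) z := fun a b =>
    (ddX.clm_apply (dXc b)).clm_apply (differentiableAt_const a)
  rw [← h1, ← h1, ← fderiv_clm_apply_const dX,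
    ← Filter.EventuallyEq.fderiv_apply_eq hU hz fun y hy => H.bracket y hy a b,
    fderiv_fun_sub (h2 a b) (h2 b a), sub_apply]

/-- An invariant function is annihilated by the action, and its gradient is invariant. -/
theorem IsIsometricLieAction.fderiv_gradient (H : IsIsometricLieAction U g Γ X br)
    {P : D → ℝ} {Gr : D → D} (hP : ContDiffOn ℝ ∞ P U) (hGr : ContDiffOn ℝ ∞ Gr U)
    (hinv : ∀ z ∈ U, ∀ c, fderiv ℝ P z (X z c) = 0)
    (hgrad : ∀ z ∈ U, ∀ t, g z (Gr z) t = fderiv ℝ P z t) {z : D} (hz : z ∈ U) (c : W) :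
    fderiv ℝ Gr z (X z c) = fderiv ℝ X z (Gr z) c := by
  have hU := H.isOpen
  have dX := H.smooth_action.differentiableAt_of_isOpen hU hz
  have dg := H.smooth_metric.differentiableAt_of_isOpen hU hz
  have dGr := hGr.differentiableAt_of_isOpen hU hz
  have ddP := (hP.fderiv_infty hU).differentiableAt_of_isOpen hU hz
  have dXc : DifferentiableAt ℝ (fun z => X z c) z := dX.clm_apply (differentiableAt_const c)
  refine eq_of_forall_metric_eq (H.pos z hz) fun t => ?_
  have h1 : fderiv ℝ (fderiv ℝ P) z t (X z c) + fderiv ℝ P z (fderiv ℝ X z t c) = 0 := by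
    rw [← fderiv_clm_apply_const dX, ← fderiv_clm_apply_apply ddP dXc,
      Filter.EventuallyEq.fderiv_apply_eq (g := fun _ => (0 : ℝ)) hU hz fun y hy => hinv y hy c]
    simp
  have h2 : fderiv ℝ g z (X z c) (Gr z) t + g z (fderiv ℝ Gr z (X z c)) t
      = fderiv ℝ (fderiv ℝ P) z (X z c) t := by
    rw [← fderiv_clm_apply_const ddP,
      ← Filter.EventuallyEq.fderiv_apply_eq hU hz fun y hy => hgrad y hy t,
      fderiv_clm_apply₂ dg dGr (differentiableAt_const t)]
    simp
  have h3 := H.killing z hz c (Gr z) t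
  have h4 := hgrad z hz (fderiv ℝ X z t c)
  rw [fderiv_fderiv_comm hP hU hz] at h1
  linarith

end Fibre

/-! ### Gauged maps -/

section Maps

set_option maxSynthPendingDepth 3

variable {E D W : Type*} [NormedAddCommGroup E] [NormedSpace ℝ E]
  [NormedAddCommGroup D] [NormedSpace ℝ D] [NormedAddCommGroup W] [NormedSpace ℝ W]

/-- The covariant derivative `dw + X_A(w)` of the map `w`. -/
def gaugedDeriv (X : D → W →L[ℝ] D) (A : E → E →L[ℝ] W) (w : E → D) (x : E) : E →L[ℝ] D :=
  fderiv ℝ w x + (X (w x)).comp (A x)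

/-- The connection induced by `A` on the pull-back by `w` of the tangent bundle. -/
def pullConn (Γ : D → D →L[ℝ] D →L[ℝ] D) (X : D → W →L[ℝ] D) (A : E → E →L[ℝ] W) (w : E → D)
    (x : E) : E →L[ℝ] D →L[ℝ] D :=
  (Γ (w x)).comp (gaugedDeriv X A w x) + (fderiv ℝ X (w x)).flip.comp (A x)

variable {U : Set D} {g : D → D →L[ℝ] D →L[ℝ] ℝ} {Γ : D → D →L[ℝ] D →L[ℝ] D}
    {X : D → W →L[ℝ] D} {br : W →L[ℝ] W →L[ℝ] W} {A : E → E →L[ℝ] W} {w : E → D} {Ω : Set E}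

theorem gaugedDeriv_apply (x v : E) :
    gaugedDeriv X A w x v = fderiv ℝ w x v + X (w x) (A x v) := rfl

theorem pullConn_apply (x v : E) (a : D) :
    pullConn Γ X A w x v a = Γ (w x) (gaugedDeriv X A w x v) a + fderiv ℝ X (w x) a (A x v) := rfl

/-- `(A, w)` is a smooth pair of a connection form and a map into `U`. -/
structure IsGaugedMap (Ω : Set E) (U : Set D) (A : E → E →L[ℝ] W) (w : E → D) : Prop where
  isOpen : IsOpen Ω
  smooth_connection : ContDiffOn ℝ ∞ A Ω
  smooth_map : ContDiffOn ℝ ∞ w Ω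
  mapsTo : Set.MapsTo w Ω U

theorem contDiffOn_gaugedDeriv (H : IsIsometricLieAction U g Γ X br) (h : IsGaugedMap Ω U A w) :
    ContDiffOn ℝ ∞ (gaugedDeriv X A w) Ω :=
  (h.smooth_map.fderiv_infty h.isOpen).add
    ((H.smooth_action.comp h.smooth_map h.mapsTo).clm_comp h.smooth_connection)

theorem contDiffOn_pullConn (H : IsIsometricLieAction U g Γ X br) (h : IsGaugedMap Ω U A w) :
    ContDiffOn ℝ ∞ (pullConn Γ X A w) Ω :=
  ((H.smooth_conn.comp h.smooth_map h.mapsTo).clm_comp (contDiffOn_gaugedDeriv H h)).add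
    (((ContinuousLinearMap.flipₗᵢ ℝ D W D).toContinuousLinearEquiv.toContinuousLinearMap.contDiff
      |>.comp_contDiffOn
        ((H.smooth_action.fderiv_infty H.isOpen).comp h.smooth_map h.mapsTo)).clm_comp
      h.smooth_connection)

/-- Metric compatibility of `Γ` handles the direction `∇_A w = dw + X_A`. Since `w` really moves
only by `dw`, the surplus derivative along `X_A` has to be cancelled, which the Killing equation
does through the term `∂X` of the connection. -/
theorem isMetricConnection_pullConn (H : IsIsometricLieAction U g Γ X br)
    (h : IsGaugedMap Ω U A w) :
    IsMetricConnection (fun x => g (w x)) (pullConn Γ X A w) Ω := by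
  intro x hx v a b
  have hz := h.mapsTo hx
  rw [fderiv_comp_apply' (H.smooth_metric.differentiableAt_of_isOpen H.isOpen hz)
    (h.smooth_map.differentiableAt_of_isOpen h.isOpen hx)]
  have e : fderiv ℝ w x v = gaugedDeriv X A w x v - X (w x) (A x v) := by
    rw [gaugedDeriv_apply]; abel
  have k := H.killing _ hz (A x v) a b
  rw [H.metric _ hz] at k
  simp only [pullConn_apply, e, map_sub, sub_apply, map_add, add_apply, H.metric _ hz]
  linarith

/-- The covariant derivative of a section of the form `X_c(w)`. -/
theorem covD_action (H : IsIsometricLieAction U g Γ X br) (h : IsGaugedMap Ω U A w)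
    {c : E → W} (hc : ContDiffOn ℝ ∞ c Ω) {x : E} (hx : x ∈ Ω) (v : E) :
    covD (pullConn Γ X A w) v (fun y => X (w y) (c y)) x
      = X (w x) (covD (adConn br A) v c x)
        + covKilling Γ X (w x) (gaugedDeriv X A w x v) (c x) := by
  have hz := h.mapsTo hx
  have dw := h.smooth_map.differentiableAt_of_isOpen h.isOpen hx
  have dX := H.smooth_action.differentiableAt_of_isOpen H.isOpen hz
  have dXw : DifferentiableAt ℝ (fun y => X (w y)) x := dX.comp x dw
  have b := H.bracket _ hz (A x v) (c x)
  rw [covD, fderiv_clm_apply_apply dXw (hc.differentiableAt_of_isOpen h.isOpen hx),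
    fderiv_comp_apply' dX dw]
  simp only [pullConn_apply, covD, adConn_apply, covKilling_apply, map_add, add_apply, ← b,
    gaugedDeriv_apply]
  module

theorem fderiv_gaugedDeriv (H : IsIsometricLieAction U g Γ X br) (h : IsGaugedMap Ω U A w)
    {x : E} (hx : x ∈ Ω) (v u : E) :
    fderiv ℝ (gaugedDeriv X A w) x v u
      = fderiv ℝ (fderiv ℝ w) x v u + fderiv ℝ X (w x) (fderiv ℝ w x v) (A x u)
        + X (w x) (fderiv ℝ A x v u) := by
  have hz := h.mapsTo hx
  have dw := h.smooth_map.differentiableAt_of_isOpen h.isOpen hx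
  have ddw := (h.smooth_map.fderiv_infty h.isOpen).differentiableAt_of_isOpen h.isOpen hx
  have dX := H.smooth_action.differentiableAt_of_isOpen H.isOpen hz
  have dA := h.smooth_connection.differentiableAt_of_isOpen h.isOpen hx
  have dXw : DifferentiableAt ℝ (fun y => X (w y)) x := dX.comp x dw
  have dAu : DifferentiableAt ℝ (fun y => A y u) x := dA.clm_apply (differentiableAt_const u)
  rw [← fderiv_clm_apply_const
    ((contDiffOn_gaugedDeriv H h).differentiableAt_of_isOpen h.isOpen hx)]
  simp only [gaugedDeriv_apply]
  rw [fderiv_fun_add (ddw.clm_apply (differentiableAt_const u)) (dXw.clm_apply dAu), add_apply,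
    fderiv_clm_apply_const ddw, fderiv_clm_apply_apply dXw dAu, fderiv_comp_apply' dX dw,
    fderiv_clm_apply_const dA, add_assoc]

/-- The antisymmetric part of `∇_A ∇_A w` is the action of the curvature. -/
theorem covD_gaugedDeriv_comm (H : IsIsometricLieAction U g Γ X br) (h : IsGaugedMap Ω U A w)
    {x : E} (hx : x ∈ Ω) (v u : E) :
    covD (pullConn Γ X A w) v (fun y => gaugedDeriv X A w y u) x
      = covD (pullConn Γ X A w) u (fun y => gaugedDeriv X A w y v) x
        + X (w x) (curv br A v u x) := by
  have hz := h.mapsTo hx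
  have dG := (contDiffOn_gaugedDeriv H h).differentiableAt_of_isOpen h.isOpen hx
  have b := H.bracket _ hz (A x v) (A x u)
  simp only [covD]
  rw [fderiv_clm_apply_const dG, fderiv_clm_apply_const dG, fderiv_gaugedDeriv H h hx,
    fderiv_gaugedDeriv H h hx, fderiv_fderiv_comm h.smooth_map h.isOpen hx v u]
  simp only [pullConn_apply, curv, map_add, map_sub, ← b]
  rw [H.torsionFree _ hz (gaugedDeriv X A w x v)]
  simp only [gaugedDeriv_apply, map_add, add_apply]
  module

theorem fderiv_pullConn (H : IsIsometricLieAction U g Γ X br) (h : IsGaugedMap Ω U A w)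
    {x : E} (hx : x ∈ Ω) (v u : E) (a : D) :
    fderiv ℝ (pullConn Γ X A w) x v u a
      = fderiv ℝ Γ (w x) (fderiv ℝ w x v) (gaugedDeriv X A w x u) a
        + Γ (w x) (fderiv ℝ (gaugedDeriv X A w) x v u) a
        + fderiv ℝ (fderiv ℝ X) (w x) (fderiv ℝ w x v) a (A x u)
        + fderiv ℝ X (w x) a (fderiv ℝ A x v u) := by
  have hz := h.mapsTo hx
  have dw := h.smooth_map.differentiableAt_of_isOpen h.isOpen hx
  have dΓ := H.smooth_conn.differentiableAt_of_isOpen H.isOpen hz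
  have ddX := (H.smooth_action.fderiv_infty H.isOpen).differentiableAt_of_isOpen H.isOpen hz
  have dA := h.smooth_connection.differentiableAt_of_isOpen h.isOpen hx
  have dG := (contDiffOn_gaugedDeriv H h).differentiableAt_of_isOpen h.isOpen hx
  have dM := (contDiffOn_pullConn H h).differentiableAt_of_isOpen h.isOpen hx
  have dc : DifferentiableAt ℝ (fun _ : E => a) x := differentiableAt_const a
  have du : DifferentiableAt ℝ (fun _ : E => u) x := differentiableAt_const u
  have dΓw : DifferentiableAt ℝ (fun y => Γ (w y)) x := dΓ.comp x dw
  have dXw : DifferentiableAt ℝ (fun y => fderiv ℝ X (w y)) x := ddX.comp x dw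
  have e : fderiv ℝ (fun y => pullConn Γ X A w y u a) x v
      = fderiv ℝ (pullConn Γ X A w) x v u a := by
    rw [fderiv_clm_apply₂ dM du dc]; simp
  rw [← e]
  simp only [pullConn_apply]
  rw [fderiv_fun_add ((dΓw.clm_apply (dG.clm_apply du)).clm_apply dc)
      ((dXw.clm_apply dc).clm_apply (dA.clm_apply du)), add_apply,
    fderiv_clm_apply₂ dΓw (dG.clm_apply du) dc, fderiv_clm_apply₂ dXw dc (dA.clm_apply du),
    fderiv_comp_apply' dΓ dw, fderiv_comp_apply' ddX dw, fderiv_clm_apply_const dG,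
    fderiv_clm_apply_const dA]
  simp only [fderiv_fun_const, Pi.zero_apply, zero_apply, map_zero, add_zero]
  module

/-- The curvature of the pulled back connection. -/
theorem covD_pullConn_comm (H : IsIsometricLieAction U g Γ X br) (h : IsGaugedMap Ω U A w)
    {Y : E → D} (hY : ContDiffOn ℝ ∞ Y Ω) {x : E} (hx : x ∈ Ω) (v u : E) :
    covD (pullConn Γ X A w) v (covD (pullConn Γ X A w) u Y) x
      = covD (pullConn Γ X A w) u (covD (pullConn Γ X A w) v Y) x
        + (riem Γ (w x) (gaugedDeriv X A w x v) (gaugedDeriv X A w x u) (Y x)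
          + covKilling Γ X (w x) (Y x) (curv br A v u x)) := by
  have hz := h.mapsTo hx
  have c := covD_comm h.isOpen (contDiffOn_pullConn H h) hY hx v u
  have t := covD_gaugedDeriv_comm H h hx v u
  have dG := (contDiffOn_gaugedDeriv H h).differentiableAt_of_isOpen h.isOpen hx
  simp only [covD] at t
  rw [fderiv_clm_apply_const dG, fderiv_clm_apply_const dG] at t
  rw [sub_apply, fderiv_pullConn H h hx, fderiv_pullConn H h hx] at c
  rw [← sub_eq_iff_eq_add']
  refine c.trans ?_
  have e : ∀ v, fderiv ℝ w x v = gaugedDeriv X A w x v - X (w x) (A x v) := fun v => by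
    rw [gaugedDeriv_apply]; abel
  set a := Y x
  set p := gaugedDeriv X A w x v
  set q := gaugedDeriv X A w x u
  -- The commutator contains second derivatives of `X` and derivatives of `Γ` along Killing fields.
  -- Affinity of the Killing fields removes the latter, `fderiv_bracket` treats the commutator of
  -- the two actions, and the torsion identity `t` the derivatives of `∇_A w`. What is left is the
  -- Riemann tensor on `∇_A w` and the covariant derivative of the Killing field of `F_A`.
  have af1 := H.affine hz q a (A x v)
  have af2 := H.affine hz p a (A x u)
  have br1 := H.fderiv_bracket hz a (A x v) (A x u)
  have t2 := congrArg (fun b => Γ (w x) b a) t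
  have s1 := fderiv_fderiv_comm H.smooth_action H.isOpen hz (X (w x) (A x v)) a
  have s2 := fderiv_fderiv_comm H.smooth_action H.isOpen hz (X (w x) (A x u)) a
  simp only [e]
  simp only [pullConn_apply, riem, covKilling_apply, map_add, map_sub, add_apply, sub_apply, s1, s2,
    ← br1, curv] at t2 ⊢
  rw [H.torsionFree _ hz q p] at t2
  rw [H.torsionFree _ hz a]
  linear_combination (norm := skip) t2 - af1 + af2
  simp only [H.torsionFree _ hz a]
  module

/-- The covariant derivative of an invariant gradient along `w`. -/
theorem covD_gradient (H : IsIsometricLieAction U g Γ X br) (h : IsGaugedMap Ω U A w)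
    {P : D → ℝ} {Gr : D → D} (hP : ContDiffOn ℝ ∞ P U) (hGr : ContDiffOn ℝ ∞ Gr U)
    (hinv : ∀ z ∈ U, ∀ c, fderiv ℝ P z (X z c) = 0)
    (hgrad : ∀ z ∈ U, ∀ t, g z (Gr z) t = fderiv ℝ P z t) {x : E} (hx : x ∈ Ω) (v : E) :
    covD (pullConn Γ X A w) v (fun y => Gr (w y)) x
      = (fderiv ℝ Gr (w x) + (Γ (w x)).flip (Gr (w x))) (gaugedDeriv X A w x v) := by
  have hz := h.mapsTo hx
  rw [covD, fderiv_comp_apply' (hGr.differentiableAt_of_isOpen H.isOpen hz)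
    (h.smooth_map.differentiableAt_of_isOpen h.isOpen hx), pullConn_apply,
    ← H.fderiv_gradient hP hGr hinv hgrad hz]
  simp only [gaugedDeriv_apply, map_add, add_apply, ContinuousLinearMap.flip_apply]
  module

end Maps

end

end YMH

namespace YMH

noncomputable section

/-! ### Yang-Mills-Higgs fields in a coordinate chart of the fibre -/

section Coordinates

set_option maxSynthPendingDepth 3

variable {D W : Type*} [NormedAddCommGroup D] [NormedSpace ℝ D]
  [NormedAddCommGroup W] [NormedSpace ℝ W]

/-- `P` is an invariant function on `U` with gradient `Gr`. -/
structure IsInvariantPotential (U : Set D) (g : D → D →L[ℝ] D →L[ℝ] ℝ) (X : D → W →L[ℝ] D)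
    (P : D → ℝ) (Gr : D → D) : Prop where
  smooth : ContDiffOn ℝ ∞ P U
  smooth_grad : ContDiffOn ℝ ∞ Gr U
  invariant : ∀ z ∈ U, ∀ c, fderiv ℝ P z (X z c) = 0
  grad : ∀ z ∈ U, ∀ t, g z (Gr z) t = fderiv ℝ P z t

/-- The Yang-Mills-Higgs equations in coordinates. -/
structure IsCoordYMH {n : ℕ} (Ω : Set (Eu n)) (U : Set D) (g : D → D →L[ℝ] D →L[ℝ] ℝ)
    (Γ : D → D →L[ℝ] D →L[ℝ] D) (X : D → W →L[ℝ] D) (Gr : D → D) (br : W →L[ℝ] W →L[ℝ] W)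
    (B : W →L[ℝ] W →L[ℝ] ℝ) (A : Eu n → Eu n →L[ℝ] W) (w : Eu n → D) : Prop
    extends IsGaugedMap Ω U A w where
  yangMills : ∀ x ∈ Ω, ∀ v c,
    B (divCurv br A v x) c = g (w x) (gaugedDeriv X A w x v) (X (w x) c)
  higgs : ∀ x ∈ Ω, ∑ i, covD (pullConn Γ X A w) (stdVec i)
    (fun y => gaugedDeriv X A w y (stdVec i)) x = Gr (w x)

/-- `L` bounds all the tensors of the fibre at the point `z`. -/
structure IsFibreBound (g : D → D →L[ℝ] D →L[ℝ] ℝ) (Γ : D → D →L[ℝ] D →L[ℝ] D)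
    (X : D → W →L[ℝ] D) (Gr : D → D) (br : W →L[ℝ] W →L[ℝ] W) (B : W →L[ℝ] W →L[ℝ] ℝ) (L : ℝ)
    (z : D) : Prop where
  one_le : 1 ≤ L
  metric_lower : ∀ a, ‖a‖ ^ 2 ≤ L * g z a a
  metric_upper : ∀ a b, |g z a b| ≤ L * ‖a‖ * ‖b‖
  action : ∀ c, ‖X z c‖ ≤ L * ‖c‖
  covKilling : ∀ a c, ‖covKilling Γ X z a c‖ ≤ L * ‖a‖ * ‖c‖
  riem : ∀ a b e, ‖riem Γ z a b e‖ ≤ L * ‖a‖ * ‖b‖ * ‖e‖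
  grad : ‖Gr z‖ ≤ L
  hess : ∀ a, ‖(fderiv ℝ Gr z + (Γ z).flip (Gr z)) a‖ ≤ L * ‖a‖
  inner_lower : ∀ c, ‖c‖ ^ 2 ≤ L * B c c
  inner_upper : ∀ a b, |B a b| ≤ L * ‖a‖ * ‖b‖
  lie : ∀ a b, ‖br a b‖ ≤ L * ‖a‖ * ‖b‖

variable {n : ℕ} {Ω : Set (Eu n)} {U : Set D} {g : D → D →L[ℝ] D →L[ℝ] ℝ}
  {Γ : D → D →L[ℝ] D →L[ℝ] D} {X : D → W →L[ℝ] D} {P : D → ℝ} {Gr : D → D}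
  {br : W →L[ℝ] W →L[ℝ] W} {B : W →L[ℝ] W →L[ℝ] ℝ} {A : Eu n → Eu n →L[ℝ] W} {w : Eu n → D}

/-- The Bochner formula for `∇_A w`. -/
theorem sum_covD_covD_gaugedDeriv (H : IsIsometricLieAction U g Γ X br)
    (hP : IsInvariantPotential U g X P Gr) (h : IsCoordYMH Ω U g Γ X Gr br B A w) {x : Eu n}
    (hx : x ∈ Ω) (v : Eu n) :
    ∑ l, covD (pullConn Γ X A w) (stdVec l)
        (covD (pullConn Γ X A w) (stdVec l) (fun y => gaugedDeriv X A w y v)) x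
      = (fderiv ℝ Gr (w x) + (Γ (w x)).flip (Gr (w x))) (gaugedDeriv X A w x v)
        + X (w x) (divCurv br A v x)
        + ∑ l, (riem Γ (w x) (gaugedDeriv X A w x (stdVec l)) (gaugedDeriv X A w x v)
              (gaugedDeriv X A w x (stdVec l))
            + (2 : ℝ) • covKilling Γ X (w x) (gaugedDeriv X A w x (stdVec l))
              (curv br A (stdVec l) v x)) := by
  have hG := h.toIsGaugedMap
  have hΩ := h.isOpen
  have hM := contDiffOn_pullConn H hG
  have hom : ∀ u, ContDiffOn ℝ ∞ (fun y => gaugedDeriv X A w y u) Ω := fun u =>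
    (contDiffOn_gaugedDeriv H hG).clm_apply contDiffOn_const
  have hF : ∀ v u, ContDiffOn ℝ ∞ (curv br A v u) Ω :=
    contDiffOn_curv hΩ h.smooth_connection
  have hD : ∀ l u, ContDiffOn ℝ ∞
      (covD (pullConn Γ X A w) l (fun y => gaugedDeriv X A w y u)) Ω :=
    fun l u => contDiffOn_covD hΩ hM (hom u) l
  have hXF : ∀ v u, ContDiffOn ℝ ∞ (fun y => X (w y) (curv br A v u y)) Ω := fun v u =>
    (H.smooth_action.comp h.smooth_map h.mapsTo).clm_apply (hF v u)
  -- Swapping `v` and `l` inside costs `X(F)`, and commuting the two outer derivatives costs the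
  -- curvature of `pullConn`. Each contributes one copy of `covKilling` on `F`, hence the `2`; the
  -- sum over `l` of the leading terms is then a derivative of the Higgs equation.
  have e1 : ∀ l : Fin n, covD (pullConn Γ X A w) (stdVec l)
        (covD (pullConn Γ X A w) (stdVec l) (fun y => gaugedDeriv X A w y v)) x
      = covD (pullConn Γ X A w) v
          (covD (pullConn Γ X A w) (stdVec l) (fun y => gaugedDeriv X A w y (stdVec l))) x
        + X (w x) (covD (adConn br A) (stdVec l) (curv br A (stdVec l) v) x)
        + (riem Γ (w x) (gaugedDeriv X A w x (stdVec l)) (gaugedDeriv X A w x v)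
              (gaugedDeriv X A w x (stdVec l))
            + (2 : ℝ) • covKilling Γ X (w x) (gaugedDeriv X A w x (stdVec l))
              (curv br A (stdVec l) v x)) := by
    intro l
    rw [covD_congr hΩ hx fun y hy => covD_gaugedDeriv_comm H hG hy (stdVec l) v,
      covD_add ((hD _ _).differentiableAt_of_isOpen hΩ hx)
        ((hXF _ _).differentiableAt_of_isOpen hΩ hx),
      covD_action H hG (hF _ _) hx, covD_pullConn_comm H hG (hom _) hx]
    module
  have e2 : ∑ l, covD (pullConn Γ X A w) v
        (covD (pullConn Γ X A w) (stdVec l) (fun y => gaugedDeriv X A w y (stdVec l))) x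
      = (fderiv ℝ Gr (w x) + (Γ (w x)).flip (Gr (w x))) (gaugedDeriv X A w x v) := by
    rw [← covD_sum _ fun l _ => (hD _ _).differentiableAt_of_isOpen hΩ hx,
      covD_congr hΩ hx h.higgs, covD_gradient H hG hP.smooth hP.smooth_grad hP.invariant hP.grad hx]
  simp only [e1, Finset.sum_add_distrib, e2, divCurv, map_sum]

/-- The exterior derivative of the Yang-Mills current. -/
theorem inner_covD_divCurv (H : IsIsometricLieAction U g Γ X br) (hb : IsMetricLieBracket br B)
    (h : IsCoordYMH Ω U g Γ X Gr br B A w) {x : Eu n} (hx : x ∈ Ω) (v u : Eu n) (c : W) :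
    B (covD (adConn br A) v (divCurv br A u) x) c
      = g (w x) (covD (pullConn Γ X A w) v (fun y => gaugedDeriv X A w y u) x) (X (w x) c)
        + g (w x) (gaugedDeriv X A w x u) (covKilling Γ X (w x) (gaugedDeriv X A w x v) c) := by
  have hG := h.toIsGaugedMap
  have hΩ := h.isOpen
  have hom : ContDiffOn ℝ ∞ (fun y => gaugedDeriv X A w y u) Ω :=
    (contDiffOn_gaugedDeriv H hG).clm_apply contDiffOn_const
  have hXc : ContDiffOn ℝ ∞ (fun y => X (w y) c) Ω :=
    (H.smooth_action.comp h.smooth_map h.mapsTo).clm_apply contDiffOn_const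
  -- Both sides of the Yang-Mills equation are tested against a constant `c` and differentiated. The
  -- constant is not parallel, but the resulting terms with `[A(v), c]` agree on the two sides by
  -- the Yang-Mills equation itself.
  have e1 := fderiv_metric hΩ (contDiffOn_const (c := B)) (isMetricConnection_adConn (A := A) hb)
    (contDiffOn_divCurv (br := br) hΩ h.smooth_connection u) (contDiffOn_const (c := c)) hx v
  have e2 := fderiv_metric hΩ (H.smooth_metric.comp h.smooth_map h.mapsTo)
    (isMetricConnection_pullConn H hG) hom hXc hx v
  have e3 := Filter.EventuallyEq.fderiv_apply_eq hΩ hx fun y hy => h.yangMills y hy u c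
  have e4 := covD_action H hG (contDiffOn_const (c := c)) hx v
  have e5 : covD (adConn br A) v (fun _ => c) x = br (A x v) c := by simp [covD]
  rw [e4, e5] at e2
  rw [e5, h.yangMills x hx] at e1
  have e6 := congrArg (fun f => f v) e3
  simp only [Function.comp_apply, map_add] at e1 e2 e6
  linarith

/-- Test the Yang-Mills equation with the divergence itself and cancel one factor. The three powers
of `L` are the lower bound of `B`, the upper bound of the metric and the bound of the action. -/
theorem norm_divCurv_le (h : IsCoordYMH Ω U g Γ X Gr br B A w) {L : ℝ} {x : Eu n}
    (hL : IsFibreBound g Γ X Gr br B L (w x)) (hx : x ∈ Ω) (v : Eu n) :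
    ‖divCurv br A v x‖ ≤ L ^ 3 * ‖gaugedDeriv X A w x v‖ := by
  have hL1 := hL.one_le
  have h1 := hL.inner_lower (divCurv br A v x)
  rw [h.yangMills x hx] at h1
  have h2 := (le_abs_self _).trans
    (hL.metric_upper (gaugedDeriv X A w x v) (X (w x) (divCurv br A v x)))
  have h3 := hL.action (divCurv br A v x)
  have h4 : ‖divCurv br A v x‖ ^ 2 ≤ L ^ 3 * ‖gaugedDeriv X A w x v‖ * ‖divCurv br A v x‖ := by
    calc _ ≤ L * (L * ‖gaugedDeriv X A w x v‖ * ‖X (w x) (divCurv br A v x)‖) := h1.trans (by gcongr)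
      _ ≤ L * (L * ‖gaugedDeriv X A w x v‖ * (L * ‖divCurv br A v x‖)) := by gcongr
      _ = _ := by ring
  by_cases h0 : ‖divCurv br A v x‖ = 0
  · rw [h0]; positivity
  · have : 0 < ‖divCurv br A v x‖ := lt_of_le_of_ne (norm_nonneg _) (Ne.symm h0)
    rw [sq] at h4
    exact le_of_mul_le_mul_right h4 this

theorem inner_divCurv_self_le (h : IsCoordYMH Ω U g Γ X Gr br B A w) {L : ℝ} {x : Eu n}
    (hL : IsFibreBound g Γ X Gr br B L (w x)) (hx : x ∈ Ω) (v : Eu n) :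
    B (divCurv br A v x) (divCurv br A v x) ≤ L ^ 7 * ‖gaugedDeriv X A w x v‖ ^ 2 := by
  have hL1 := hL.one_le
  have h1 := norm_divCurv_le h hL hx v
  calc _ ≤ L * ‖divCurv br A v x‖ * ‖divCurv br A v x‖ := (le_abs_self _).trans (hL.inner_upper _ _)
    _ ≤ L * (L ^ 3 * ‖gaugedDeriv X A w x v‖) * (L ^ 3 * ‖gaugedDeriv X A w x v‖) := by gcongr
    _ = _ := by ring

/-- The zeroth order terms of the Bochner formula for `∇_A w`. -/
theorem abs_inner_sum_covD_covD_gaugedDeriv_le (H : IsIsometricLieAction U g Γ X br)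
    (hP : IsInvariantPotential U g X P Gr) (h : IsCoordYMH Ω U g Γ X Gr br B A w) {L : ℝ}
    {x : Eu n} (hL : IsFibreBound g Γ X Gr br B L (w x)) (hx : x ∈ Ω) {a b : ℝ}
    (ha : ∀ i : Fin n, ‖gaugedDeriv X A w x (stdVec i)‖ ≤ a)
    (hb : ∀ i j : Fin n, ‖curv br A (stdVec i) (stdVec j) x‖ ≤ b) (j : Fin n) :
    |g (w x) (∑ l, covD (pullConn Γ X A w) (stdVec l)
        (covD (pullConn Γ X A w) (stdVec l) (fun y => gaugedDeriv X A w y (stdVec j))) x)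
        (gaugedDeriv X A w x (stdVec j))|
      ≤ L * (L * a + L ^ 4 * a + n * (L * a ^ 3 + 2 * (L * a * b))) * a := by
  have hL1 := hL.one_le
  have ha0 : 0 ≤ a := (norm_nonneg _).trans (ha j)
  have hb0 : 0 ≤ b := (norm_nonneg _).trans (hb j j)
  refine (hL.metric_upper _ _).trans ?_
  rw [sum_covD_covD_gaugedDeriv H hP h hx]
  have haj := ha j
  have h1 : ‖(fderiv ℝ Gr (w x) + (Γ (w x)).flip (Gr (w x)))
      (gaugedDeriv X A w x (stdVec j))‖ ≤ L * a := (hL.hess _).trans (by gcongr)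
  have h2 : ‖X (w x) (divCurv br A (stdVec j) x)‖ ≤ L ^ 4 * a := by
    have := norm_divCurv_le h hL hx (stdVec j)
    calc _ ≤ L * (L ^ 3 * a) := (hL.action _).trans (by gcongr; exact this.trans (by gcongr))
      _ = _ := by ring
  have h3 : ∀ l, ‖riem Γ (w x) (gaugedDeriv X A w x (stdVec l)) (gaugedDeriv X A w x (stdVec j))
              (gaugedDeriv X A w x (stdVec l))
            + (2 : ℝ) • covKilling Γ X (w x) (gaugedDeriv X A w x (stdVec l))
              (curv br A (stdVec l) (stdVec j) x)‖ ≤ L * a ^ 3 + 2 * (L * a * b) := by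
    intro l
    have hal := ha l
    have hbl := hb l j
    refine (norm_add_le _ _).trans (add_le_add ?_ ?_)
    · calc _ ≤ L * a * a * a := (hL.riem _ _ _).trans (by gcongr)
        _ = _ := by ring
    · rw [norm_smul, Real.norm_eq_abs, abs_two]
      gcongr
      exact (hL.covKilling _ _).trans (by gcongr)
  have h4 := norm_sum_le_of_le Finset.univ fun l _ => h3 l
  rw [Finset.sum_const, Finset.card_univ, Fintype.card_fin, nsmul_eq_mul] at h4
  have h5 := norm_add₃_le.trans (add_le_add (add_le_add h1 h2) h4)
  gcongr

/-- The zeroth order terms of the Bochner formula for the curvature. -/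
theorem abs_inner_sum_covD_covD_curv_le (H : IsIsometricLieAction U g Γ X br)
    (hbr : IsMetricLieBracket br B) (h : IsCoordYMH Ω U g Γ X Gr br B A w) {L : ℝ}
    {x : Eu n} (hL : IsFibreBound g Γ X Gr br B L (w x)) (hx : x ∈ Ω) {a b : ℝ}
    (ha : ∀ i : Fin n, ‖gaugedDeriv X A w x (stdVec i)‖ ≤ a)
    (hb : ∀ i j : Fin n, ‖curv br A (stdVec i) (stdVec j) x‖ ≤ b) (i j : Fin n) :
    |B (∑ l, covD (adConn br A) (stdVec l)
        (covD (adConn br A) (stdVec l) (curv br A (stdVec i) (stdVec j))) x)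
        (curv br A (stdVec i) (stdVec j) x)|
      ≤ L ^ 3 * b ^ 2 + 2 * (L ^ 2 * a ^ 2 * b) + 2 * (n * (L ^ 2 * b ^ 3)) := by
  have hL1 := hL.one_le
  have ha0 : 0 ≤ a := (norm_nonneg _).trans (ha j)
  have hb0 : 0 ≤ b := (norm_nonneg _).trans (hb j j)
  have hai := ha i
  have haj := ha j
  have hbij := hb i j
  -- The derivative of the current enters antisymmetrised in `i` and `j`, so by this identity its
  -- second derivatives of `w` collapse to `X(F)`. No second derivative of `w` has to be estimated.
  have t := covD_gaugedDeriv_comm H h.toIsGaugedMap hx (stdVec i) (stdVec j)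
  have e : B (∑ l, covD (adConn br A) (stdVec l)
        (covD (adConn br A) (stdVec l) (curv br A (stdVec i) (stdVec j))) x)
        (curv br A (stdVec i) (stdVec j) x)
      = g (w x) (X (w x) (curv br A (stdVec i) (stdVec j) x))
          (X (w x) (curv br A (stdVec i) (stdVec j) x))
        + (g (w x) (gaugedDeriv X A w x (stdVec j)) (covKilling Γ X (w x)
            (gaugedDeriv X A w x (stdVec i)) (curv br A (stdVec i) (stdVec j) x))
          - g (w x) (gaugedDeriv X A w x (stdVec i)) (covKilling Γ X (w x)
            (gaugedDeriv X A w x (stdVec j)) (curv br A (stdVec i) (stdVec j) x)))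
        + 2 * ∑ l, B (br (curv br A (stdVec l) (stdVec i) x) (curv br A (stdVec l) (stdVec j) x))
          (curv br A (stdVec i) (stdVec j) x) := by
    rw [sum_covD_covD_curv hbr h.isOpen h.smooth_connection hx]
    simp only [map_add, map_sub, map_smul, map_sum, add_apply, sub_apply, smul_apply, sum_apply,
      inner_covD_divCurv H hbr h hx, smul_eq_mul]
    rw [t]
    simp only [map_add, add_apply]
    ring
  rw [e]
  have hXF : ‖X (w x) (curv br A (stdVec i) (stdVec j) x)‖ ≤ L * b :=
    (hL.action _).trans (by gcongr)
  have h1 : |g (w x) (X (w x) (curv br A (stdVec i) (stdVec j) x))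
      (X (w x) (curv br A (stdVec i) (stdVec j) x))| ≤ L ^ 3 * b ^ 2 := by
    calc _ ≤ L * (L * b) * (L * b) := (hL.metric_upper _ _).trans (by gcongr)
      _ = _ := by ring
  have h2 : ∀ p q : Eu n, ‖gaugedDeriv X A w x p‖ ≤ a → ‖gaugedDeriv X A w x q‖ ≤ a →
      |g (w x) (gaugedDeriv X A w x p) (covKilling Γ X (w x)
            (gaugedDeriv X A w x q) (curv br A (stdVec i) (stdVec j) x))| ≤ L ^ 2 * a ^ 2 * b := by
    intro p q hp hq
    have : ‖covKilling Γ X (w x) (gaugedDeriv X A w x q) (curv br A (stdVec i) (stdVec j) x)‖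
      ≤ L * a * b := (hL.covKilling _ _).trans (by gcongr)
    calc _ ≤ L * a * (L * a * b) := (hL.metric_upper _ _).trans (by gcongr)
      _ = _ := by ring
  have h3 : ∀ l, |B (br (curv br A (stdVec l) (stdVec i) x) (curv br A (stdVec l) (stdVec j) x))
          (curv br A (stdVec i) (stdVec j) x)| ≤ L ^ 2 * b ^ 3 := by
    intro l
    have h1 := hb l i
    have h2 := hb l j
    have : ‖br (curv br A (stdVec l) (stdVec i) x) (curv br A (stdVec l) (stdVec j) x)‖
      ≤ L * b * b := (hL.lie _ _).trans (by gcongr)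
    calc _ ≤ L * (L * b * b) * b := (hL.inner_upper _ _).trans (by gcongr)
      _ = _ := by ring
  have h4 := (Finset.abs_sum_le_sum_abs _ Finset.univ).trans (Finset.sum_le_sum fun l _ => h3 l)
  rw [Finset.sum_const, Finset.card_univ, Fintype.card_fin, nsmul_eq_mul] at h4
  refine (abs_add_le _ _).trans (add_le_add ((abs_add_le _ _).trans (add_le_add h1 ?_)) ?_)
  · refine (abs_sub _ _).trans ?_
    linarith [h2 _ _ haj hai, h2 _ _ hai haj]
  · rw [abs_mul, abs_two]; linarith

end Coordinates

end

end YMH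

namespace YMH

noncomputable section

/-! ### The two differential inequalities in coordinates, with explicit constants -/

section Estimates

set_option maxSynthPendingDepth 3

variable {D W : Type*} [NormedAddCommGroup D] [NormedSpace ℝ D]
  [NormedAddCommGroup W] [NormedSpace ℝ W]

/-- The bilinear form underlying a continuous bilinear form. -/
def bilinOf (B : D →L[ℝ] D →L[ℝ] ℝ) : LinearMap.BilinForm ℝ D :=
  LinearMap.mk₂ ℝ (fun a b => B a b) (by simp) (by simp) (by simp) (by simp)

@[simp] theorem bilinOf_apply (B : D →L[ℝ] D →L[ℝ] ℝ) (a b : D) : bilinOf B a b = B a b := rfl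

variable {n : ℕ} {Ω : Set (Eu n)} {U : Set D} {g : D → D →L[ℝ] D →L[ℝ] ℝ}
  {Γ : D → D →L[ℝ] D →L[ℝ] D} {X : D → W →L[ℝ] D} {P : D → ℝ} {Gr : D → D}
  {br : W →L[ℝ] W →L[ℝ] W} {B : W →L[ℝ] W →L[ℝ] ℝ} {A : Eu n → Eu n →L[ℝ] W} {w : Eu n → D}

/-- The constant in the subharmonicity estimate for `|∇_A u|`. -/
def sectionConst (n : ℕ) (L η : ℝ) : ℝ :=
  n * (L * (L ^ 2 + L ^ 5 + n * (L ^ 3 + 4 * L ^ 3))) + 1 / η * (n * (n * (2 * L ^ 4)) + L ^ 3)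

/-- The constant in the subharmonicity estimate for `|F_A|`. -/
def curvatureConst (n : ℕ) (L η : ℝ) : ℝ :=
  n * (n * (L ^ 3 * (2 * L) + 2 * (L ^ 2 * (2 * L ^ 2)) + 2 * (n * (L ^ 2 * (4 * L ^ 2)))))
    + 1 / η * (n * L ^ 8)

/-- Puts the Kato inequality into the form required by `laplacian_sqrt_rpow_ge`. The Kato defect
needs only `c₂`; the Bochner constant `c₁` is added so that one constant serves both hypotheses
there. -/
theorem refined_sq_le {p κ S q Q e c₁ c₂ N : ℝ} (h : 2 - p ≤ κ) (hS : 0 ≤ S)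
    (hk : κ * S ≤ q * (Q + e)) (he : e ≤ c₂ * (N * (q + 1))) (hq : 0 ≤ q) (hQ : 0 ≤ Q)
    (hc₁ : 0 ≤ c₁) (hc₂ : 0 ≤ c₂) (hN : 0 ≤ N * (q + 1)) :
    (2 - p) * S ≤ (q + 1) * (Q + (c₁ + c₂) * N * (q + 1)) := by
  have h1 : 0 ≤ c₁ * (N * (q + 1)) := mul_nonneg hc₁ hN
  have h2 : 0 ≤ c₂ * (N * (q + 1)) := mul_nonneg hc₂ hN
  calc (2 - p) * S ≤ κ * S := by gcongr
    _ ≤ q * (Q + e) := hk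
    _ ≤ q * (Q + (c₁ * (N * (q + 1)) + c₂ * (N * (q + 1)))) := by
      gcongr; linarith
    _ ≤ (q + 1) * (Q + (c₁ * (N * (q + 1)) + c₂ * (N * (q + 1)))) := by
      gcongr; linarith
    _ = _ := by ring

theorem sum_le_card_mul {n : ℕ} {f : Fin n → ℝ} {c : ℝ} (h : ∀ i, f i ≤ c) :
    ∑ i, f i ≤ n * c := by
  simpa using Finset.sum_le_card_nsmul Finset.univ f c fun i _ => h i

set_option maxHeartbeats 400000 in
-- Combines the Bochner formula with the one-form Kato inequality for `T l i`, the covariant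
-- derivative of `∇_A w`. Its antisymmetric part is `X(F)` and its trace is the gradient of the
-- potential. Every error term is absorbed into `N * f`, with `f = q + 1` and `N = qF + f`, both at
-- least `1`.
theorem laplacian_section_ge (hn : 4 ≤ n) {δ η : ℝ} (hη : 0 < η) (hη1 : η ≤ 1) (hηδ : η ≤ δ)
    (H : IsIsometricLieAction U g Γ X br) (hbr : IsMetricLieBracket br B)
    (hP : IsInvariantPotential U g X P Gr) (h : IsCoordYMH Ω U g Γ X Gr br B A w) {L : ℝ}
    {x : Eu n} (hx : x ∈ Ω) (hL : IsFibreBound g Γ X Gr br B L (w x))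
    {q : Eu n → ℝ} (hq : ∀ y, 0 ≤ q y)
    (hqΩ : ∀ y ∈ Ω, q y = ∑ i, g (w y) (gaugedDeriv X A w y (stdVec i))
      (gaugedDeriv X A w y (stdVec i)))
    {qF : ℝ} (hqF : 2 * qF = ∑ i, ∑ j, B (curv br A (stdVec i) (stdVec j) x)
      (curv br A (stdVec i) (stdVec j) x)) {p : ℝ}
    (hp : ((n : ℝ) - 2) / ((n : ℝ) - 1) + δ ≤ p) :
    Δ (fun y => Real.sqrt (q y + 1) ^ p) x
      ≥ -(2 * sectionConst n L η * p) * (qF + (q x + 1)) * Real.sqrt (q x + 1) ^ p := by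
  obtain ⟨m, rfl⟩ : ∃ m, n = m + 1 := ⟨n - 1, by omega⟩
  have hL1 := hL.one_le
  have hΩ := h.isOpen
  have hG := h.toIsGaugedMap
  have hz := h.mapsTo hx
  have hm3 : (3 : ℝ) ≤ m := by
    have : 3 ≤ m := by omega
    exact_mod_cast this
  have hom : ∀ i : Fin (m + 1), ContDiffOn ℝ ∞ (fun y => gaugedDeriv X A w y (stdVec i)) Ω :=
    fun i => (contDiffOn_gaugedDeriv H hG).clm_apply contDiffOn_const
  have hgw : ContDiffOn ℝ ∞ (fun y => g (w y)) Ω := H.smooth_metric.comp h.smooth_map h.mapsTo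
  have hM := contDiffOn_pullConn H hG
  have hsym : ∀ y ∈ Ω, ∀ a b, g (w y) a b = g (w y) b a := fun y hy => H.symm _ (h.mapsTo hy)
  have hgnn : ∀ a, 0 ≤ g (w x) a a := fun a => by
    by_cases h0 : a = 0
    · simp [h0]
    · exact (H.pos _ hz a h0).le
  have hBnn : ∀ a, 0 ≤ B a a := fun a => by
    by_cases h0 : a = 0
    · simp [h0]
    · exact (hbr.pos a h0).le
  have hlap := half_laplacian_sum_metric Finset.univ hΩ hgw hsym
    (isMetricConnection_pullConn H hG) hM hom hx
  have hgrad := fun v => half_fderiv_sum_metric Finset.univ hΩ hgw hsym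
    (isMetricConnection_pullConn H hG) hom hx v
  have hev : q =ᶠ[nhds x] fun y => ∑ i, g (w y) (gaugedDeriv X A w y (stdVec i))
      (gaugedDeriv X A w y (stdVec i)) :=
    Filter.eventually_of_mem (hΩ.mem_nhds hx) hqΩ
  have hcd : ContDiffAt ℝ 2 q x := by
    refine ContDiffAt.congr_of_eventuallyEq ?_ hev
    have : ContDiffOn ℝ ∞ (fun y => ∑ i, g (w y) (gaugedDeriv X A w y (stdVec i))
      (gaugedDeriv X A w y (stdVec i))) Ω :=
      ContDiffOn.sum fun i _ => contDiffOn_metric hgw (hom i) (hom i)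
    exact (this.contDiffAt (hΩ.mem_nhds hx)).of_le two_le_infty
  rw [← InnerProductSpace.laplacian_congr_nhds hev |>.eq_of_nhds] at hlap
  rw [← hev.fderiv_eq] at hgrad
  have hqx := hqΩ x hx
  have hqx0 := hq x
  set T : Fin (m + 1) → Fin (m + 1) → D := fun l i =>
    covD (pullConn Γ X A w) (stdVec l) (fun y => gaugedDeriv X A w y (stdVec i)) x with hT
  set σ : Fin (m + 1) → D := fun i => gaugedDeriv X A w x (stdVec i) with hσ
  have hqF0 : 0 ≤ qF := by
    have : 0 ≤ ∑ i, ∑ j, B (curv br A (stdVec i) (stdVec j) x) (curv br A (stdVec i) (stdVec j) x) :=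
      Finset.sum_nonneg fun i _ => Finset.sum_nonneg fun j _ => hBnn _
    linarith
  set a := Real.sqrt (L * q x) with ha_def
  -- The `2` compensates for `qF` counting each pair of indices once.
  set b := Real.sqrt (2 * L * qF) with hb_def
  have ha2 : a ^ 2 = L * q x := Real.sq_sqrt (by positivity)
  have hb2 : b ^ 2 = 2 * L * qF := Real.sq_sqrt (by positivity)
  have ha0 : 0 ≤ a := Real.sqrt_nonneg _
  have hb0 : 0 ≤ b := Real.sqrt_nonneg _
  have ha : ∀ i, ‖σ i‖ ≤ a := fun i => by
    refine Real.le_sqrt_of_sq_le ((hL.metric_lower _).trans ?_)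
    gcongr
    rw [hqx]
    exact Finset.single_le_sum (f := fun i => g (w x) (σ i) (σ i)) (fun i _ => hgnn _)
      (Finset.mem_univ i)
  have hb : ∀ i j : Fin (m + 1), ‖curv br A (stdVec i) (stdVec j) x‖ ≤ b := fun i j => by
    refine Real.le_sqrt_of_sq_le ((hL.inner_lower _).trans ?_)
    rw [mul_comm 2 L, mul_assoc, hqF]
    gcongr
    refine le_trans ?_ (Finset.single_le_sum (f := fun i => ∑ j, B (curv br A (stdVec i) (stdVec j) x)
      (curv br A (stdVec i) (stdVec j) x)) (fun i _ => Finset.sum_nonneg fun j _ => hBnn _)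
      (Finset.mem_univ i))
    exact Finset.single_le_sum (f := fun j => B (curv br A (stdVec i) (stdVec j) x)
      (curv br A (stdVec i) (stdVec j) x)) (fun i _ => hBnn _) (Finset.mem_univ j)
  set N := qF + (q x + 1) with hN
  set f := q x + 1 with hf
  have hf1 : 1 ≤ f := by linarith
  have hN1 : 1 ≤ N := by linarith
  have hfN : f ≤ N * f := le_mul_of_one_le_left (by linarith) hN1
  have hNf : N ≤ N * f := le_mul_of_one_le_right (by linarith) hf1
  have b1 : a ^ 2 ≤ L * (N * f) := by rw [ha2]; gcongr; linarith
  have b2 : a ^ 4 ≤ L ^ 2 * (N * f) := by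
    rw [show a ^ 4 = (a ^ 2) ^ 2 by ring, ha2, mul_pow]
    gcongr
    nlinarith
  have b3 : a ^ 2 * b ≤ 2 * L ^ 2 * (N * f) := by
    -- From `2b ≤ b² + 1` with `b² = 2 * L * qF`, and `1 ≤ L * N`.
    have h1 : b ≤ 2 * L * N := by nlinarith [sq_nonneg (b - 1)]
    calc a ^ 2 * b ≤ L * f * (2 * L * N) := by rw [ha2]; gcongr; linarith
      _ = _ := by ring
  have hS : -((((m + 1 : ℕ) : ℝ)) * (L * (L ^ 2 + L ^ 5 + ((m + 1 : ℕ) : ℝ) * (L ^ 3 + 4 * L ^ 3)))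
        * (N * f)) ≤ ∑ i, g (w x) (∑ l, covD (pullConn Γ X A w) (stdVec l)
        (covD (pullConn Γ X A w) (stdVec l) (fun y => gaugedDeriv X A w y (stdVec i))) x) (σ i) := by
    refine (neg_le_neg ?_).trans (neg_abs_le _)
    refine (Finset.abs_sum_le_sum_abs _ _).trans ?_
    rw [mul_assoc]
    refine sum_le_card_mul fun i => ?_
    refine (abs_inner_sum_covD_covD_gaugedDeriv_le H hP h hL hx ha hb i).trans ?_
    calc L * (L * a + L ^ 4 * a + ((m + 1 : ℕ) : ℝ) * (L * a ^ 3 + 2 * (L * a * b))) * a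
        = L * (L * a ^ 2 + L ^ 4 * a ^ 2
          + ((m + 1 : ℕ) : ℝ) * (L * a ^ 4 + 2 * (L * (a ^ 2 * b)))) := by ring
      _ ≤ L * (L * (L * (N * f)) + L ^ 4 * (L * (N * f))
          + ((m + 1 : ℕ) : ℝ) * (L * (L ^ 2 * (N * f)) + 2 * (L * (2 * L ^ 2 * (N * f))))) := by
        gcongr
      _ = _ := by ring
  have hkato := kato_one_form (bilinOf (g (w x))) (H.symm _ hz) (H.pos _ hz) (by omega : 1 ≤ m)
    hη hη1 T σ
  simp only [bilinOf_apply] at hkato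
  have hskew : ∀ i j, T i j - T j i = X (w x) (curv br A (stdVec i) (stdVec j) x) := fun i j => by
    simp only [hT]; rw [covD_gaugedDeriv_comm H hG hx (stdVec i) (stdVec j)]; abel
  have htr : ∑ i, T i i = Gr (w x) := h.higgs x hx
  simp only [hskew] at hkato
  rw [htr, ← hqx] at hkato
  have k1 : ∑ i : Fin (m + 1), ∑ j : Fin (m + 1),
      g (w x) (X (w x) (curv br A (stdVec i) (stdVec j) x))
        (X (w x) (curv br A (stdVec i) (stdVec j) x))
      ≤ ((m + 1 : ℕ) : ℝ) * (((m + 1 : ℕ) : ℝ) * (2 * L ^ 4)) * (N * f) := by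
    rw [mul_assoc, mul_assoc]
    refine sum_le_card_mul fun i => sum_le_card_mul fun j => ?_
    have h1 := hb i j
    have h2 : ‖X (w x) (curv br A (stdVec i) (stdVec j) x)‖ ≤ L * b :=
      (hL.action _).trans (by gcongr)
    calc _ ≤ L * (L * b) * (L * b) :=
          (le_abs_self _).trans ((hL.metric_upper _ _).trans (by gcongr))
      _ = L ^ 3 * b ^ 2 := by ring
      _ = 2 * L ^ 4 * qF := by rw [hb2]; ring
      _ ≤ _ := by gcongr; linarith
  have k2 : g (w x) (Gr (w x)) (Gr (w x)) ≤ L ^ 3 * (N * f) := by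
    have h2 := hL.grad
    calc _ ≤ L * L * L := (le_abs_self _).trans ((hL.metric_upper _ _).trans (by gcongr))
      _ = L ^ 3 * 1 := by ring
      _ ≤ _ := by gcongr; linarith
  set Q := ∑ i, ∑ j, g (w x) (T i j) (T i j) with hQ
  have hQ0 : 0 ≤ Q := Finset.sum_nonneg fun i _ => Finset.sum_nonneg fun j _ => hgnn _
  set c1 := (((m + 1 : ℕ) : ℝ)) * (L * (L ^ 2 + L ^ 5 + ((m + 1 : ℕ) : ℝ) * (L ^ 3 + 4 * L ^ 3)))
  set c2 := 1 / η * (((m + 1 : ℕ) : ℝ) * (((m + 1 : ℕ) : ℝ) * (2 * L ^ 4)) + L ^ 3)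
  have hc1 : 0 ≤ c1 := by positivity
  have hc2 : 0 ≤ c2 := by positivity
  have hC : sectionConst (m + 1) L η = c1 + c2 := rfl
  have k3 : 1 / η * (∑ i : Fin (m + 1), ∑ j : Fin (m + 1),
      g (w x) (X (w x) (curv br A (stdVec i) (stdVec j) x))
        (X (w x) (curv br A (stdVec i) (stdVec j) x)) + g (w x) (Gr (w x)) (Gr (w x)))
      ≤ c2 * (N * f) := by
    simp only [c2]
    rw [mul_assoc, add_mul]
    gcongr
  have hNf0 : 0 ≤ N * f := by positivity
  refine laplacian_sqrt_rpow_ge (T := Q) hq hcd ?_ ?_ ?_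
  · have : 0 ≤ ((m : ℝ) + 1 - 2) / ((m : ℝ) + 1 - 1) :=
      div_nonneg (by linarith) (by linarith)
    push_cast at hp
    linarith
  · rw [hlap, hC]
    have : 0 ≤ c2 * (N * f) := by positivity
    have e : (c1 + c2) * N * (q x + 1) = c1 * (N * f) + c2 * (N * f) := by rw [hf]; ring
    rw [e]
    linarith
  · simp only [hgrad]
    -- With `m = n - 1` the threshold `(n-2)/(n-1)` is `1 - 1/m`, so the condition on `p` together
    -- with `η ≤ δ` is exactly what the Kato constant allows.
    have hp' : 2 - p ≤ 1 + 1 / (m : ℝ) - η := by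
      have e : ((((m + 1 : ℕ) : ℝ)) - 2) / ((((m + 1 : ℕ) : ℝ)) - 1) = 1 - 1 / m := by
        push_cast
        rw [show (m : ℝ) + 1 - 1 = m by ring]
        have : (m : ℝ) ≠ 0 := by linarith
        field_simp; ring
      rw [e] at hp
      linarith
    rw [hC]
    exact refined_sq_le hp' (Finset.sum_nonneg fun i _ => sq_nonneg _) hkato k3 hqx0 hQ0 hc1 hc2 hNf0

set_option maxHeartbeats 400000 in
-- Combines the Weitzenböck formula with the two-form Kato inequality. The cyclic condition is the
-- Bianchi identity, and the only defect is the divergence, bounded by `|∇_A w|`. The weight is now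
-- `N = qw + √f`: the worst terms `|F|³` and `|∇w|²|F|` contain at most one factor `|F|` beyond
-- those absorbed by `f` or `qw`.
theorem laplacian_curvature_ge (hn : 4 ≤ n) {δ η : ℝ} (hη : 0 < η) (hη1 : η ≤ 1) (hηδ : η ≤ δ)
    (H : IsIsometricLieAction U g Γ X br) (hbr : IsMetricLieBracket br B)
    (h : IsCoordYMH Ω U g Γ X Gr br B A w) {L : ℝ}
    {x : Eu n} (hx : x ∈ Ω) (hL : IsFibreBound g Γ X Gr br B L (w x))
    {q : Eu n → ℝ} (hq : ∀ y, 0 ≤ q y)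
    (hqΩ : ∀ y ∈ Ω, 2 * q y = ∑ i, ∑ j, B (curv br A (stdVec i) (stdVec j) y)
      (curv br A (stdVec i) (stdVec j) y))
    {qw : ℝ} (hqw : qw = ∑ i, g (w x) (gaugedDeriv X A w x (stdVec i))
      (gaugedDeriv X A w x (stdVec i))) {p : ℝ}
    (hp : ((n : ℝ) - 3) / ((n : ℝ) - 2) + δ ≤ p) :
    Δ (fun y => Real.sqrt (q y + 1) ^ p) x
      ≥ -(2 * curvatureConst n L η * p) * (qw + Real.sqrt (q x + 1))
        * Real.sqrt (q x + 1) ^ p := by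
  obtain ⟨m, rfl⟩ : ∃ m, n = m + 1 := ⟨n - 1, by omega⟩
  have hL1 := hL.one_le
  have hΩ := h.isOpen
  have hG := h.toIsGaugedMap
  have hz := h.mapsTo hx
  have hm3 : (3 : ℝ) ≤ m := by
    have : 3 ≤ m := by omega
    exact_mod_cast this
  -- Halving the form makes the sum over all ordered pairs equal to `|F|²`, which counts pairs `i <
  -- j`.
  set B' : W →L[ℝ] W →L[ℝ] ℝ := (1 / 2 : ℝ) • B with hB'
  have hB'a : ∀ a b, B' a b = 1 / 2 * B a b := fun a b => rfl
  have hbr' : IsMetricLieBracket br B' :=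
    { skew := hbr.skew
      jacobi := hbr.jacobi
      symm := fun a b => by rw [hB'a, hB'a, hbr.symm]
      pos := fun a ha => by rw [hB'a]; linarith [hbr.pos a ha]
      invariant := fun a b c => by rw [hB'a, hB'a]; linarith [hbr.invariant a b c] }
  have hF : ∀ i : Fin (m + 1) × Fin (m + 1),
      ContDiffOn ℝ ∞ (curv br A (stdVec i.1) (stdVec i.2)) Ω :=
    fun i => contDiffOn_curv hΩ h.smooth_connection _ _
  have hM := contDiffOn_adConn (br := br) h.smooth_connection
  have hgnn : ∀ a, 0 ≤ g (w x) a a := fun a => by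
    by_cases h0 : a = 0
    · simp [h0]
    · exact (H.pos _ hz a h0).le
  have hBnn : ∀ a, 0 ≤ B a a := fun a => by
    by_cases h0 : a = 0
    · simp [h0]
    · exact (hbr.pos a h0).le
  have hlap := half_laplacian_sum_metric (g := fun _ => B') Finset.univ hΩ contDiffOn_const
    (fun _ _ => hbr'.symm) (isMetricConnection_adConn (A := A) hbr') hM hF hx
  have hgrad := fun v => half_fderiv_sum_metric (g := fun _ => B') Finset.univ hΩ contDiffOn_const
    (fun _ _ => hbr'.symm) (isMetricConnection_adConn (A := A) hbr') hF hx v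
  have hqΩ' : ∀ y ∈ Ω, q y = ∑ i : Fin (m + 1) × Fin (m + 1),
      B' (curv br A (stdVec i.1) (stdVec i.2) y) (curv br A (stdVec i.1) (stdVec i.2) y) := by
    intro y hy
    simp only [hB'a, ← Finset.mul_sum]
    rw [Fintype.sum_prod_type, ← hqΩ y hy]; ring
  have hev : q =ᶠ[nhds x] fun y => ∑ i : Fin (m + 1) × Fin (m + 1),
      B' (curv br A (stdVec i.1) (stdVec i.2) y) (curv br A (stdVec i.1) (stdVec i.2) y) :=
    Filter.eventually_of_mem (hΩ.mem_nhds hx) hqΩ'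
  have hcd : ContDiffAt ℝ 2 q x := by
    refine ContDiffAt.congr_of_eventuallyEq ?_ hev
    have : ContDiffOn ℝ ∞ (fun y => ∑ i : Fin (m + 1) × Fin (m + 1),
      B' (curv br A (stdVec i.1) (stdVec i.2) y) (curv br A (stdVec i.1) (stdVec i.2) y)) Ω :=
      ContDiffOn.sum fun i _ => contDiffOn_metric contDiffOn_const (hF i) (hF i)
    exact (this.contDiffAt (hΩ.mem_nhds hx)).of_le two_le_infty
  rw [← InnerProductSpace.laplacian_congr_nhds hev |>.eq_of_nhds] at hlap
  rw [← hev.fderiv_eq] at hgrad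
  have hqx := hqΩ x hx
  have hqx0 := hq x
  set T : Fin (m + 1) → Fin (m + 1) → Fin (m + 1) → W := fun l i j =>
    covD (adConn br A) (stdVec l) (curv br A (stdVec i) (stdVec j)) x with hT
  set R : Fin (m + 1) → Fin (m + 1) → W := fun i j => curv br A (stdVec i) (stdVec j) x with hR
  set σ : Fin (m + 1) → D := fun i => gaugedDeriv X A w x (stdVec i) with hσ
  simp only [Fintype.sum_prod_type] at hlap hgrad
  have hqw0 : 0 ≤ qw := by
    rw [hqw]; exact Finset.sum_nonneg fun i _ => hgnn _
  set a := Real.sqrt (L * qw) with ha_def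
  set b := Real.sqrt (2 * L * q x) with hb_def
  have ha2 : a ^ 2 = L * qw := Real.sq_sqrt (by positivity)
  have hb2 : b ^ 2 = 2 * L * q x := Real.sq_sqrt (by positivity)
  have ha0 : 0 ≤ a := Real.sqrt_nonneg _
  have hb0 : 0 ≤ b := Real.sqrt_nonneg _
  have ha : ∀ i, ‖σ i‖ ≤ a := fun i => by
    refine Real.le_sqrt_of_sq_le ((hL.metric_lower _).trans ?_)
    gcongr
    rw [hqw]
    exact Finset.single_le_sum (f := fun i => g (w x) (σ i) (σ i)) (fun i _ => hgnn _)
      (Finset.mem_univ i)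
  have hb : ∀ i j, ‖R i j‖ ≤ b := fun i j => by
    refine Real.le_sqrt_of_sq_le ((hL.inner_lower _).trans ?_)
    rw [mul_comm 2 L, mul_assoc, hqx]
    gcongr
    refine le_trans ?_ (Finset.single_le_sum (f := fun i => ∑ j, B (R i j) (R i j))
      (fun i _ => Finset.sum_nonneg fun j _ => hBnn _) (Finset.mem_univ i))
    exact Finset.single_le_sum (f := fun j => B (R i j) (R i j)) (fun i _ => hBnn _)
      (Finset.mem_univ j)
  set f := q x + 1 with hf
  set r := Real.sqrt f with hr
  have hf1 : 1 ≤ f := by linarith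
  have hr2 : r ^ 2 = f := Real.sq_sqrt (by linarith)
  have hr0 : 0 ≤ r := Real.sqrt_nonneg _
  have hr1 : 1 ≤ r := Real.one_le_sqrt.mpr hf1
  set N := qw + r with hN
  have hN1 : 1 ≤ N := by linarith
  have hfN : f ≤ N * f := le_mul_of_one_le_left (by linarith) hN1
  have hNf : N ≤ N * f := le_mul_of_one_le_right (by linarith) hf1
  -- Compare squares: `2 * L * q x ≤ 4 * L² * f`, because `1 ≤ L`.
  have hbr1 : b ≤ 2 * L * r := by
    refine abs_le_of_sq_le_sq' ?_ (by positivity) |>.2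
    rw [hb2, mul_pow, hr2]
    nlinarith
  have b1 : b ^ 2 ≤ 2 * L * (N * f) := by rw [hb2]; gcongr; linarith
  have b2 : b ^ 3 ≤ 4 * L ^ 2 * (N * f) := by
    calc b ^ 3 = b ^ 2 * b := by ring
      _ ≤ (2 * L * f) * (2 * L * N) := by
        rw [hb2]
        gcongr
        · linarith
        · exact hbr1.trans (by gcongr; linarith)
      _ = _ := by ring
  have b3 : a ^ 2 * b ≤ 2 * L ^ 2 * (N * f) := by
    have : r ≤ f := by rw [← hr2]; nlinarith
    calc a ^ 2 * b ≤ L * N * (2 * L * f) := by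
          rw [ha2]
          gcongr
          · linarith
          · exact hbr1.trans (by gcongr)
      _ = _ := by ring
  set c1 := ((m + 1 : ℕ) : ℝ) * (((m + 1 : ℕ) : ℝ) * (L ^ 3 * (2 * L) + 2 * (L ^ 2 * (2 * L ^ 2))
    + 2 * (((m + 1 : ℕ) : ℝ) * (L ^ 2 * (4 * L ^ 2))))) with hc1d
  set c2 := 1 / η * (((m + 1 : ℕ) : ℝ) * L ^ 8) with hc2d
  have hc1 : 0 ≤ c1 := by positivity
  have hc2 : 0 ≤ c2 := by positivity
  have hC : curvatureConst (m + 1) L η = c1 + c2 := rfl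
  have hNf0 : 0 ≤ N * f := by positivity
  have hS : -(c1 * (N * f)) ≤ ∑ i, ∑ j, B' (∑ l, covD (adConn br A) (stdVec l)
        (covD (adConn br A) (stdVec l) (curv br A (stdVec i) (stdVec j))) x) (R i j) := by
    refine (neg_le_neg ?_).trans (neg_abs_le _)
    refine (Finset.abs_sum_le_sum_abs _ _).trans ?_
    rw [hc1d, mul_assoc]
    refine sum_le_card_mul fun i => ?_
    refine (Finset.abs_sum_le_sum_abs _ _).trans ?_
    rw [mul_assoc]
    refine sum_le_card_mul fun j => ?_
    have h1 := abs_inner_sum_covD_covD_curv_le H hbr h hL hx ha hb i j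
    rw [hB'a, abs_mul, abs_of_pos (by norm_num : (0 : ℝ) < 1 / 2)]
    calc _ ≤ 1 * (L ^ 3 * b ^ 2 + 2 * (L ^ 2 * a ^ 2 * b)
            + 2 * (((m + 1 : ℕ) : ℝ) * (L ^ 2 * b ^ 3))) := by
          refine mul_le_mul (by norm_num) h1 (abs_nonneg _) (by norm_num)
      _ = L ^ 3 * b ^ 2 + 2 * (L ^ 2 * (a ^ 2 * b))
            + 2 * (((m + 1 : ℕ) : ℝ) * (L ^ 2 * b ^ 3)) := by ring
      _ ≤ L ^ 3 * (2 * L * (N * f)) + 2 * (L ^ 2 * (2 * L ^ 2 * (N * f)))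
            + 2 * (((m + 1 : ℕ) : ℝ) * (L ^ 2 * (4 * L ^ 2 * (N * f)))) := by gcongr
      _ = _ := by ring
  have hTskew : ∀ i j k, T i j k = -T i k j := fun i j k => by
    simp only [hT]
    rw [← covD_neg]
    exact covD_congr hΩ hx (fun y _ => curv_skew hbr _ _ _) _
  have hTb : ∀ i j k, T i j k + T j k i + T k i j = 0 := fun i j k =>
    bianchi hbr hΩ h.smooth_connection hx _ _ _
  have hkato := kato_two_form (bilinOf B') hbr'.symm hbr'.pos (by omega : 3 ≤ m) hη hη1 T R hTskew
    hTb
  simp only [bilinOf_apply] at hkato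
  have htr : ∀ j, ∑ i, T i i j = divCurv br A (stdVec j) x := fun j => rfl
  simp only [htr] at hkato
  have hq2 : ∑ i, ∑ j, B' (R i j) (R i j) = q x := by
    rw [hqΩ' x hx, Fintype.sum_prod_type]
  rw [hq2] at hkato
  set Q := ∑ i, ∑ j, ∑ k, B' (T i j k) (T i j k) with hQ
  have hB'nn : ∀ a, 0 ≤ B' a a := fun a => by rw [hB'a]; linarith [hBnn a]
  have hQ0 : 0 ≤ Q := Finset.sum_nonneg fun i _ => Finset.sum_nonneg fun j _ =>
    Finset.sum_nonneg fun k _ => hB'nn _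
  have k3 : 1 / η * ∑ j : Fin (m + 1), B' (divCurv br A (stdVec j) x) (divCurv br A (stdVec j) x)
      ≤ c2 * (N * f) := by
    rw [hc2d, mul_assoc, mul_assoc]
    gcongr
    refine sum_le_card_mul fun j => ?_
    have h1 := inner_divCurv_self_le h hL hx (stdVec j)
    have h2 := ha j
    have h3 := hBnn (divCurv br A (stdVec j) x)
    rw [hB'a]
    calc _ ≤ L ^ 7 * ‖σ j‖ ^ 2 := by linarith
      _ ≤ L ^ 7 * a ^ 2 := by gcongr
      _ = L ^ 8 * qw := by rw [ha2]; ring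
      _ ≤ _ := by gcongr; linarith
  refine laplacian_sqrt_rpow_ge (T := Q) hq hcd ?_ ?_ ?_
  · have : 0 ≤ ((m : ℝ) + 1 - 3) / ((m : ℝ) + 1 - 2) :=
      div_nonneg (by linarith) (by linarith)
    push_cast at hp
    linarith
  · rw [hlap, hC]
    have : 0 ≤ c2 * (N * f) := by positivity
    have e : (c1 + c2) * N * (q x + 1) = c1 * (N * f) + c2 * (N * f) := by rw [hf]; ring
    rw [e]
    linarith
  · simp only [hgrad]
    have hp' : 2 - p ≤ 1 + 1 / ((m : ℝ) - 1) - η := by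
      have e : ((((m + 1 : ℕ) : ℝ)) - 3) / ((((m + 1 : ℕ) : ℝ)) - 2) = 1 - 1 / ((m : ℝ) - 1) := by
        push_cast
        rw [show (m : ℝ) + 1 - 2 = m - 1 by ring]
        have : (m : ℝ) - 1 ≠ 0 := by linarith
        field_simp; ring
      rw [e] at hp
      linarith
    rw [hC]
    exact refined_sq_le hp' (Finset.sum_nonneg fun i _ => sq_nonneg _) hkato k3 hqx0 hQ0 hc1 hc2 hNf0

end Estimates

end

end YMH

namespace YMH

noncomputable section

/-! ### Levi-Civita connection and gradient of a metric on an open set; uniform bounds on compact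
sets -/

section LeviCivita

set_option maxSynthPendingDepth 3

variable {D W : Type*} [NormedAddCommGroup D] [NormedSpace ℝ D]
  [NormedAddCommGroup W] [NormedSpace ℝ W]

/-- Transposition of bilinear maps. -/
def flipCLM (E F H : Type*) [NormedAddCommGroup E] [NormedSpace ℝ E] [NormedAddCommGroup F]
    [NormedSpace ℝ F] [NormedAddCommGroup H] [NormedSpace ℝ H] :
    (E →L[ℝ] F →L[ℝ] H) →L[ℝ] F →L[ℝ] E →L[ℝ] H :=
  (ContinuousLinearMap.flipₗᵢ ℝ E F H).toContinuousLinearEquiv.toContinuousLinearMap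

@[simp] theorem flipCLM_apply {E F H : Type*} [NormedAddCommGroup E] [NormedSpace ℝ E]
    [NormedAddCommGroup F] [NormedSpace ℝ F] [NormedAddCommGroup H] [NormedSpace ℝ H]
    (f : E →L[ℝ] F →L[ℝ] H) (a : F) (b : E) : flipCLM E F H f a b = f b a := rfl

/-- The Christoffel symbols of the first kind of the metric `g`. -/
def christoffel₁ (g : D → D →L[ℝ] D →L[ℝ] ℝ) (z : D) : D →L[ℝ] D →L[ℝ] D →L[ℝ] ℝ :=
  (1 / 2 : ℝ) • (fderiv ℝ g z + flipCLM D D (D →L[ℝ] ℝ) (fderiv ℝ g z)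
    - (flipCLM D D ℝ).comp (flipCLM D D (D →L[ℝ] ℝ) (fderiv ℝ g z)))

theorem christoffel₁_apply (g : D → D →L[ℝ] D →L[ℝ] ℝ) (z a b t : D) :
    christoffel₁ g z a b t
      = (fderiv ℝ g z a b t + fderiv ℝ g z b a t - fderiv ℝ g z t a b) / 2 := by
  have : christoffel₁ g z a b t
    = 1 / 2 * (fderiv ℝ g z a b t + fderiv ℝ g z b a t - fderiv ℝ g z t a b) := rfl
  rw [this]; ring

/-- The Christoffel symbols of the metric `g`. -/
def christoffel (g : D → D →L[ℝ] D →L[ℝ] ℝ) (z : D) : D →L[ℝ] D →L[ℝ] D :=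
  (ContinuousLinearMap.compL ℝ D (D →L[ℝ] ℝ) D (g z).inverse).comp (christoffel₁ g z)

/-- The gradient of the function `P` for the metric `g`. -/
def metricGrad (g : D → D →L[ℝ] D →L[ℝ] ℝ) (P : D → ℝ) (z : D) : D :=
  (g z).inverse (fderiv ℝ P z)

variable {U : Set D} {g : D → D →L[ℝ] D →L[ℝ] ℝ}

/-- Definiteness gives injectivity, and a space has the dimension of its dual. This makes the total
function `inverse` in `christoffel` and `metricGrad` a genuine inverse. -/
theorem isInvertible_of_pos [FiniteDimensional ℝ D] {b : D →L[ℝ] D →L[ℝ] ℝ}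
    (hpos : ∀ a, a ≠ 0 → 0 < b a a) : ∃ e : D ≃L[ℝ] (D →L[ℝ] ℝ), (e : D →L[ℝ] D →L[ℝ] ℝ) = b := by
  have hinj : Function.Injective (b : D →ₗ[ℝ] D →L[ℝ] ℝ) := by
    rw [injective_iff_map_eq_zero]
    intro a ha
    by_contra h0
    have h1 := hpos a h0
    have h2 : b a = 0 := ha
    rw [h2] at h1
    simp at h1
  have hdim : Module.finrank ℝ D = Module.finrank ℝ (D →L[ℝ] ℝ) := by
    rw [← (LinearMap.toContinuousLinearMap (𝕜 := ℝ) (E := D) (F' := ℝ)).finrank_eq]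
    exact (Subspace.dual_finrank_eq (K := ℝ) (V := D)).symm
  refine ⟨(LinearEquiv.ofInjectiveOfFinrankEq _ hinj hdim).toContinuousLinearEquiv, ?_⟩
  ext a t
  rfl

theorem metric_inverse_apply [FiniteDimensional ℝ D] {b : D →L[ℝ] D →L[ℝ] ℝ}
    (hpos : ∀ a, a ≠ 0 → 0 < b a a) (l : D →L[ℝ] ℝ) : b (b.inverse l) = l := by
  obtain ⟨e, rfl⟩ := isInvertible_of_pos hpos
  simp

theorem contDiffOn_inverse_metric [FiniteDimensional ℝ D] (hg : ContDiffOn ℝ ∞ g U)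
    (hpos : ∀ z ∈ U, ∀ a, a ≠ 0 → 0 < g z a a) : ContDiffOn ℝ ∞ (fun z => (g z).inverse) U := by
  have : CompleteSpace D := FiniteDimensional.complete ℝ D
  intro z hz
  obtain ⟨e, he⟩ := isInvertible_of_pos (hpos z hz)
  have h1 : ContDiffAt ℝ ∞ ContinuousLinearMap.inverse (g z) := by
    rw [← he]; exact contDiffAt_map_inverse e
  exact h1.comp_contDiffWithinAt z (hg z hz)

theorem contDiffOn_christoffel [FiniteDimensional ℝ D] (hU : IsOpen U) (hg : ContDiffOn ℝ ∞ g U)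
    (hpos : ∀ z ∈ U, ∀ a, a ≠ 0 → 0 < g z a a) : ContDiffOn ℝ ∞ (christoffel g) U := by
  have hd := hg.fderiv_infty hU
  have hf := (flipCLM D D (D →L[ℝ] ℝ)).contDiff.comp_contDiffOn hd
  have h1 : ContDiffOn ℝ ∞ (christoffel₁ g) U :=
    ((hd.add hf).sub (contDiffOn_const.clm_comp hf)).const_smul (1 / 2 : ℝ)
  exact ((ContinuousLinearMap.compL ℝ D (D →L[ℝ] ℝ) D).contDiff.comp_contDiffOn
    (contDiffOn_inverse_metric hg hpos)).clm_comp h1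

theorem contDiffOn_metricGrad [FiniteDimensional ℝ D] (hU : IsOpen U) (hg : ContDiffOn ℝ ∞ g U)
    (hpos : ∀ z ∈ U, ∀ a, a ≠ 0 → 0 < g z a a) {P : D → ℝ} (hP : ContDiffOn ℝ ∞ P U) :
    ContDiffOn ℝ ∞ (metricGrad g P) U :=
  (contDiffOn_inverse_metric hg hpos).clm_apply (hP.fderiv_infty hU)

theorem metric_christoffel [FiniteDimensional ℝ D] {z : D} (hpos : ∀ a, a ≠ 0 → 0 < g z a a)
    (a b t : D) : g z (christoffel g z a b) t
      = (fderiv ℝ g z a b t + fderiv ℝ g z b a t - fderiv ℝ g z t a b) / 2 := by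
  rw [← christoffel₁_apply]
  exact congrArg (fun l : D →L[ℝ] ℝ => l t) (metric_inverse_apply hpos _)

theorem metric_metricGrad [FiniteDimensional ℝ D] {z : D} (hpos : ∀ a, a ≠ 0 → 0 < g z a a)
    (P : D → ℝ) (t : D) : g z (metricGrad g P z) t = fderiv ℝ P z t :=
  congrArg (fun l : D →L[ℝ] ℝ => l t) (metric_inverse_apply hpos _)

/-- Vanishing torsion and metric compatibility both follow from the Koszul formula and the symmetry
of `fderiv ℝ g z c`; only the Killing equation and the bracket relation remain as input. -/
theorem isIsometricLieAction_christoffel [FiniteDimensional ℝ D] {X : D → W →L[ℝ] D}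
    {br : W →L[ℝ] W →L[ℝ] W} (hU : IsOpen U) (hg : ContDiffOn ℝ ∞ g U) (hX : ContDiffOn ℝ ∞ X U)
    (hsymm : ∀ z ∈ U, ∀ a b, g z a b = g z b a) (hpos : ∀ z ∈ U, ∀ a, a ≠ 0 → 0 < g z a a)
    (hkill : ∀ z ∈ U, ∀ c a b,
      fderiv ℝ g z (X z c) a b + g z (fderiv ℝ X z a c) b + g z a (fderiv ℝ X z b c) = 0)
    (hbr : ∀ z ∈ U, ∀ a b, fderiv ℝ X z (X z b) a - fderiv ℝ X z (X z a) b = X z (br a b)) :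
    IsIsometricLieAction U g (christoffel g) X br := by
  have hd : ∀ z ∈ U, ∀ c a b, fderiv ℝ g z c a b = fderiv ℝ g z c b a := by
    intro z hz c a b
    have dg := hg.differentiableAt_of_isOpen hU hz
    have e : ∀ a b, fderiv ℝ (fun z => g z a b) z c = fderiv ℝ g z c a b := fun a b => by
      rw [fderiv_clm_apply₂ dg (differentiableAt_const _) (differentiableAt_const _)]; simp
    rw [← e, ← e, Filter.EventuallyEq.fderiv_apply_eq hU hz fun y hy => hsymm y hy a b]
  exact
    { isOpen := hU
      smooth_metric := hg
      smooth_conn := contDiffOn_christoffel hU hg hpos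
      smooth_action := hX
      symm := hsymm
      pos := hpos
      torsionFree := fun z hz a b => by
        refine eq_of_forall_metric_eq (hpos z hz) fun t => ?_
        rw [metric_christoffel (hpos z hz), metric_christoffel (hpos z hz), hd z hz t a b]
        ring
      metric := fun z hz c a b => by
        rw [hsymm z hz a, metric_christoffel (hpos z hz), metric_christoffel (hpos z hz),
          hd z hz c b a]
        ring
      killing := hkill
      bracket := hbr }

/-- The reciprocal of `g z a a` is continuous on the compact product of `K` with the unit sphere,
hence bounded there; the general case follows by homogeneity. -/
theorem exists_norm_sq_le [FiniteDimensional ℝ D] {K : Set D} (hK : IsCompact K)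
    (hg : ContinuousOn g K) (hpos : ∀ z ∈ K, ∀ a, a ≠ 0 → 0 < g z a a) :
    ∃ L : ℝ, 0 ≤ L ∧ ∀ z ∈ K, ∀ a, ‖a‖ ^ 2 ≤ L * g z a a := by
  have : ProperSpace D := FiniteDimensional.proper ℝ D
  have hS : IsCompact (K ×ˢ Metric.sphere (0 : D) 1) := hK.prod (isCompact_sphere _ _)
  have hcont : ContinuousOn (fun p : D × D => (g p.1 p.2 p.2)⁻¹) (K ×ˢ Metric.sphere (0 : D) 1) := by
    refine ContinuousOn.inv₀ ?_ ?_
    · have h1 : ContinuousOn (fun p : D × D => g p.1) (K ×ˢ Metric.sphere (0 : D) 1) :=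
        hg.comp continuousOn_fst fun p hp => hp.1
      exact (h1.clm_apply continuousOn_snd).clm_apply continuousOn_snd
    · rintro ⟨z, a⟩ ⟨hz, ha⟩
      refine (hpos z hz a ?_).ne'
      rintro rfl
      simp at ha
  obtain ⟨L, hL⟩ := hS.exists_bound_of_continuousOn hcont
  refine ⟨max L 0, le_max_right _ _, fun z hz a => ?_⟩
  by_cases ha : a = 0
  · simp [ha]
  have hn : 0 < ‖a‖ := norm_pos_iff.mpr ha
  have h1 := hL (z, ‖a‖⁻¹ • a) ⟨hz, by simp [norm_smul, hn.ne']⟩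
  have hga := hpos z hz a ha
  have e : g z (‖a‖⁻¹ • a) (‖a‖⁻¹ • a) = (‖a‖ ^ 2)⁻¹ * g z a a := by
    simp only [map_smul, smul_apply, smul_eq_mul]; field_simp
  simp only [e, mul_inv, inv_inv, norm_mul, norm_inv, Real.norm_eq_abs, abs_of_pos hga,
    abs_of_pos (pow_pos hn 2)] at h1
  rw [← div_eq_mul_inv, div_le_iff₀ hga] at h1
  exact h1.trans (by gcongr; exact le_max_left _ _)

/-- The tensors are built from the metric, connection, action and gradient and their first
derivatives, all continuous on `U`. Adding the individual bounds gives one `L` for all of them. -/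
theorem exists_isFibreBound [FiniteDimensional ℝ D] [FiniteDimensional ℝ W]
    {Γ : D → D →L[ℝ] D →L[ℝ] D} {X : D → W →L[ℝ] D} {P : D → ℝ} {Gr : D → D}
    {br : W →L[ℝ] W →L[ℝ] W} {B : W →L[ℝ] W →L[ℝ] ℝ}
    (H : IsIsometricLieAction U g Γ X br) (hbr : IsMetricLieBracket br B)
    (hP : IsInvariantPotential U g X P Gr) {K : Set D} (hK : IsCompact K) (hKU : K ⊆ U) :
    ∃ L : ℝ, ∀ z ∈ K, IsFibreBound g Γ X Gr br B L z := by
  obtain ⟨l1, h1n, h1⟩ := exists_norm_sq_le hK (H.smooth_metric.continuousOn.mono hKU)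
    fun z hz => H.pos z (hKU hz)
  obtain ⟨l2, h2⟩ := hK.exists_bound_of_continuousOn (H.smooth_metric.continuousOn.mono hKU)
  obtain ⟨l3, h3⟩ := hK.exists_bound_of_continuousOn (H.smooth_action.continuousOn.mono hKU)
  have hc4 : ContinuousOn (covKilling Γ X) U := by
    refine (H.smooth_action.fderiv_infty H.isOpen).continuousOn.add ?_
    exact (((ContinuousLinearMap.compL ℝ W D D).flip.continuous.comp_continuousOn
      H.smooth_action.continuousOn)).clm_comp H.smooth_conn.continuousOn
  obtain ⟨l4, h4⟩ := hK.exists_bound_of_continuousOn (hc4.mono hKU)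
  obtain ⟨l5, h5⟩ := hK.exists_bound_of_continuousOn (H.smooth_conn.continuousOn.mono hKU)
  obtain ⟨l6, h6⟩ := hK.exists_bound_of_continuousOn
    ((H.smooth_conn.fderiv_infty H.isOpen).continuousOn.mono hKU)
  obtain ⟨l7, h7⟩ := hK.exists_bound_of_continuousOn (hP.smooth_grad.continuousOn.mono hKU)
  have hc8 : ContinuousOn (fun z => fderiv ℝ Gr z + (Γ z).flip (Gr z)) U :=
    (hP.smooth_grad.fderiv_infty H.isOpen).continuousOn.add
      (((flipCLM D D D).continuous.comp_continuousOn H.smooth_conn.continuousOn).clm_apply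
        hP.smooth_grad.continuousOn)
  obtain ⟨l8, h8⟩ := hK.exists_bound_of_continuousOn (hc8.mono hKU)
  -- The form `B` is treated as a metric over a one-point base.
  obtain ⟨l9, h9n, h9⟩ := exists_norm_sq_le (g := fun _ : W => B) (K := {0}) isCompact_singleton
    continuousOn_const fun _ _ => hbr.pos
  set L := 1 + l1 + |l2| + |l3| + |l4| + (2 * |l6| + 2 * |l5| ^ 2) + |l7| + |l8| + l9 + ‖B‖ + ‖br‖
    with hL
  have n2 := abs_nonneg l2
  have n3 := abs_nonneg l3
  have n4 := abs_nonneg l4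
  have n5 := sq_nonneg |l5|
  have n6 := abs_nonneg l6
  have n7 := abs_nonneg l7
  have n8 := abs_nonneg l8
  have nB := norm_nonneg B
  have nb := norm_nonneg br
  refine ⟨L, fun z hz => ?_⟩
  exact
    { one_le := by linarith
      metric_lower := fun a => by
        have hg0 : 0 ≤ g z a a := by
          by_cases h0 : a = 0
          · simp [h0]
          · exact (H.pos z (hKU hz) a h0).le
        exact (h1 z hz a).trans (by gcongr; linarith)
      metric_upper := fun a b => by
        refine ((g z).le_opNorm₂ a b).trans ?_
        gcongr
        linarith [h2 z hz, le_abs_self l2]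
      action := fun c => by
        refine ((X z).le_opNorm c).trans ?_
        gcongr
        linarith [h3 z hz, le_abs_self l3]
      covKilling := fun a c => by
        refine ((covKilling Γ X z).le_opNorm₂ a c).trans ?_
        gcongr
        linarith [h4 z hz, le_abs_self l4]
      riem := fun a b e => by
        have hD : ∀ a b, ‖fderiv ℝ Γ z a b e‖ ≤ |l6| * ‖a‖ * ‖b‖ * ‖e‖ := fun a b => by
          refine ((fderiv ℝ Γ z a b).le_opNorm e).trans ?_
          gcongr
          refine ((fderiv ℝ Γ z).le_opNorm₂ a b).trans ?_
          gcongr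
          exact (h6 z hz).trans (le_abs_self _)
        have hΓ : ∀ a b, ‖Γ z a b‖ ≤ |l5| * ‖a‖ * ‖b‖ := fun a b => by
          refine ((Γ z).le_opNorm₂ a b).trans ?_
          gcongr
          exact (h5 z hz).trans (le_abs_self _)
        have hΓΓ : ∀ a b, ‖Γ z a (Γ z b e)‖ ≤ |l5| * ‖a‖ * (|l5| * ‖b‖ * ‖e‖) := fun a b =>
          (hΓ _ _).trans (by gcongr; exact hΓ _ _)
        have hs : ‖riem Γ z a b e‖ ≤ (|l6| * ‖a‖ * ‖b‖ * ‖e‖ + |l6| * ‖b‖ * ‖a‖ * ‖e‖)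
            + (|l5| * ‖a‖ * (|l5| * ‖b‖ * ‖e‖) + |l5| * ‖b‖ * (|l5| * ‖a‖ * ‖e‖)) :=
          (norm_add_le _ _).trans (add_le_add
            ((norm_sub_le _ _).trans (add_le_add (hD _ _) (hD _ _)))
            ((norm_sub_le _ _).trans (add_le_add (hΓΓ _ _) (hΓΓ _ _))))
        calc _ ≤ (2 * |l6| + 2 * |l5| ^ 2) * ‖a‖ * ‖b‖ * ‖e‖ := by linarith
          _ ≤ _ := by gcongr; linarith
      grad := by linarith [h7 z hz, le_abs_self l7]
      hess := fun a => by
        refine (ContinuousLinearMap.le_opNorm _ a).trans ?_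
        gcongr
        linarith [h8 z hz, le_abs_self l8]
      inner_lower := fun c => by
        have hB0 : 0 ≤ B c c := by
          by_cases h0 : c = 0
          · simp [h0]
          · exact (hbr.pos c h0).le
        exact (h9 0 rfl c).trans (by gcongr; linarith)
      inner_upper := fun a b => by
        refine (B.le_opNorm₂ a b).trans ?_
        gcongr
        linarith
      lie := fun a b => by
        refine (br.le_opNorm₂ a b).trans ?_
        gcongr
        linarith }

end LeviCivita

end

end YMH

namespace YMH

noncomputable section

/-! ### Local group actions on Euclidean spaces -/

section LocalAction

set_option maxSynthPendingDepth 3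

variable {S T H : Type*} [NormedAddCommGroup S] [NormedSpace ℝ S]
  [NormedAddCommGroup T] [NormedSpace ℝ T] [NormedAddCommGroup H] [NormedSpace ℝ H]

theorem fderiv_slice_left {F : S × T → H} {s : S} {t : T} (hF : DifferentiableAt ℝ F (s, t))
    (a : S) : fderiv ℝ (fun s => F (s, t)) s a = fderiv ℝ F (s, t) (a, 0) := by
  have h := (HasFDerivAt.comp (g := F) (f := fun s => (s, t)) s hF.hasFDerivAt
    (hasFDerivAt_prodMk_left s t)).fderiv
  rw [show (fun s => F (s, t)) = F ∘ fun s => (s, t) from rfl, h]; simp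

theorem fderiv_slice_right {F : S × T → H} {s : S} {t : T} (hF : DifferentiableAt ℝ F (s, t))
    (a : T) : fderiv ℝ (fun t => F (s, t)) t a = fderiv ℝ F (s, t) (0, a) := by
  have h := (HasFDerivAt.comp (g := F) (f := fun t => (s, t)) t hF.hasFDerivAt
    (hasFDerivAt_prodMk_right s t)).fderiv
  rw [show (fun t => F (s, t)) = F ∘ fun t => (s, t) from rfl, h]; simp

theorem differentiableAt_slice_left {F : S × T → H} {s : S} {t : T}
    (hF : DifferentiableAt ℝ F (s, t)) : DifferentiableAt ℝ (fun s => F (s, t)) s :=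
  (HasFDerivAt.comp (g := F) (f := fun s => (s, t)) s hF.hasFDerivAt
    (hasFDerivAt_prodMk_left s t)).differentiableAt

theorem differentiableAt_slice_right {F : S × T → H} {s : S} {t : T}
    (hF : DifferentiableAt ℝ F (s, t)) : DifferentiableAt ℝ (fun t => F (s, t)) t :=
  (HasFDerivAt.comp (g := F) (f := fun t => (s, t)) t hF.hasFDerivAt
    (hasFDerivAt_prodMk_right s t)).differentiableAt

variable {D : Type*} [NormedAddCommGroup D] [NormedSpace ℝ D]

/-- The infinitesimal generators `z ↦ d/ds Φ(s, z)` at `s = e`. -/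
def actField (Φ : S × D → D) (e : S) (z : D) : S →L[ℝ] D :=
  (fderiv ℝ Φ (e, z)).comp (ContinuousLinearMap.inl ℝ S D)

@[simp] theorem actField_apply (Φ : S × D → D) (e : S) (z : D) (c : S) :
    actField Φ e z c = fderiv ℝ Φ (e, z) (c, 0) := rfl

/-- `Φ` is smooth on `O`, which contains `{e} × U`, and `Φ(e, z) = z`. -/
structure IsLocalAction (Φ : S × D → D) (e : S) (O : Set (S × D)) (U : Set D) : Prop where
  isOpen : IsOpen O
  isOpen_base : IsOpen U
  mem : ∀ z ∈ U, (e, z) ∈ O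
  smooth : ContDiffOn ℝ ∞ Φ O
  id_apply : ∀ z ∈ U, Φ (e, z) = z

variable {Φ : S × D → D} {e : S} {O : Set (S × D)} {U : Set D}

theorem IsLocalAction.contDiffOn_actField (h : IsLocalAction Φ e O U) :
    ContDiffOn ℝ ∞ (actField Φ e) U :=
  ((h.smooth.fderiv_infty h.isOpen).comp (contDiffOn_const.prodMk contDiffOn_id)
    fun z hz => h.mem z hz).clm_comp contDiffOn_const

theorem IsLocalAction.fderiv_actField (h : IsLocalAction Φ e O U) {z : D} (hz : z ∈ U) (a : D)
    (c : S) : fderiv ℝ (actField Φ e) z a c = fderiv ℝ (fderiv ℝ Φ) (e, z) (0, a) (c, 0) := by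
  have dX := h.contDiffOn_actField.differentiableAt_of_isOpen h.isOpen_base hz
  have dd := (h.smooth.fderiv_infty h.isOpen).differentiableAt_of_isOpen h.isOpen (h.mem z hz)
  rw [← fderiv_clm_apply_const dX]
  simp only [actField_apply]
  rw [fderiv_clm_apply_const (c := fun z => fderiv ℝ Φ (e, z)) (differentiableAt_slice_right dd),
    fderiv_slice_right dd]

theorem IsLocalAction.fderiv_id (h : IsLocalAction Φ e O U) {z : D} (hz : z ∈ U) (a : D) :
    fderiv ℝ Φ (e, z) (0, a) = a := by
  have d := h.smooth.differentiableAt_of_isOpen h.isOpen (h.mem z hz)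
  rw [← fderiv_slice_right d, Filter.EventuallyEq.fderiv_apply_eq h.isOpen_base hz h.id_apply]
  simp

/-- An action by isometries has Killing generators. -/
theorem IsLocalAction.killing (h : IsLocalAction Φ e O U) {g : D → D →L[ℝ] D →L[ℝ] ℝ}
    (hg : ContDiffOn ℝ ∞ g U) {z : D} (hz : z ∈ U)
    (hiso : ∀ a b : D, ∀ᶠ s in nhds e,
      g (Φ (s, z)) (fderiv ℝ Φ (s, z) (0, a)) (fderiv ℝ Φ (s, z) (0, b)) = g z a b)
    (c : S) (a b : D) :
    fderiv ℝ g z (actField Φ e z c) a b + g z (fderiv ℝ (actField Φ e) z a c) b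
      + g z a (fderiv ℝ (actField Φ e) z b c) = 0 := by
  have d := h.smooth.differentiableAt_of_isOpen h.isOpen (h.mem z hz)
  have dd := (h.smooth.fderiv_infty h.isOpen).differentiableAt_of_isOpen h.isOpen (h.mem z hz)
  have dg := hg.differentiableAt_of_isOpen h.isOpen_base hz
  have e0 : fderiv ℝ (fun s => g (Φ (s, z)) (fderiv ℝ Φ (s, z) (0, a))
      (fderiv ℝ Φ (s, z) (0, b))) e c = 0 := by
    rw [Filter.EventuallyEq.fderiv_eq (f := fun _ => g z a b) (hiso a b)]; simp
  have dg' : DifferentiableAt ℝ g (Φ (e, z)) := by rw [h.id_apply z hz]; exact dg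
  have dΦ := differentiableAt_slice_left d
  have ddΦ : DifferentiableAt ℝ (fun s => fderiv ℝ Φ (s, z)) e := differentiableAt_slice_left dd
  have dgΦ : DifferentiableAt ℝ (fun s => g (Φ (s, z))) e := dg'.comp e dΦ
  have da : ∀ a : D, DifferentiableAt ℝ (fun s => fderiv ℝ Φ (s, z) (0, a)) e := fun a =>
    ddΦ.clm_apply (differentiableAt_const _)
  have e1 : ∀ a : D, fderiv ℝ (fun s => fderiv ℝ Φ (s, z) (0, a)) e c
      = fderiv ℝ (actField Φ e) z a c := fun a => by
    rw [fderiv_clm_apply_const (c := fun s => fderiv ℝ Φ (s, z)) ddΦ, fderiv_slice_left dd,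
      h.fderiv_actField hz, fderiv_fderiv_comm h.smooth h.isOpen (h.mem z hz)]
  rw [fderiv_clm_apply₂ (c := fun s => g (Φ (s, z))) dgΦ (da a) (da b), e1, e1,
    fderiv_comp_apply' (w := fun s => Φ (s, z)) dg' dΦ, fderiv_slice_left d, h.fderiv_id hz,
    h.fderiv_id hz] at e0
  simp only [h.id_apply z hz] at e0
  exact e0

/-- An invariant function is constant along the generators. -/
theorem IsLocalAction.fderiv_invariant (h : IsLocalAction Φ e O U) {P : D → ℝ}
    (hP : ContDiffOn ℝ ∞ P U) {z : D} (hz : z ∈ U)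
    (hinv : ∀ᶠ s in nhds e, P (Φ (s, z)) = P z) (c : S) :
    fderiv ℝ P z (actField Φ e z c) = 0 := by
  have d := h.smooth.differentiableAt_of_isOpen h.isOpen (h.mem z hz)
  have dP := hP.differentiableAt_of_isOpen h.isOpen_base hz
  have dP' : DifferentiableAt ℝ P (Φ (e, z)) := by rw [h.id_apply z hz]; exact dP
  have e0 : fderiv ℝ (fun s => P (Φ (s, z))) e c = 0 := by
    rw [Filter.EventuallyEq.fderiv_eq (f := fun _ => P z) hinv]; simp
  rw [fderiv_comp_apply' (w := fun s => Φ (s, z)) dP' (differentiableAt_slice_left d),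
    fderiv_slice_left d, h.id_apply z hz] at e0
  exact e0

/-- `m` is a smooth local multiplication with unit `e`. -/
structure IsLocalMul (m : S × S → S) (e : S) (M : Set (S × S)) (N : Set S) : Prop where
  isOpen : IsOpen M
  isOpen_base : IsOpen N
  mem_base : e ∈ N
  left_mem : ∀ s ∈ N, (e, s) ∈ M
  right_mem : ∀ s ∈ N, (s, e) ∈ M
  smooth : ContDiffOn ℝ ∞ m M
  one_mul : ∀ s ∈ N, m (e, s) = s
  mul_one : ∀ s ∈ N, m (s, e) = s

variable {m : S × S → S} {M : Set (S × S)} {N : Set S}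

theorem IsLocalMul.fderiv_left (h : IsLocalMul m e M N) (a : S) :
    fderiv ℝ m (e, e) (a, 0) = a := by
  have d := h.smooth.differentiableAt_of_isOpen h.isOpen (h.left_mem e h.mem_base)
  rw [← fderiv_slice_left d, Filter.EventuallyEq.fderiv_apply_eq h.isOpen_base h.mem_base h.mul_one]
  simp

/-- The Lie bracket of a local multiplication. -/
def localBracket (m : S × S → S) (e a b : S) : S :=
  fderiv ℝ (fderiv ℝ m) (e, e) (a, 0) (0, b) - fderiv ℝ (fderiv ℝ m) (e, e) (b, 0) (0, a)

/-- Differentiate `Φ(st, z) = Φ(s, Φ(t, z))` in `s` and then in `t` at the unit, and antisymmetrise.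
The second derivative of `Φ` is symmetric and drops out, and the mixed second derivatives of the
multiplication form the bracket. The order on the left reflects that a left action is an
antihomomorphism into vector fields. -/
theorem IsLocalAction.bracket (h : IsLocalAction Φ e O U) (hm : IsLocalMul m e M N) {z : D}
    (hz : z ∈ U) (hact : ∀ᶠ p : S × S in nhds (e, e), Φ (m p, z) = Φ (p.1, Φ (p.2, z))) (a b : S) :
    fderiv ℝ (actField Φ e) z (actField Φ e z b) a - fderiv ℝ (actField Φ e) z (actField Φ e z a) b
      = actField Φ e z (localBracket m e a b) := by
  have d := h.smooth.differentiableAt_of_isOpen h.isOpen (h.mem z hz)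
  have dd := (h.smooth.fderiv_infty h.isOpen).differentiableAt_of_isOpen h.isOpen (h.mem z hz)
  have hee := hm.left_mem e hm.mem_base
  have dm := (hm.smooth.fderiv_infty hm.isOpen).differentiableAt_of_isOpen hm.isOpen hee
  have dX := h.contDiffOn_actField.differentiableAt_of_isOpen h.isOpen_base hz
  have dΦ : DifferentiableAt ℝ (fun t => Φ (t, z)) e := differentiableAt_slice_left d
  have hΦz : Φ (e, z) = z := h.id_apply z hz
  -- differentiate in the first factor
  have key : ∀ a : S, ∀ᶠ t in nhds e, fderiv ℝ Φ (t, z) (fderiv ℝ m (e, t) (a, 0), 0)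
      = actField Φ e (Φ (t, z)) a := by
    intro a
    -- The factors are interchanged so that `curry` yields, for each `t` near `e`, an identity for
    -- all `s` near `e`, which can be differentiated in `s`.
    have hswap : ∀ᶠ p : S × S in nhds (e, e), Φ (m (p.2, p.1), z) = Φ (p.2, Φ (p.1, z)) :=
      (continuous_swap.tendsto ((e, e) : S × S)).eventually hact
    rw [nhds_prod_eq] at hswap
    have hU' : ∀ᶠ t in nhds e, Φ (t, z) ∈ U := dΦ.continuousAt.eventually_mem
      (by rw [hΦz]; exact h.isOpen_base.mem_nhds hz)
    have hO' : ∀ᶠ t in nhds e, (t, z) ∈ O :=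
      (Continuous.prodMk_left z).continuousAt.eventually_mem (h.isOpen.mem_nhds (h.mem z hz))
    filter_upwards [hswap.curry, hU', hO', hm.isOpen_base.mem_nhds hm.mem_base] with t ht1 ht2 ht3 ht4
    have dmt := hm.smooth.differentiableAt_of_isOpen hm.isOpen (hm.left_mem t ht4)
    have dms : DifferentiableAt ℝ (fun s => m (s, t)) e := differentiableAt_slice_left dmt
    have dtz := h.smooth.differentiableAt_of_isOpen h.isOpen ht3
    have dtz' : DifferentiableAt ℝ (fun s => Φ (s, z)) (m (e, t)) := by
      rw [hm.one_mul t ht4]; exact differentiableAt_slice_left dtz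
    have e1 := congrArg (fun L : S →L[ℝ] D => L a) (Filter.EventuallyEq.fderiv_eq ht1)
    rw [fderiv_comp_apply' (f := fun s => Φ (s, z)) (w := fun s => m (s, t)) dtz' dms,
      fderiv_slice_left dmt, hm.one_mul t ht4, fderiv_slice_left dtz,
      fderiv_slice_left (h.smooth.differentiableAt_of_isOpen h.isOpen (h.mem _ ht2))] at e1
    exact e1
  -- Now the derivative of `key` in `t` at the unit.
  have key2 : ∀ a b : S, fderiv ℝ (fderiv ℝ Φ) (e, z) (b, 0) (a, 0)
      + fderiv ℝ Φ (e, z) (fderiv ℝ (fderiv ℝ m) (e, e) (0, b) (a, 0), 0)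
      = fderiv ℝ (actField Φ e) z (actField Φ e z b) a := by
    intro a b
    have e1 := congrArg (fun L : S →L[ℝ] D => L b) (Filter.EventuallyEq.fderiv_eq (key a))
    have d1 : DifferentiableAt ℝ (fun t => fderiv ℝ Φ (t, z)) e := differentiableAt_slice_left dd
    have d2 : DifferentiableAt ℝ (fun t => fderiv ℝ m (e, t)) e := differentiableAt_slice_right dm
    have d3 : DifferentiableAt ℝ (fun t => fderiv ℝ m (e, t) ((a, 0) : S × S)) e :=
      d2.clm_apply (differentiableAt_const _)
    have d4 : DifferentiableAt ℝ
        (fun t => ContinuousLinearMap.inl ℝ S D (fderiv ℝ m (e, t) ((a, 0) : S × S))) e :=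
      (ContinuousLinearMap.inl ℝ S D).differentiableAt.comp e d3
    have dX' : DifferentiableAt ℝ (actField Φ e) (Φ (e, z)) := by rw [hΦz]; exact dX
    have dX2 : DifferentiableAt ℝ (fun t => actField Φ e (Φ (t, z))) e :=
      DifferentiableAt.comp (g := actField Φ e) (f := fun t => Φ (t, z)) e dX' dΦ
    have e2 : fderiv ℝ (fun t => fderiv ℝ Φ (t, z) (fderiv ℝ m (e, t) ((a, 0) : S × S), 0)) e b
        = fderiv ℝ (fderiv ℝ Φ) (e, z) (b, 0) (a, 0)
          + fderiv ℝ Φ (e, z) (fderiv ℝ (fderiv ℝ m) (e, e) (0, b) (a, 0), 0) := by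
      have := fderiv_clm_apply_apply d1 d4 b
      simp only [ContinuousLinearMap.inl_apply] at this
      rw [this, fderiv_slice_left dd, hm.fderiv_left]
      congr 2
      have h4 := fderiv_comp_apply' (f := ContinuousLinearMap.inl ℝ S D)
        (w := fun t => fderiv ℝ m (e, t) ((a, 0) : S × S))
        (ContinuousLinearMap.inl ℝ S D).differentiableAt d3 b
      rw [ContinuousLinearMap.fderiv, fderiv_clm_apply_const (c := fun t => fderiv ℝ m (e, t)) d2,
        fderiv_slice_right dm] at h4
      exact h4
    rw [e2, fderiv_clm_apply_const (c := fun t => actField Φ e (Φ (t, z))) dX2,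
      fderiv_comp_apply' (w := fun t => Φ (t, z)) dX' dΦ, fderiv_slice_left d, hΦz] at e1
    exact e1
  rw [← key2, ← key2, fderiv_fderiv_comm h.smooth h.isOpen (h.mem z hz) (b, 0) (a, 0),
    fderiv_fderiv_comm hm.smooth hm.isOpen hee (0, b), fderiv_fderiv_comm hm.smooth hm.isOpen hee
      (0, a)]
  simp only [localBracket, ← actField_apply, map_sub]
  abel

/-- The derivative of the adjoint representation is the bracket. -/
theorem IsLocalMul.invariant (hm : IsLocalMul m e M N) {q : S × S → S} {Q : Set (S × S)}
    (hQ : IsOpen Q) (hqs : ContDiffOn ℝ ∞ q Q) (hNQ : ∀ s ∈ N, (s, e) ∈ Q)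
    (hq1 : ∀ s ∈ N, q (s, e) = e) (hqe : ∀ t ∈ N, (e, t) ∈ Q ∧ q (e, t) = t)
    (hq : ∀ᶠ p : S × S in nhds (e, e), m (q p, p.1) = m p)
    {B : S →L[ℝ] S →L[ℝ] ℝ}
    (hB : ∀ a b : S, ∀ᶠ s in nhds e,
      B (fderiv ℝ q (s, e) (0, a)) (fderiv ℝ q (s, e) (0, b)) = B a b) (c a b : S) :
    B (localBracket m e c a) b + B a (localBracket m e c b) = 0 := by
  have hee := hm.left_mem e hm.mem_base
  have dm := (hm.smooth.fderiv_infty hm.isOpen).differentiableAt_of_isOpen hm.isOpen hee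
  have hqee := hNQ e hm.mem_base
  have dq := (hqs.fderiv_infty hQ).differentiableAt_of_isOpen hQ hqee
  have d1 : DifferentiableAt ℝ (fun s => fderiv ℝ q (s, e)) e := differentiableAt_slice_left dq
  have hAd : ∀ a : S, fderiv ℝ q (e, e) (0, a) = a := fun a => by
    rw [← fderiv_slice_right (hqs.differentiableAt_of_isOpen hQ hqee),
      Filter.EventuallyEq.fderiv_apply_eq hm.isOpen_base hm.mem_base fun t ht => (hqe t ht).2]
    simp
  have d2 : ∀ a : S, DifferentiableAt ℝ (fun s => fderiv ℝ q (s, e) ((0, a) : S × S)) e := fun a =>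
    d1.clm_apply (differentiableAt_const _)
  -- Conjugation `q` enters only through `q(s, t) s = s t`, so no inverse has to be differentiated.
  -- This is the derivative in `t` at the unit; differentiating once more in `s` gives `hbr`.
  have key : ∀ a : S, ∀ᶠ s in nhds e, fderiv ℝ m (e, s) (fderiv ℝ q (s, e) (0, a), 0)
      = fderiv ℝ m (s, e) (0, a) := by
    intro a
    rw [nhds_prod_eq] at hq
    filter_upwards [hq.curry, hm.isOpen_base.mem_nhds hm.mem_base] with s hs1 hs2
    have dqs := hqs.differentiableAt_of_isOpen hQ (hNQ s hs2)
    have dm1 := hm.smooth.differentiableAt_of_isOpen hm.isOpen (hm.left_mem s hs2)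
    have dm2 := hm.smooth.differentiableAt_of_isOpen hm.isOpen (hm.right_mem s hs2)
    have dm1' : DifferentiableAt ℝ (fun r => m (r, s)) (q (s, e)) := by
      rw [hq1 s hs2]; exact differentiableAt_slice_left dm1
    have e1 := congrArg (fun L : S →L[ℝ] S => L a) (Filter.EventuallyEq.fderiv_eq hs1)
    rw [fderiv_comp_apply' (f := fun r => m (r, s)) (w := fun t => q (s, t)) dm1'
      (differentiableAt_slice_right dqs), fderiv_slice_right dqs, hq1 s hs2, fderiv_slice_left dm1,
      fderiv_slice_right dm2] at e1
    exact e1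
  have hbr : ∀ c a : S, fderiv ℝ (fun s => fderiv ℝ q (s, e) ((0, a) : S × S)) e c
      = localBracket m e c a := by
    intro c a
    have e1 := congrArg (fun L : S →L[ℝ] S => L c) (Filter.EventuallyEq.fderiv_eq (key a))
    have d3 : DifferentiableAt ℝ (fun s => fderiv ℝ m (e, s)) e := differentiableAt_slice_right dm
    have d3' : DifferentiableAt ℝ (fun s => fderiv ℝ m (s, e)) e := differentiableAt_slice_left dm
    have d4 : DifferentiableAt ℝ
        (fun s => ContinuousLinearMap.inl ℝ S S (fderiv ℝ q (s, e) ((0, a) : S × S))) e :=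
      (ContinuousLinearMap.inl ℝ S S).differentiableAt.comp e (d2 a)
    have e2 := fderiv_clm_apply_apply d3 d4 c
    simp only [ContinuousLinearMap.inl_apply] at e2
    have h4 := fderiv_comp_apply' (f := ContinuousLinearMap.inl ℝ S S)
        (w := fun s => fderiv ℝ q (s, e) ((0, a) : S × S))
        (ContinuousLinearMap.inl ℝ S S).differentiableAt (d2 a) c
    rw [ContinuousLinearMap.fderiv] at h4
    simp only [ContinuousLinearMap.inl_apply] at h4
    rw [e2, h4, hm.fderiv_left, hAd, fderiv_slice_right dm,
      fderiv_clm_apply_const (c := fun s => fderiv ℝ m (s, e)) d3', fderiv_slice_left dm,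
      fderiv_fderiv_comm hm.smooth hm.isOpen hee (0, c)] at e1
    rw [localBracket, ← e1]; abel
  have e0 : fderiv ℝ (fun s => B (fderiv ℝ q (s, e) ((0, a) : S × S))
      (fderiv ℝ q (s, e) ((0, b) : S × S))) e c = 0 := by
    rw [Filter.EventuallyEq.fderiv_eq (f := fun _ => B a b) (hB a b)]; simp
  rw [fderiv_clm_apply₂ (c := fun _ => B) (differentiableAt_const _) (d2 a) (d2 b), hbr, hbr, hAd,
    hAd] at e0
  simpa using e0

end LocalAction

end

end YMH

namespace YMH

noncomputable section

/-! ### Charts of manifolds modelled on Euclidean spaces -/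

section Charts

set_option linter.unusedSectionVars false

set_option maxSynthPendingDepth 3

variable {d : ℕ} {N : Type*} [TopologicalSpace N] [ChartedSpace (Eu d) N] [IsManifold (𝓡 d) ∞ N]

theorem isOpen_target (y₀ : N) : IsOpen (extChartAt (𝓡 d) y₀).target := isOpen_extChartAt_target y₀

theorem symm_mem_source {y₀ : N} {z : Eu d} (hz : z ∈ (extChartAt (𝓡 d) y₀).target) :
    (extChartAt (𝓡 d) y₀).symm z ∈ (chartAt (Eu d) y₀).source := by
  have := (extChartAt (𝓡 d) y₀).map_target hz
  rwa [extChartAt_source] at this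

theorem mem_target {y₀ y : N} (hy : y ∈ (chartAt (Eu d) y₀).source) :
    extChartAt (𝓡 d) y₀ y ∈ (extChartAt (𝓡 d) y₀).target :=
  (extChartAt (𝓡 d) y₀).map_source (by rwa [extChartAt_source])

theorem left_inv_chart {y₀ y : N} (hy : y ∈ (chartAt (Eu d) y₀).source) :
    (extChartAt (𝓡 d) y₀).symm (extChartAt (𝓡 d) y₀ y) = y :=
  (extChartAt (𝓡 d) y₀).left_inv (by rwa [extChartAt_source])

theorem right_inv_chart {y₀ : N} {z : Eu d} (hz : z ∈ (extChartAt (𝓡 d) y₀).target) :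
    extChartAt (𝓡 d) y₀ ((extChartAt (𝓡 d) y₀).symm z) = z :=
  (extChartAt (𝓡 d) y₀).right_inv hz

theorem contMDiffAt_chart {y₀ y : N} (hy : y ∈ (chartAt (Eu d) y₀).source) :
    ContMDiffAt (𝓡 d) (𝓡 d) ∞ (extChartAt (𝓡 d) y₀) y :=
  contMDiffAt_extChartAt' hy

theorem contMDiffAt_chart_symm {y₀ : N} {z : Eu d} (hz : z ∈ (extChartAt (𝓡 d) y₀).target) :
    ContMDiffAt (𝓡 d) (𝓡 d) ∞ (extChartAt (𝓡 d) y₀).symm z :=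
  (contMDiffOn_extChartAt_symm y₀).contMDiffAt ((isOpen_target y₀).mem_nhds hz)

theorem mdifferentiableAt_chart {y₀ y : N} (hy : y ∈ (chartAt (Eu d) y₀).source) :
    MDifferentiableAt (𝓡 d) (𝓡 d) (extChartAt (𝓡 d) y₀) y :=
  (contMDiffAt_chart hy).mdifferentiableAt (by simp)

theorem mdifferentiableAt_chart_symm {y₀ : N} {z : Eu d}
    (hz : z ∈ (extChartAt (𝓡 d) y₀).target) :
    MDifferentiableAt (𝓡 d) (𝓡 d) (extChartAt (𝓡 d) y₀).symm z :=
  (contMDiffAt_chart_symm hz).mdifferentiableAt (by simp)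

theorem mfderiv_chart_mfderiv_symm {y₀ : N} {z : Eu d} (hz : z ∈ (extChartAt (𝓡 d) y₀).target)
    (a : Eu d) : mfderiv (𝓡 d) (𝓡 d) (extChartAt (𝓡 d) y₀) ((extChartAt (𝓡 d) y₀).symm z)
      (mfderiv (𝓡 d) (𝓡 d) (extChartAt (𝓡 d) y₀).symm z a) = a := by
  have : IsManifold (𝓡 d) 1 N := IsManifold.of_le (n := ∞) (by simp)
  have h := mfderiv_extChartAt_comp_mfderivWithin_extChartAt_symm (I := 𝓡 d) hz
  rw [ModelWithCorners.range_eq_univ, mfderivWithin_univ] at h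
  exact congrArg (fun L : Eu d →L[ℝ] Eu d => L a) h

theorem mfderiv_symm_mfderiv_chart {y₀ y : N} (hy : y ∈ (chartAt (Eu d) y₀).source) (a : Eu d) :
    (mfderiv (𝓡 d) (𝓡 d) (extChartAt (𝓡 d) y₀).symm (extChartAt (𝓡 d) y₀ y) : Eu d →L[ℝ] Eu d)
      (mfderiv (𝓡 d) (𝓡 d) (extChartAt (𝓡 d) y₀) y a) = a := by
  have : IsManifold (𝓡 d) 1 N := IsManifold.of_le (n := ∞) (by simp)
  have h := mfderivWithin_extChartAt_symm_comp_mfderiv_extChartAt' (I := 𝓡 d) (x := y₀) (y := y)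
    (by rwa [extChartAt_source])
  rw [ModelWithCorners.range_eq_univ, mfderivWithin_univ] at h
  exact congrArg (fun L : Eu d →L[ℝ] Eu d => L a) h

theorem fderiv_chart_comp {E : Type*} [NormedAddCommGroup E] [NormedSpace ℝ E] {f : E → N} {x : E}
    {y₀ : N} (hf : MDifferentiableAt 𝓘(ℝ, E) (𝓡 d) f x) (hx : f x ∈ (chartAt (Eu d) y₀).source)
    (v : E) : fderiv ℝ (fun x => extChartAt (𝓡 d) y₀ (f x)) x v
      = mfderiv (𝓡 d) (𝓡 d) (extChartAt (𝓡 d) y₀) (f x) (mfderiv 𝓘(ℝ, E) (𝓡 d) f x v) := by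
  rw [← mfderiv_eq_fderiv]
  have h := mfderiv_comp x (mdifferentiableAt_chart hx) hf
  exact congrArg (fun L : E →L[ℝ] Eu d => L v) h

theorem mfderiv_comp_chart_symm {k : ℕ} {G : Type*} [TopologicalSpace G] [ChartedSpace (Eu k) G]
    {f : N → G} {y₀ : N} {z : Eu d} (hz : z ∈ (extChartAt (𝓡 d) y₀).target)
    (hf : MDifferentiableAt (𝓡 d) (𝓡 k) f ((extChartAt (𝓡 d) y₀).symm z)) (a : Eu d) :
    mfderiv (𝓡 d) (𝓡 k) (fun z => f ((extChartAt (𝓡 d) y₀).symm z)) z a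
      = mfderiv (𝓡 d) (𝓡 k) f ((extChartAt (𝓡 d) y₀).symm z)
        (mfderiv (𝓡 d) (𝓡 d) (extChartAt (𝓡 d) y₀).symm z a) := by
  have h := mfderiv_comp z hf (mdifferentiableAt_chart_symm hz)
  exact congrArg (fun L : Eu d →L[ℝ] Eu k => L a) h

theorem contDiffAt_chart_comp {E : Type*} [NormedAddCommGroup E] [NormedSpace ℝ E] {f : E → N}
    {x : E} {y₀ : N} (hf : ContMDiffAt 𝓘(ℝ, E) (𝓡 d) ∞ f x)
    (hx : f x ∈ (chartAt (Eu d) y₀).source) :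
    ContDiffAt ℝ ∞ (fun x => extChartAt (𝓡 d) y₀ (f x)) x :=
  ((contMDiffAt_chart hx).comp x hf).contDiffAt

end Charts

/-! ### Maps of two variables in charts: the common form of action, multiplication and conjugation
-/

section ChartMap

set_option linter.unusedSectionVars false

set_option maxSynthPendingDepth 3

variable {a b c : ℕ} {X₁ X₂ X₃ : Type*}
  [TopologicalSpace X₁] [ChartedSpace (Eu a) X₁] [IsManifold (𝓡 a) ∞ X₁]
  [TopologicalSpace X₂] [ChartedSpace (Eu b) X₂] [IsManifold (𝓡 b) ∞ X₂]
  [TopologicalSpace X₃] [ChartedSpace (Eu c) X₃] [IsManifold (𝓡 c) ∞ X₃]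

/-- The expression of a map of two variables in charts. -/
def chartMap (x₁ : X₁) (x₂ : X₂) (x₃ : X₃) (F : X₁ → X₂ → X₃) (p : Eu a × Eu b) : Eu c :=
  extChartAt (𝓡 c) x₃ (F ((extChartAt (𝓡 a) x₁).symm p.1) ((extChartAt (𝓡 b) x₂).symm p.2))

/-- The domain on which `chartMap` represents `F`. -/
def chartDomain (x₁ : X₁) (x₂ : X₂) (x₃ : X₃) (F : X₁ → X₂ → X₃) : Set (Eu a × Eu b) :=
  {p | (p.1 ∈ (extChartAt (𝓡 a) x₁).target ∧ p.2 ∈ (extChartAt (𝓡 b) x₂).target) ∧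
    F ((extChartAt (𝓡 a) x₁).symm p.1) ((extChartAt (𝓡 b) x₂).symm p.2)
      ∈ (chartAt (Eu c) x₃).source}

variable {x₁ : X₁} {x₂ : X₂} {x₃ : X₃} {F : X₁ → X₂ → X₃}

theorem contMDiffOn_chartMap_aux
    (hF : ContMDiff ((𝓡 a).prod (𝓡 b)) (𝓡 c) ∞ fun p : X₁ × X₂ => F p.1 p.2) :
    ContMDiffOn 𝓘(ℝ, Eu a × Eu b) (𝓡 c) ∞ (fun p : Eu a × Eu b =>
      F ((extChartAt (𝓡 a) x₁).symm p.1) ((extChartAt (𝓡 b) x₂).symm p.2))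
      ((extChartAt (𝓡 a) x₁).target ×ˢ (extChartAt (𝓡 b) x₂).target) := by
  have h1 : ContMDiffOn 𝓘(ℝ, Eu a × Eu b) (𝓡 a) ∞
      (fun p : Eu a × Eu b => (extChartAt (𝓡 a) x₁).symm p.1)
      ((extChartAt (𝓡 a) x₁).target ×ˢ (extChartAt (𝓡 b) x₂).target) :=
    (contMDiffOn_extChartAt_symm x₁).comp contDiff_fst.contMDiff.contMDiffOn fun p hp => hp.1
  have h2 : ContMDiffOn 𝓘(ℝ, Eu a × Eu b) (𝓡 b) ∞
      (fun p : Eu a × Eu b => (extChartAt (𝓡 b) x₂).symm p.2)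
      ((extChartAt (𝓡 a) x₁).target ×ˢ (extChartAt (𝓡 b) x₂).target) :=
    (contMDiffOn_extChartAt_symm x₂).comp contDiff_snd.contMDiff.contMDiffOn fun p hp => hp.2
  exact hF.comp_contMDiffOn (h1.prodMk h2)

theorem isOpen_chartDomain
    (hF : ContMDiff ((𝓡 a).prod (𝓡 b)) (𝓡 c) ∞ fun p : X₁ × X₂ => F p.1 p.2) :
    IsOpen (chartDomain (a := a) (b := b) (c := c) x₁ x₂ x₃ F) :=
  (contMDiffOn_chartMap_aux (x₁ := x₁) (x₂ := x₂) hF).continuousOn.isOpen_inter_preimage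
    ((isOpen_target x₁).prod (isOpen_target x₂)) (chartAt (Eu c) x₃).open_source

theorem contDiffOn_chartMap
    (hF : ContMDiff ((𝓡 a).prod (𝓡 b)) (𝓡 c) ∞ fun p : X₁ × X₂ => F p.1 p.2) :
    ContDiffOn ℝ ∞ (chartMap (a := a) (b := b) (c := c) x₁ x₂ x₃ F) (
      chartDomain (a := a) (b := b) (c := c) x₁ x₂ x₃ F) := fun _ hp =>
  (contDiffAt_chart_comp ((contMDiffOn_chartMap_aux hF).contMDiffAt
    (((isOpen_target x₁).prod (isOpen_target x₂)).mem_nhds hp.1)) hp.2).contDiffWithinAt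

theorem mdifferentiableAt_left
    (hF : ContMDiff ((𝓡 a).prod (𝓡 b)) (𝓡 c) ∞ fun p : X₁ × X₂ => F p.1 p.2) (x : X₁) (y : X₂) :
    MDifferentiableAt (𝓡 a) (𝓡 c) (fun x => F x y) x :=
  (hF.comp (contMDiff_id.prodMk contMDiff_const) : ContMDiff (𝓡 a) (𝓡 c) ∞
    (fun x => F x y)).mdifferentiable (by simp) x

theorem mdifferentiableAt_right
    (hF : ContMDiff ((𝓡 a).prod (𝓡 b)) (𝓡 c) ∞ fun p : X₁ × X₂ => F p.1 p.2) (x : X₁) (y : X₂) :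
    MDifferentiableAt (𝓡 b) (𝓡 c) (fun y => F x y) y :=
  (hF.comp (contMDiff_const.prodMk contMDiff_id) : ContMDiff (𝓡 b) (𝓡 c) ∞
    (fun y => F x y)).mdifferentiable (by simp) y

theorem fderiv_chartMap_left
    (hF : ContMDiff ((𝓡 a).prod (𝓡 b)) (𝓡 c) ∞ fun p : X₁ × X₂ => F p.1 p.2) {s : Eu a} {t : Eu b}
    (h : (s, t) ∈ chartDomain (a := a) (b := b) (c := c) x₁ x₂ x₃ F) (v : Eu a) :
    fderiv ℝ (chartMap (a := a) (b := b) (c := c) x₁ x₂ x₃ F) (s, t) (v, 0)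
      = (mfderiv (𝓡 c) (𝓡 c) (extChartAt (𝓡 c) x₃) (F ((extChartAt (𝓡 a) x₁).symm s)
          ((extChartAt (𝓡 b) x₂).symm t)) : Eu c →L[ℝ] Eu c)
        ((mfderiv (𝓡 a) (𝓡 c) (fun x => F x ((extChartAt (𝓡 b) x₂).symm t))
          ((extChartAt (𝓡 a) x₁).symm s) : Eu a →L[ℝ] Eu c)
        (mfderiv (𝓡 a) (𝓡 a) (extChartAt (𝓡 a) x₁).symm s v)) := by
  have d := (contDiffOn_chartMap (x₁ := x₁) (x₂ := x₂) (x₃ := x₃) hF).differentiableAt_of_isOpen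
    (isOpen_chartDomain hF) h
  have d1 := mdifferentiableAt_left hF ((extChartAt (𝓡 a) x₁).symm s) ((extChartAt (𝓡 b) x₂).symm t)
  have d2 : MDifferentiableAt (𝓡 a) (𝓡 c) (fun s => F ((extChartAt (𝓡 a) x₁).symm s)
      ((extChartAt (𝓡 b) x₂).symm t)) s := d1.comp s (mdifferentiableAt_chart_symm h.1.1)
  rw [← fderiv_slice_left d]
  exact (fderiv_chart_comp (y₀ := x₃) d2 h.2 v).trans
    (congrArg _ (mfderiv_comp_chart_symm (f := fun x => F x ((extChartAt (𝓡 b) x₂).symm t))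
      h.1.1 d1 v))

theorem fderiv_chartMap_right
    (hF : ContMDiff ((𝓡 a).prod (𝓡 b)) (𝓡 c) ∞ fun p : X₁ × X₂ => F p.1 p.2) {s : Eu a} {t : Eu b}
    (h : (s, t) ∈ chartDomain (a := a) (b := b) (c := c) x₁ x₂ x₃ F) (v : Eu b) :
    fderiv ℝ (chartMap (a := a) (b := b) (c := c) x₁ x₂ x₃ F) (s, t) (0, v)
      = (mfderiv (𝓡 c) (𝓡 c) (extChartAt (𝓡 c) x₃) (F ((extChartAt (𝓡 a) x₁).symm s)
          ((extChartAt (𝓡 b) x₂).symm t)) : Eu c →L[ℝ] Eu c)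
        ((mfderiv (𝓡 b) (𝓡 c) (fun y => F ((extChartAt (𝓡 a) x₁).symm s) y)
          ((extChartAt (𝓡 b) x₂).symm t) : Eu b →L[ℝ] Eu c)
        (mfderiv (𝓡 b) (𝓡 b) (extChartAt (𝓡 b) x₂).symm t v)) := by
  have d := (contDiffOn_chartMap (x₁ := x₁) (x₂ := x₂) (x₃ := x₃) hF).differentiableAt_of_isOpen
    (isOpen_chartDomain hF) h
  have d1 := mdifferentiableAt_right hF ((extChartAt (𝓡 a) x₁).symm s) ((extChartAt (𝓡 b) x₂).symm t)
  have d2 : MDifferentiableAt (𝓡 b) (𝓡 c) (fun t => F ((extChartAt (𝓡 a) x₁).symm s)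
      ((extChartAt (𝓡 b) x₂).symm t)) t := d1.comp t (mdifferentiableAt_chart_symm h.1.2)
  rw [← fderiv_slice_right d]
  exact (fderiv_chart_comp (y₀ := x₃) d2 h.2 v).trans
    (congrArg _ (mfderiv_comp_chart_symm (f := fun y => F ((extChartAt (𝓡 a) x₁).symm s) y)
      h.1.2 d1 v))

end ChartMap

end

end YMH

namespace YMH

noncomputable section

/-! ### The metric in a chart -/

section ChartMetric

set_option linter.unusedSectionVars false
set_option maxSynthPendingDepth 3

variable {d : ℕ} {N : Type*} [TopologicalSpace N] [ChartedSpace (Eu d) N] [IsManifold (𝓡 d) ∞ N]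

/-- The metric in a chart, as a continuous bilinear form. -/
def metricForm (h : Metric d N) (y₀ : N) (z : Eu d) : Eu d →L[ℝ] Eu d →L[ℝ] ℝ :=
  let L : Eu d →L[ℝ] Eu d := mfderiv (𝓡 d) (𝓡 d) (extChartAt (𝓡 d) y₀).symm z
  let b : Eu d →L[ℝ] Eu d →L[ℝ] ℝ := h.inner ((extChartAt (𝓡 d) y₀).symm z)
  b.bilinearComp L L

theorem metricForm_apply (h : Metric d N) (y₀ : N) (z a b : Eu d) :
    metricForm h y₀ z a b = chartMetric h y₀ z a b := rfl

theorem metricForm_symm (h : Metric d N) (y₀ : N) (z a b : Eu d) :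
    metricForm h y₀ z a b = metricForm h y₀ z b a := h.symm _ _ _

theorem metricForm_pos (h : Metric d N) {y₀ : N} {z : Eu d}
    (hz : z ∈ (extChartAt (𝓡 d) y₀).target) (a : Eu d) (ha : a ≠ 0) :
    0 < metricForm h y₀ z a a := by
  refine h.pos _ _ fun h0 => ha ?_
  have h1 := mfderiv_chart_mfderiv_symm hz a
  rw [← h1]
  exact (congrArg (mfderiv (𝓡 d) (𝓡 d) (extChartAt (𝓡 d) y₀) ((extChartAt (𝓡 d) y₀).symm z)
    : Eu d →L[ℝ] Eu d) h0).trans (map_zero _)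

theorem metricForm_chart (h : Metric d N) {y₀ y : N} (hy : y ∈ (chartAt (Eu d) y₀).source)
    (v w : TangentSpace (𝓡 d) y) :
    metricForm h y₀ (extChartAt (𝓡 d) y₀ y) (mfderiv (𝓡 d) (𝓡 d) (extChartAt (𝓡 d) y₀) y v)
      (mfderiv (𝓡 d) (𝓡 d) (extChartAt (𝓡 d) y₀) y w) = h.inner y v w := by
  -- The round trip through the chart returns `y` only propositionally, while all tangent spaces are
  -- definitionally `Eu d`. Generalising base point and vectors together avoids transport between
  -- fibres.
  have key : ∀ y' : N, y' = y → ∀ v' w' : Eu d, v' = v → w' = w →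
      (h.inner y' : Eu d →L[ℝ] Eu d →L[ℝ] ℝ) v' w' = h.inner y v w := by
    rintro y' rfl v' w' rfl rfl; rfl
  exact key _ (left_inv_chart hy) _ _ (mfderiv_symm_mfderiv_chart hy v)
    (mfderiv_symm_mfderiv_chart hy w)

/-- A coordinate vector field is the tangent map of the inverse chart applied to a constant field,
hence smooth. -/
theorem contMDiffOn_mfderiv_chart_symm (y₀ : N) (a : Eu d) :
    ContMDiffOn (𝓡 d) (𝓡 d).tangent ∞
      (fun z : Eu d => (⟨(extChartAt (𝓡 d) y₀).symm z,
        mfderiv (𝓡 d) (𝓡 d) (extChartAt (𝓡 d) y₀).symm z a⟩ : TangentBundle (𝓡 d) N))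
      (extChartAt (𝓡 d) y₀).target := by
  have hopen := isOpen_target (d := d) y₀
  have h1 := (contMDiffOn_extChartAt_symm (I := 𝓡 d) (n := ∞) y₀).contMDiffOn_tangentMapWithin
    (m := ∞) (by simp) hopen.uniqueMDiffOn
  have h2 : ContMDiffOn (𝓡 d) (𝓡 d).tangent ∞
      (fun z : Eu d => (⟨z, a⟩ : TangentBundle (𝓡 d) (Eu d))) (extChartAt (𝓡 d) y₀).target :=
    contMDiffOn_vectorSpace_iff_contDiffOn.2 contDiffOn_const
  refine (h1.comp h2 fun z hz => hz).congr fun z hz => ?_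
  simp only [Function.comp, tangentMapWithin]
  rw [mfderivWithin_of_isOpen hopen hz]

/-- The coefficients are the smooth section `h` of the bundle of bilinear forms evaluated on two
coordinate fields. -/
theorem contDiffOn_metricForm (h : Metric d N) (y₀ : N) :
    ContDiffOn ℝ ∞ (metricForm h y₀) (extChartAt (𝓡 d) y₀).target := by
  rw [contDiffOn_clm_apply]
  intro a
  rw [contDiffOn_clm_apply]
  intro b
  rw [← contMDiffOn_iff_contDiffOn]
  intro z hz
  have : ContMDiffWithinAt (𝓡 d) ((𝓡 d).prod 𝓘(ℝ)) ∞
      (fun z ↦ Bundle.TotalSpace.mk' ℝ (E := Bundle.Trivial N ℝ) ((extChartAt (𝓡 d) y₀).symm z)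
        (h.inner ((extChartAt (𝓡 d) y₀).symm z)
          (mfderiv (𝓡 d) (𝓡 d) (extChartAt (𝓡 d) y₀).symm z a)
          (mfderiv (𝓡 d) (𝓡 d) (extChartAt (𝓡 d) y₀).symm z b)))
      (extChartAt (𝓡 d) y₀).target z := by
    apply ContMDiffWithinAt.clm_bundle_apply₂ (F₁ := Eu d) (F₂ := Eu d)
    · exact ContMDiffAt.comp_contMDiffWithinAt z h.contMDiff.contMDiffAt
        (contMDiffAt_chart_symm hz).contMDiffWithinAt
    · exact contMDiffOn_mfderiv_chart_symm y₀ a z hz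
    · exact contMDiffOn_mfderiv_chart_symm y₀ b z hz
  rw [Bundle.contMDiffWithinAt_totalSpace] at this
  exact this.2

theorem fderiv_chartMetric (h : Metric d N) {y₀ : N} {z : Eu d}
    (hz : z ∈ (extChartAt (𝓡 d) y₀).target) (a b c : Eu d) :
    fderiv ℝ (fun z => chartMetric h y₀ z a b) z c = fderiv ℝ (metricForm h y₀) z c a b := by
  have hd := (contDiffOn_metricForm h y₀).differentiableAt_of_isOpen (isOpen_target y₀) hz
  have := fderiv_clm_apply₂ (c := metricForm h y₀) (x := z) hd (differentiableAt_const a)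
    (differentiableAt_const b) c
  exact this.trans (by simp)

theorem chartChristoffel_eq (h : Metric d N) {y₀ : N} {z : Eu d}
    (hz : z ∈ (extChartAt (𝓡 d) y₀).target) (a b t : Eu d) :
    chartChristoffel h y₀ z a b t
      = metricForm h y₀ z (christoffel (metricForm h y₀) z a b) t := by
  rw [metric_christoffel (metricForm_pos h hz), chartChristoffel, fderiv_chartMetric h hz,
    fderiv_chartMetric h hz, fderiv_chartMetric h hz]

end ChartMetric

end

end YMH

namespace YMH

noncomputable section

/-! ### The group and its action in charts -/

/-- The tangent space at `g` is identified with `Eu k` by the preferred chart at `g`, so that chart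
has identity derivative there. Hence no Jacobian appears between `𝔤` and the coordinates at the
unit. -/
theorem mfderiv_chart_self {k : ℕ} {G : Type*} [TopologicalSpace G] [ChartedSpace (Eu k) G]
    [IsManifold (𝓡 k) ∞ G] (g : G) (c : Eu k) :
    (mfderiv (𝓡 k) (𝓡 k) (extChartAt (𝓡 k) g) g : Eu k →L[ℝ] Eu k) c = c := by
  have : IsManifold (𝓡 k) 1 G := IsManifold.of_le (n := ∞) (by simp)
  have h : (mfderiv (𝓡 k) (𝓡 k) (extChartAt (𝓡 k) g) g : Eu k →L[ℝ] Eu k)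
      = tangentCoordChange (𝓡 k) g g g :=
    mfderiv_chartAt_eq_tangentCoordChange (mem_chart_source _ g)
  exact (congrArg (fun L : Eu k →L[ℝ] Eu k => L c) h).trans
    (tangentCoordChange_self (I := 𝓡 k) (mem_extChartAt_source g))

theorem mfderiv_chart_symm_self {k : ℕ} {G : Type*} [TopologicalSpace G] [ChartedSpace (Eu k) G]
    [IsManifold (𝓡 k) ∞ G] (g : G) (c : Eu k) :
    (mfderiv (𝓡 k) (𝓡 k) (extChartAt (𝓡 k) g).symm (extChartAt (𝓡 k) g g) : Eu k →L[ℝ] Eu k) c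
      = c := by
  have h := mfderiv_symm_mfderiv_chart (mem_chart_source (Eu k) g) c
  rwa [mfderiv_chart_self] at h

section Action

set_option linter.unusedSectionVars false
set_option maxSynthPendingDepth 3

variable {d k : ℕ} {N : Type*} [TopologicalSpace N] [ChartedSpace (Eu d) N] [IsManifold (𝓡 d) ∞ N]
  {G : Type*} [TopologicalSpace G] [ChartedSpace (Eu k) G] [Group G] [LieGroup (𝓡 k) ∞ G]
  [MulAction G N] [ContMDiffSMul (𝓡 k) (𝓡 d) ∞ G N]

variable (k G) in
/-- The coordinates of the unit. -/
def chartOne : Eu k := extChartAt (𝓡 k) (1 : G) 1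

theorem chartOne_mem : chartOne k G ∈ (extChartAt (𝓡 k) (1 : G)).target :=
  mem_target (mem_chart_source _ 1)

theorem symm_chartOne : (extChartAt (𝓡 k) (1 : G)).symm (chartOne k G) = 1 :=
  left_inv_chart (mem_chart_source _ 1)

variable (k G) in
/-- The action in charts. -/
def chartAction (y₀ : N) : Eu k × Eu d → Eu d :=
  chartMap (1 : G) y₀ y₀ (fun g y => g • y)

variable (k G) in
/-- The domain of `chartAction`. -/
def actionDomain (y₀ : N) : Set (Eu k × Eu d) :=
  chartDomain (c := d) (1 : G) y₀ y₀ (fun g y => g • y)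

theorem isLocalAction_chart (y₀ : N) :
    IsLocalAction (chartAction k G y₀) (chartOne k G) (actionDomain k G y₀)
      (extChartAt (𝓡 d) y₀).target where
  isOpen := isOpen_chartDomain ContMDiffSMul.contMDiff_smul
  isOpen_base := isOpen_target y₀
  mem z hz := ⟨⟨chartOne_mem, hz⟩, by
    simp only [symm_chartOne, one_smul]; exact symm_mem_source hz⟩
  smooth := contDiffOn_chartMap ContMDiffSMul.contMDiff_smul
  id_apply z hz := by
    simp only [chartAction, chartMap, symm_chartOne, one_smul]; exact right_inv_chart hz

theorem actField_chart {y₀ : N} {z : Eu d} (hz : z ∈ (extChartAt (𝓡 d) y₀).target) (c : Eu k) :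
    actField (chartAction k G y₀) (chartOne k G) z c = chartInfAct G y₀ c z := by
  have key : ∀ g : G, g = 1 → ∀ y : N, y = (extChartAt (𝓡 d) y₀).symm z → ∀ c' : Eu k, c' = c →
      (mfderiv (𝓡 d) (𝓡 d) (extChartAt (𝓡 d) y₀) y : Eu d →L[ℝ] Eu d)
        ((mfderiv (𝓡 k) (𝓡 d) (fun g : G => g • (extChartAt (𝓡 d) y₀).symm z) g :
          Eu k →L[ℝ] Eu d) c') = chartInfAct G y₀ c z := by
    rintro _ rfl _ rfl _ rfl; rfl
  rw [actField_apply]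
  exact (fderiv_chartMap_left (ContMDiffSMul.contMDiff_smul (I := 𝓡 k) (I' := 𝓡 d) (n := ∞))
    ((isLocalAction_chart y₀).mem z hz) c).trans
    (key _ symm_chartOne _ (by rw [symm_chartOne, one_smul]) _ (mfderiv_chart_symm_self _ _))

theorem metricForm_action {h : Metric d N} (h_iso : IsIsometricAction G h) {y₀ : N} {s : Eu k}
    {z : Eu d} (hs : (s, z) ∈ actionDomain k G y₀) (a b : Eu d) :
    metricForm h y₀ (chartAction k G y₀ (s, z)) (fderiv ℝ (chartAction k G y₀) (s, z) (0, a))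
      (fderiv ℝ (chartAction k G y₀) (s, z) (0, b)) = metricForm h y₀ z a b := by
  have h1 := fun a => fderiv_chartMap_right
    (ContMDiffSMul.contMDiff_smul (I := 𝓡 k) (I' := 𝓡 d) (n := ∞)) hs a
  simp only [chartAction] at h1 ⊢
  rw [h1, h1]
  exact (metricForm_chart h hs.2 _ _).trans (h_iso _ _ _ _)

theorem potential_action {V : N → ℝ} (hV : ∀ (g : G) (y : N), V (g • y) = V y) {y₀ : N} {s : Eu k}
    {z : Eu d} (hs : (s, z) ∈ actionDomain k G y₀) :
    V ((extChartAt (𝓡 d) y₀).symm (chartAction k G y₀ (s, z)))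
      = V ((extChartAt (𝓡 d) y₀).symm z) := by
  simp only [chartAction, chartMap]
  rw [left_inv_chart hs.2, hV]

variable (k G) in
/-- The multiplication in the chart around the unit. -/
def chartMul : Eu k × Eu k → Eu k := chartMap (1 : G) (1 : G) (1 : G) (fun g g' => g * g')

variable (k G) in
/-- The domain of `chartMul`. -/
def mulDomain : Set (Eu k × Eu k) :=
  chartDomain (c := k) (1 : G) (1 : G) (1 : G) (fun g g' => g * g')

theorem isLocalMul_chart : IsLocalMul (chartMul k G) (chartOne k G) (mulDomain k G)
    (extChartAt (𝓡 k) (1 : G)).target where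
  isOpen := isOpen_chartDomain (contMDiff_mul (𝓡 k) ∞)
  isOpen_base := isOpen_target 1
  mem_base := chartOne_mem
  left_mem s hs := ⟨⟨chartOne_mem, hs⟩, by
    simp only [symm_chartOne, one_mul]; exact symm_mem_source hs⟩
  right_mem s hs := ⟨⟨hs, chartOne_mem⟩, by
    simp only [symm_chartOne, mul_one]; exact symm_mem_source hs⟩
  smooth := contDiffOn_chartMap (contMDiff_mul (𝓡 k) ∞)
  one_mul s hs := by
    simp only [chartMul, chartMap, symm_chartOne, one_mul]; exact right_inv_chart hs
  mul_one s hs := by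
    simp only [chartMul, chartMap, symm_chartOne, mul_one]; exact right_inv_chart hs

theorem chartAction_mul {y₀ : N} {p : Eu k × Eu k} {z : Eu d} (hp : p ∈ mulDomain k G)
    (hz : (p.2, z) ∈ actionDomain k G y₀) :
    chartAction k G y₀ (chartMul k G p, z) = chartAction k G y₀ (p.1, chartAction k G y₀ (p.2, z)) := by
  simp only [chartAction, chartMap, chartMul]
  rw [left_inv_chart hp.2, left_inv_chart hz.2, mul_smul]

variable (k G) in
/-- Conjugation in the chart around the unit. -/
def chartConj : Eu k × Eu k → Eu k := chartMap (1 : G) (1 : G) (1 : G) (fun g a => g * a * g⁻¹)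

variable (k G) in
/-- The domain of `chartConj`. -/
def conjDomain : Set (Eu k × Eu k) :=
  chartDomain (c := k) (1 : G) (1 : G) (1 : G) (fun g a => g * a * g⁻¹)

theorem contMDiff_conj : ContMDiff ((𝓡 k).prod (𝓡 k)) (𝓡 k) ∞
    (fun p : G × G => p.1 * p.2 * p.1⁻¹) :=
  (contMDiff_fst.mul contMDiff_snd).mul contMDiff_fst.inv

theorem mem_conjDomain {s : Eu k} (hs : s ∈ (extChartAt (𝓡 k) (1 : G)).target) :
    (s, chartOne k G) ∈ conjDomain k G :=
  ⟨⟨hs, chartOne_mem⟩, by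
    simp only [symm_chartOne, mul_one, mul_inv_cancel]; exact mem_chart_source _ _⟩

theorem fderiv_chartConj {s : Eu k} (hs : s ∈ (extChartAt (𝓡 k) (1 : G)).target) (a : Eu k) :
    fderiv ℝ (chartConj k G) (s, chartOne k G) (0, a)
      = adjointAct ((extChartAt (𝓡 k) (1 : G)).symm s) a := by
  have key : ∀ g g₁ : G, g = 1 → g₁ = 1 → ∀ a' : Eu k, a' = a →
      (mfderiv (𝓡 k) (𝓡 k) (extChartAt (𝓡 k) (1 : G)) g : Eu k →L[ℝ] Eu k)
        ((mfderiv (𝓡 k) (𝓡 k) (fun a : G => (extChartAt (𝓡 k) (1 : G)).symm s * a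
          * ((extChartAt (𝓡 k) (1 : G)).symm s)⁻¹) g₁ : Eu k →L[ℝ] Eu k) a')
        = adjointAct ((extChartAt (𝓡 k) (1 : G)).symm s) a := by
    rintro _ _ rfl rfl _ rfl; exact mfderiv_chart_self _ _
  exact (fderiv_chartMap_right contMDiff_conj (mem_conjDomain hs) a).trans
    (key _ _ (by rw [symm_chartOne]; simp) symm_chartOne _ (mfderiv_chart_symm_self _ _))

/-- Differentiating `Ad`-invariance at the unit, with conjugation in the chart as `q`. -/
theorem localBracket_invariant {B : Eu k →L[ℝ] Eu k →L[ℝ] ℝ} (hB : IsInvariantInner G B)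
    (c a b : Eu k) : B (localBracket (chartMul k G) (chartOne k G) c a) b
      + B a (localBracket (chartMul k G) (chartOne k G) c b) = 0 := by
  refine isLocalMul_chart.invariant (q := chartConj k G) (Q := conjDomain k G)
    (isOpen_chartDomain contMDiff_conj) (contDiffOn_chartMap contMDiff_conj)
    (fun s hs => mem_conjDomain hs) (fun s hs => ?_) (fun t ht => ⟨⟨⟨chartOne_mem, ht⟩, ?_⟩, ?_⟩)
    ?_ (fun a b => ?_) c a b
  · simp only [chartConj, chartMap, symm_chartOne, mul_one, mul_inv_cancel]; rfl
  · simp only [symm_chartOne, inv_one, one_mul, mul_one]; exact symm_mem_source ht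
  · simp only [chartConj, chartMap, symm_chartOne, inv_one, one_mul, mul_one]
    exact right_inv_chart ht
  · filter_upwards [(isOpen_chartDomain (x₁ := (1 : G)) (x₂ := (1 : G)) (x₃ := (1 : G))
      (contMDiff_conj (k := k) (G := G))).mem_nhds (mem_conjDomain chartOne_mem)] with p hp
    simp only [chartMul, chartMap, chartConj]
    rw [left_inv_chart hp.2, inv_mul_cancel_right]
  · filter_upwards [(isOpen_target (d := k) (1 : G)).mem_nhds chartOne_mem] with s hs
    rw [fderiv_chartConj hs, fderiv_chartConj hs, hB.adInvariant]

end Action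

/-! ### The Lie bracket of the group in the chart around the unit -/

section Bracket

set_option linter.unusedSectionVars false
set_option maxSynthPendingDepth 3

variable {k : ℕ} {G : Type*} [TopologicalSpace G] [ChartedSpace (Eu k) G] [Group G]
  [LieGroup (𝓡 k) ∞ G]

theorem fderiv_chartMul_right {s : Eu k} (hs : s ∈ (extChartAt (𝓡 k) (1 : G)).target) (a : Eu k) :
    fderiv ℝ (chartMul k G) (s, chartOne k G) (0, a)
      = (mfderiv (𝓡 k) (𝓡 k) (extChartAt (𝓡 k) (1 : G)) ((extChartAt (𝓡 k) (1 : G)).symm s) :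
          Eu k →L[ℝ] Eu k)
        (mulInvariantVectorField (I := 𝓡 k) (a : GroupLieAlgebra (𝓡 k) G)
          ((extChartAt (𝓡 k) (1 : G)).symm s)) := by
  have key : ∀ g g₁ : G, g = (extChartAt (𝓡 k) (1 : G)).symm s → g₁ = 1 → ∀ a' : Eu k, a' = a →
      (mfderiv (𝓡 k) (𝓡 k) (extChartAt (𝓡 k) (1 : G)) g : Eu k →L[ℝ] Eu k)
        ((mfderiv (𝓡 k) (𝓡 k) (fun a : G => (extChartAt (𝓡 k) (1 : G)).symm s * a) g₁ :
          Eu k →L[ℝ] Eu k) a')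
        = (mfderiv (𝓡 k) (𝓡 k) (extChartAt (𝓡 k) (1 : G)) ((extChartAt (𝓡 k) (1 : G)).symm s) :
          Eu k →L[ℝ] Eu k)
        (mulInvariantVectorField (I := 𝓡 k) (a : GroupLieAlgebra (𝓡 k) G)
          ((extChartAt (𝓡 k) (1 : G)).symm s)) := by
    rintro _ _ rfl rfl _ rfl; rfl
  exact (fderiv_chartMap_right (contMDiff_mul (𝓡 k) ∞) (isLocalMul_chart.right_mem s hs) a).trans
    (key _ _ (by rw [symm_chartOne, mul_one]) symm_chartOne _ (mfderiv_chart_symm_self _ _))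

theorem mpullbackWithin_chart_symm {s : Eu k} (hs : s ∈ (extChartAt (𝓡 k) (1 : G)).target)
    (W : (g : G) → TangentSpace (𝓡 k) g) :
    VectorField.mpullbackWithin 𝓘(ℝ, Eu k) (𝓡 k) (extChartAt (𝓡 k) (1 : G)).symm W
      (Set.range (𝓡 k)) s
      = (mfderiv (𝓡 k) (𝓡 k) (extChartAt (𝓡 k) (1 : G)) ((extChartAt (𝓡 k) (1 : G)).symm s) :
          Eu k →L[ℝ] Eu k) (W ((extChartAt (𝓡 k) (1 : G)).symm s)) := by
  rw [VectorField.mpullbackWithin_apply, ModelWithCorners.range_eq_univ, mfderivWithin_univ]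
  have h1 : ∀ a, (mfderiv (𝓡 k) (𝓡 k) (extChartAt (𝓡 k) (1 : G)).symm s : Eu k →L[ℝ] Eu k)
      ((mfderiv (𝓡 k) (𝓡 k) (extChartAt (𝓡 k) (1 : G)) ((extChartAt (𝓡 k) (1 : G)).symm s) :
          Eu k →L[ℝ] Eu k) a) = a := by
    intro a
    have h := mfderiv_symm_mfderiv_chart (symm_mem_source hs) a
    rwa [right_inv_chart hs] at h
  have h2 : ContinuousLinearMap.inverse
      (mfderiv (𝓡 k) (𝓡 k) (extChartAt (𝓡 k) (1 : G)).symm s : Eu k →L[ℝ] Eu k)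
      = (mfderiv (𝓡 k) (𝓡 k) (extChartAt (𝓡 k) (1 : G)) ((extChartAt (𝓡 k) (1 : G)).symm s) :
          Eu k →L[ℝ] Eu k) :=
    ContinuousLinearMap.inverse_eq (ContinuousLinearMap.ext h1)
      (ContinuousLinearMap.ext fun a => mfderiv_chart_mfderiv_symm hs a)
  exact congrArg (fun L : Eu k →L[ℝ] Eu k => L (W ((extChartAt (𝓡 k) (1 : G)).symm s))) h2

/-- The bracket of `𝔤` is that of left-invariant vector fields at the unit. In the chart such a
field is the derivative of the multiplication in its second factor at the unit, and the commutator
of two of them is the antisymmetrised mixed second derivative. -/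
theorem lieBr_eq_localBracket (a b : Eu k) :
    lieBr G a b = localBracket (chartMul k G) (chartOne k G) a b := by
  have hW : ∀ a : Eu k, VectorField.mpullbackWithin 𝓘(ℝ, Eu k) (𝓡 k)
      (extChartAt (𝓡 k) (1 : G)).symm
      (mulInvariantVectorField (I := 𝓡 k) (a : GroupLieAlgebra (𝓡 k) G)) (Set.range (𝓡 k))
      =ᶠ[nhds (chartOne k G)]
        fun s => fderiv ℝ (chartMul k G) (s, chartOne k G) (0, a) := by
    intro a
    filter_upwards [(isOpen_target (d := k) (1 : G)).mem_nhds chartOne_mem] with s hs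
    rw [mpullbackWithin_chart_symm hs, fderiv_chartMul_right hs]
  have hm := isLocalMul_chart (k := k) (G := G)
  have hee := hm.left_mem _ hm.mem_base
  have dm := (hm.smooth.fderiv_infty hm.isOpen).differentiableAt_of_isOpen hm.isOpen hee
  have hv : ∀ a : Eu k, fderiv ℝ (chartMul k G) (chartOne k G, chartOne k G) (0, a) = a := by
    intro a
    rw [← fderiv_slice_right (hm.smooth.differentiableAt_of_isOpen hm.isOpen hee),
      Filter.EventuallyEq.fderiv_apply_eq hm.isOpen_base hm.mem_base hm.one_mul]
    simp
  have hd : ∀ a c : Eu k, fderiv ℝ (fun s => fderiv ℝ (chartMul k G) (s, chartOne k G) (0, a))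
      (chartOne k G) c
      = fderiv ℝ (fderiv ℝ (chartMul k G)) (chartOne k G, chartOne k G) (c, 0) (0, a) := by
    intro a c
    rw [fderiv_clm_apply_const (c := fun s => fderiv ℝ (chartMul k G) (s, chartOne k G))
      (differentiableAt_slice_left dm), fderiv_slice_left dm]
  have h1 : lieBr G a b = VectorField.mlieBracketWithin (𝓡 k)
      (mulInvariantVectorField (I := 𝓡 k) (a : GroupLieAlgebra (𝓡 k) G))
      (mulInvariantVectorField (I := 𝓡 k) (b : GroupLieAlgebra (𝓡 k) G)) Set.univ (1 : G) := by
    rw [VectorField.mlieBracketWithin_univ]; rfl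
  have hid : ∀ c : Eu k, ContinuousLinearMap.inverse
      (mfderiv (𝓡 k) (𝓡 k) (extChartAt (𝓡 k) (1 : G)) 1 : Eu k →L[ℝ] Eu k) c = c := by
    intro c
    have e1 : (mfderiv (𝓡 k) (𝓡 k) (extChartAt (𝓡 k) (1 : G)) 1 : Eu k →L[ℝ] Eu k)
        = ContinuousLinearMap.id ℝ (Eu k) := ContinuousLinearMap.ext fun c => mfderiv_chart_self _ c
    have e2 : ContinuousLinearMap.inverse (ContinuousLinearMap.id ℝ (Eu k))
        = ContinuousLinearMap.id ℝ (Eu k) := ContinuousLinearMap.inverse_id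
    exact (congrArg (fun L : Eu k →L[ℝ] Eu k => ContinuousLinearMap.inverse L c) e1).trans
      (congrArg (fun L : Eu k →L[ℝ] Eu k => L c) e2)
  have h2 : ∀ V W : Eu k → Eu k, ∀ S : Set (Eu k), S = Set.univ →
      VectorField.lieBracketWithin ℝ V W S (chartOne k G)
        = VectorField.lieBracket ℝ V W (chartOne k G) := by
    rintro V W _ rfl; rw [VectorField.lieBracketWithin_univ]
  rw [h1, VectorField.mlieBracketWithin_apply]
  refine (hid _).trans ((h2 _ _ _ (by rw [ModelWithCorners.range_eq_univ]; simp)).trans ?_)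
  rw [(hW a).lieBracket_vectorField_eq (hW b), VectorField.lieBracket, hv, hv, hd, hd]
  rfl

variable (k G) in
/-- The Lie bracket as a continuous bilinear map. -/
def bracketForm : Eu k →L[ℝ] Eu k →L[ℝ] Eu k :=
  let b : Eu k →L[ℝ] Eu k →L[ℝ] Eu k :=
    (fderiv ℝ (fderiv ℝ (chartMul k G)) (chartOne k G, chartOne k G)).bilinearComp
      (ContinuousLinearMap.inl ℝ (Eu k) (Eu k)) (ContinuousLinearMap.inr ℝ (Eu k) (Eu k))
  b - b.flip

theorem bracketForm_apply (a b : Eu k) : bracketForm k G a b = lieBr G a b := by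
  rw [lieBr_eq_localBracket]; rfl

theorem isMetricLieBracket_lieBr {B : Eu k →L[ℝ] Eu k →L[ℝ] ℝ} (hB : IsInvariantInner G B) :
    IsMetricLieBracket (bracketForm k G) B where
  skew a b := by
    simp only [bracketForm_apply, lieBr_eq_localBracket, localBracket]; abel
  jacobi a b c := by
    have : LieGroup (𝓡 k) (minSmoothness ℝ 3) G := by
      rw [minSmoothness_of_isRCLikeNormedField]; infer_instance
    simp only [bracketForm_apply]
    have key : ∀ a b c : GroupLieAlgebra (𝓡 k) G, ⁅a, ⁅b, c⁆⁆ = ⁅⁅a, b⁆, c⁆ + ⁅b, ⁅a, c⁆⁆ :=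
      leibniz_lie
    exact key a b c
  symm := hB.symm
  pos := hB.pos
  invariant a b c := by
    simp only [bracketForm_apply, lieBr_eq_localBracket]
    exact localBracket_invariant hB a b c

end Bracket

end

end YMH

namespace YMH

noncomputable section

/-! ### Yang-Mills-Higgs fields in charts -/

section ChartField

set_option linter.unusedSectionVars false
set_option maxSynthPendingDepth 3

variable {n d k : ℕ} {N : Type*} [TopologicalSpace N] [ChartedSpace (Eu d) N]
  [IsManifold (𝓡 d) ∞ N]
  {G : Type*} [TopologicalSpace G] [ChartedSpace (Eu k) G] [Group G] [LieGroup (𝓡 k) ∞ G]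
  [MulAction G N] [ContMDiffSMul (𝓡 k) (𝓡 d) ∞ G N]

variable (k G) in
/-- The generators of the action in a chart. -/
def chartGenerator (y₀ : N) (z : Eu d) : Eu k →L[ℝ] Eu d :=
  actField (chartAction k G y₀) (chartOne k G) z

theorem chartGenerator_apply {y₀ : N} {z : Eu d} (hz : z ∈ (extChartAt (𝓡 d) y₀).target)
    (c : Eu k) : chartGenerator k G y₀ z c = chartInfAct G y₀ c z := actField_chart hz c

theorem chartGenerator_chart {y₀ y : N} (hy : y ∈ (chartAt (Eu d) y₀).source) (c : Eu k) :
    chartGenerator k G y₀ (extChartAt (𝓡 d) y₀ y) c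
      = mfderiv (𝓡 d) (𝓡 d) (extChartAt (𝓡 d) y₀) y (infAct G c y) := by
  rw [chartGenerator_apply (mem_target hy), chartInfAct, left_inv_chart hy]

/-- The global action restricts to a local action near the unit, where invariance of the metric and
associativity hold as identities of germs; these are all that `killing` and `bracket` need. -/
theorem isIsometricLieAction_chart {h : Metric d N} (h_iso : IsIsometricAction G h) (y₀ : N) :
    IsIsometricLieAction (extChartAt (𝓡 d) y₀).target (metricForm h y₀)
      (christoffel (metricForm h y₀)) (chartGenerator k G y₀) (bracketForm k G) := by
  have hloc := isLocalAction_chart (d := d) (k := k) (G := G) y₀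
  refine isIsometricLieAction_christoffel (isOpen_target y₀) (contDiffOn_metricForm h y₀)
    hloc.contDiffOn_actField (fun z _ => metricForm_symm h y₀ z) (fun z hz => metricForm_pos h hz)
    (fun z hz c a b => ?_) (fun z hz a b => ?_)
  · refine hloc.killing (contDiffOn_metricForm h y₀) hz (fun a b => ?_) c a b
    filter_upwards [(Continuous.prodMk_left z).continuousAt.eventually_mem
      (hloc.isOpen.mem_nhds (hloc.mem z hz))] with s hs
    exact metricForm_action h_iso hs a b
  · rw [bracketForm_apply, lieBr_eq_localBracket]
    refine hloc.bracket isLocalMul_chart hz ?_ a b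
    have hm := isLocalMul_chart (k := k) (G := G)
    have h1 : ∀ᶠ p : Eu k × Eu k in nhds (chartOne k G, chartOne k G), p ∈ mulDomain k G :=
      hm.isOpen.mem_nhds (hm.left_mem _ hm.mem_base)
    have h2 : ∀ᶠ p : Eu k × Eu k in nhds (chartOne k G, chartOne k G),
        (p.2, z) ∈ actionDomain k G y₀ :=
      (continuous_snd.prodMk continuous_const).continuousAt.eventually_mem
        (hloc.isOpen.mem_nhds (hloc.mem z hz))
    filter_upwards [h1, h2] with p hp1 hp2
    exact chartAction_mul hp1 hp2

/-- The potential in a chart. -/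
def chartPotential (V : N → ℝ) (y₀ : N) (z : Eu d) : ℝ := V ((extChartAt (𝓡 d) y₀).symm z)

theorem isInvariantPotential_chart (h : Metric d N) {V : N → ℝ}
    (hV : ContMDiff (𝓡 d) 𝓘(ℝ) ∞ V) (hinv : ∀ (g : G) (y : N), V (g • y) = V y) (y₀ : N) :
    IsInvariantPotential (extChartAt (𝓡 d) y₀).target (metricForm h y₀) (chartGenerator k G y₀)
      (chartPotential V y₀) (metricGrad (metricForm h y₀) (chartPotential V y₀)) := by
  have hloc := isLocalAction_chart (d := d) (k := k) (G := G) y₀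
  have hs : ContDiffOn ℝ ∞ (chartPotential V y₀) (extChartAt (𝓡 d) y₀).target :=
    (hV.comp_contMDiffOn (contMDiffOn_extChartAt_symm (I := 𝓡 d) y₀)).contDiffOn
  refine ⟨hs, contDiffOn_metricGrad (isOpen_target y₀) (contDiffOn_metricForm h y₀)
    (fun z hz => metricForm_pos h hz) hs, fun z hz c => ?_,
    fun z hz => metric_metricGrad (metricForm_pos h hz) _⟩
  refine hloc.fderiv_invariant hs hz ?_ c
  filter_upwards [(Continuous.prodMk_left z).continuousAt.eventually_mem
      (hloc.isOpen.mem_nhds (hloc.mem z hz))] with s hs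
  exact potential_action hinv hs

theorem curvature_eq_curv (A : Eu n → Eu n →L[ℝ] Eu k) (x v w : Eu n) :
    curvature G A x v w = curv (bracketForm k G) A v w x := by
  rw [curvature, curv, bracketForm_apply]

theorem codiffCurvature_eq (A : Eu n → Eu n →L[ℝ] Eu k) (x v : Eu n) :
    codiffCurvature G A x v = -divCurv (bracketForm k G) A v x := by
  simp only [codiffCurvature, divCurv, covD, adConn_apply, bracketForm_apply, curvature_eq_curv]

theorem sum_sum_eq_two_mul_sum_Ioi {f : Fin n → Fin n → ℝ} (hs : ∀ i j, f i j = f j i)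
    (h0 : ∀ i, f i i = 0) : ∑ i, ∑ j, f i j = 2 * ∑ i, ∑ j ∈ Finset.Ioi i, f i j := by
  have h1 : ∀ i, ∑ j, f i j = ∑ j ∈ Finset.Ioi i, f i j + ∑ j ∈ Finset.Iio i, f i j := by
    intro i
    rw [← Finset.sum_filter_add_sum_filter_not Finset.univ (fun j => i < j)]
    congr 1
    · refine Finset.sum_congr ?_ fun _ _ => rfl
      ext j; simp
    · refine (Finset.sum_subset ?_ ?_).symm
      · intro j hj
        simp only [Finset.mem_Iio] at hj
        simp [hj.le]
      · intro j hj hj'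
        simp only [Finset.mem_filter, Finset.mem_univ, true_and, Finset.mem_Iio, not_lt] at hj hj'
        rw [le_antisymm hj hj', h0]
  have h2 : ∑ i, ∑ j ∈ Finset.Iio i, f i j = ∑ i, ∑ j ∈ Finset.Ioi i, f i j := by
    rw [Finset.sum_comm' (t' := Finset.univ) (s' := fun j => Finset.Ioi j) (by simp)]
    exact Finset.sum_congr rfl fun i _ => Finset.sum_congr rfl fun j _ => hs j i
  rw [Finset.sum_congr rfl fun i _ => h1 i, Finset.sum_add_distrib, h2]
  ring

theorem two_mul_curvatureNormSq {B : Eu k →L[ℝ] Eu k →L[ℝ] ℝ} (hB : IsInvariantInner G B)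
    (A : Eu n → Eu n →L[ℝ] Eu k) (x : Eu n) :
    2 * curvatureNormSq G B A x = ∑ i : Fin n, ∑ j : Fin n,
      B (curv (bracketForm k G) A (stdVec i) (stdVec j) x)
        (curv (bracketForm k G) A (stdVec i) (stdVec j) x) := by
  have hsk := curv_skew (E := Eu n) (isMetricLieBracket_lieBr (G := G) hB) (A := A)
  rw [sum_sum_eq_two_mul_sum_Ioi (fun i j => ?_) (fun i => ?_)]
  · simp only [curvatureNormSq, curvature_eq_curv]
  · rw [hsk]; simp
  · have h0 : curv (bracketForm k G) A (stdVec i) (stdVec i) x = 0 := by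
      linear_combination (norm := module) (1 / 2 : ℝ) • hsk (stdVec i) (stdVec i) x
    rw [h0]; simp

theorem IsInvariantInner.nonneg {B : Eu k →L[ℝ] Eu k →L[ℝ] ℝ} (hB : IsInvariantInner G B)
    (a : Eu k) : 0 ≤ B a a := by
  by_cases ha : a = 0
  · simp [ha]
  · exact (hB.pos a ha).le

theorem curvatureNormSq_nonneg {B : Eu k →L[ℝ] Eu k →L[ℝ] ℝ} (hB : IsInvariantInner G B)
    (A : Eu n → Eu n →L[ℝ] Eu k) (x : Eu n) : 0 ≤ curvatureNormSq G B A x :=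
  Finset.sum_nonneg fun _ _ => Finset.sum_nonneg fun _ _ => hB.nonneg _

theorem covDerivNormSq_nonneg (h : Metric d N) (A : Eu n → Eu n →L[ℝ] Eu k) (u : Eu n → N)
    (x : Eu n) : 0 ≤ covDerivNormSq G h A u x := by
  refine Finset.sum_nonneg fun i _ => ?_
  by_cases ha : covDeriv (d := d) G A u x (stdVec i) = 0
  · rw [ha, map_zero]
  · exact (h.pos _ _ ha).le

variable {Ω : Set (Eu n)} {A : Eu n → Eu n →L[ℝ] Eu k} {u : Eu n → N} {y₀ : N} {h : Metric d N}
  {B : Eu k →L[ℝ] Eu k →L[ℝ] ℝ} {V : N → ℝ}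

theorem gaugedDeriv_chart {x : Eu n} (hu : MDifferentiableAt (𝓡 n) (𝓡 d) u x)
    (hx : u x ∈ (chartAt (Eu d) y₀).source) (v : Eu n) :
    gaugedDeriv (chartGenerator k G y₀) A (fun x => extChartAt (𝓡 d) y₀ (u x)) x v
      = mfderiv (𝓡 d) (𝓡 d) (extChartAt (𝓡 d) y₀) (u x) (covDeriv G A u x v) := by
  rw [gaugedDeriv_apply, fderiv_chart_comp hu hx, chartGenerator_chart hx]
  exact (map_add _ _ _).symm

theorem covDerivNormSq_chart {x : Eu n} (hu : MDifferentiableAt (𝓡 n) (𝓡 d) u x)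
    (hx : u x ∈ (chartAt (Eu d) y₀).source) :
    covDerivNormSq G h A u x = ∑ i : Fin n, metricForm h y₀ (extChartAt (𝓡 d) y₀ (u x))
      (gaugedDeriv (chartGenerator k G y₀) A (fun x => extChartAt (𝓡 d) y₀ (u x)) x (stdVec i))
      (gaugedDeriv (chartGenerator k G y₀) A (fun x => extChartAt (𝓡 d) y₀ (u x)) x (stdVec i)) := by
  simp only [gaugedDeriv_chart hu hx, metricForm_chart h hx]
  rfl

/-- The definition contains `Γ(dw, Y)` and `Γ(Y, X_A)` separately; vanishing torsion merges them
into the single term `Γ(∇_A w, Y)` of `pullConn`. -/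
theorem chartCovDerivInner_eq (h_iso : IsIsometricAction G h) (hΩ : IsOpen Ω)
    (hu : ContMDiffOn (𝓡 n) (𝓡 d) ∞ u Ω) (hsrc : Set.MapsTo u Ω (chartAt (Eu d) y₀).source)
    {x : Eu n} (hx : x ∈ Ω) (v e : Eu n) (t : Eu d) :
    chartCovDerivInner G h A u y₀ (fun x' => covDeriv G A u x' e) x v t
      = metricForm h y₀ (extChartAt (𝓡 d) y₀ (u x))
        (covD (pullConn (christoffel (metricForm h y₀)) (chartGenerator k G y₀) A
          (fun x => extChartAt (𝓡 d) y₀ (u x))) v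
          (fun y => gaugedDeriv (chartGenerator k G y₀) A (fun x => extChartAt (𝓡 d) y₀ (u x)) y e)
          x) t := by
  have H := isIsometricLieAction_chart (k := k) h_iso y₀
  have hdu : ∀ y ∈ Ω, MDifferentiableAt (𝓡 n) (𝓡 d) u y := fun y hy =>
    (hu.contMDiffAt (hΩ.mem_nhds hy)).mdifferentiableAt (by simp)
  have hz := mem_target (hsrc hx)
  have hY : ∀ y ∈ Ω, chartField u y₀ (fun x' => covDeriv G A u x' e) y
      = gaugedDeriv (chartGenerator k G y₀) A (fun x => extChartAt (𝓡 d) y₀ (u x)) y e :=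
    fun y hy => (gaugedDeriv_chart (hdu y hy) (hsrc hy) e).symm
  have hX : ∀ c a, fderiv ℝ (chartInfAct G y₀ c) (extChartAt (𝓡 d) y₀ (u x)) a
      = fderiv ℝ (chartGenerator k G y₀) (extChartAt (𝓡 d) y₀ (u x)) a c := by
    intro c a
    rw [Filter.EventuallyEq.fderiv_apply_eq (isOpen_target y₀) hz
      (g := fun z => chartGenerator k G y₀ z c) fun z hz => (chartGenerator_apply hz c).symm,
      fderiv_clm_apply_const (c := chartGenerator k G y₀)
        (H.smooth_action.differentiableAt_of_isOpen H.isOpen hz)]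
  simp only [chartCovDerivInner]
  rw [hX, hY x hx, Filter.EventuallyEq.fderiv_apply_eq hΩ hx hY, ← chartGenerator_apply hz,
    chartChristoffel_eq h hz, chartChristoffel_eq h hz, ← metricForm_apply, ← metricForm_apply,
    H.torsionFree _ hz _ (chartGenerator k G y₀ _ _), covD, pullConn_apply]
  conv_rhs => rw [gaugedDeriv_apply]
  simp only [map_add, add_apply]
  ring

/-- The chart covers only the part of the domain that `u` maps into it, which is open by continuity.
The Higgs equation is given against all coordinate vectors, and nondegeneracy of the metric turns it
into an equation of vectors. -/
theorem isCoordYMH_chart (h_iso : IsIsometricAction G h) (hΩ : IsOpen Ω)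
    (hYM : IsYMHField G h B V Ω A u) (y₀ : N) :
    IsCoordYMH (Ω ∩ u ⁻¹' (chartAt (Eu d) y₀).source) (extChartAt (𝓡 d) y₀).target
      (metricForm h y₀) (christoffel (metricForm h y₀)) (chartGenerator k G y₀)
      (metricGrad (metricForm h y₀) (chartPotential V y₀)) (bracketForm k G) B A
      (fun x => extChartAt (𝓡 d) y₀ (u x)) := by
  have hdu : ∀ y ∈ Ω, ContMDiffAt (𝓡 n) (𝓡 d) ∞ u y := fun y hy =>
    hYM.smooth_section.contMDiffAt (hΩ.mem_nhds hy)
  have hopen := hYM.smooth_section.continuousOn.isOpen_inter_preimage hΩ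
    (chartAt (Eu d) y₀).open_source
  refine
    { isOpen := hopen
      smooth_connection := hYM.smooth_connection.mono Set.inter_subset_left
      smooth_map := fun x hx => (contDiffAt_chart_comp (hdu x hx.1) hx.2).contDiffWithinAt
      mapsTo := fun x hx => mem_target hx.2
      yangMills := fun x hx v c => ?_
      higgs := fun x hx => ?_ }
  · have h1 := hYM.yangMills x hx.1 v c
    rw [codiffCurvature_eq, map_neg, neg_apply, neg_inj] at h1
    rw [h1, gaugedDeriv_chart ((hdu x hx.1).mdifferentiableAt (by simp)) hx.2,
      chartGenerator_chart hx.2, metricForm_chart h hx.2]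
  · have hz := mem_target hx.2
    refine eq_of_forall_metric_eq (metricForm_pos h hz) fun t => ?_
    have h1 := hYM.higgs x hx.1 y₀ hx.2 t
    rw [chartRoughLaplacianInner, neg_inj] at h1
    rw [metric_metricGrad (metricForm_pos h hz), map_sum, sum_apply]
    refine Eq.trans (Finset.sum_congr rfl fun i _ => ?_) h1
    exact (chartCovDerivInner_eq h_iso hopen (hYM.smooth_section.mono Set.inter_subset_left)
      (fun y hy => hy.2) hx _ _ t).symm

end ChartField

end

end YMH

/-! ### Local constants, and compactness of the fibre -/

namespace YMH

theorem sectionConst_nonneg {n : ℕ} {L η : ℝ} (hL : 1 ≤ L) (hη : 0 < η) :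
    0 ≤ sectionConst n L η := by
  have : 0 ≤ L := zero_le_one.trans hL
  unfold sectionConst
  positivity

theorem curvatureConst_nonneg {n : ℕ} {L η : ℝ} (hL : 1 ≤ L) (hη : 0 < η) :
    0 ≤ curvatureConst n L η := by
  have : 0 ≤ L := zero_le_one.trans hL
  unfold curvatureConst
  positivity

theorem isOpen_puncturedBall (n : ℕ) (R : ℝ) : IsOpen (puncturedBall n R) :=
  (isOpen_lt continuous_const continuous_norm).inter (isOpen_lt continuous_norm continuous_const)

theorem neg_mul_mono {c C p W F : ℝ} (hc : c ≤ C) (hp : 0 ≤ p) (hW : 0 ≤ W) (hF : 0 ≤ F) :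
    -(C * p) * W * F ≤ -(c * p) * W * F := by
  have := mul_le_mul_of_nonneg_right (mul_le_mul_of_nonneg_right
    (mul_le_mul_of_nonneg_right hc hp) hW) hF
  linarith

/-- Every point of the fibre has a neighbourhood over which the estimates hold with some
constant. -/
theorem exists_local_const {n d k : ℕ} (hn : 4 ≤ n)
    {N : Type*} [TopologicalSpace N] [ChartedSpace (Eu d) N] [IsManifold (𝓡 d) ∞ N]
    {G : Type*} [TopologicalSpace G] [ChartedSpace (Eu k) G] [Group G] [LieGroup (𝓡 k) ∞ G]
    [MulAction G N] [ContMDiffSMul (𝓡 k) (𝓡 d) ∞ G N]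
    {h : Metric d N} (h_iso : IsIsometricAction G h)
    {B : Eu k →L[ℝ] Eu k →L[ℝ] ℝ} (hB : IsInvariantInner G B)
    {V : N → ℝ} (hV : ContMDiff (𝓡 d) 𝓘(ℝ) ∞ V) (hV_inv : ∀ (g : G) (y : N), V (g • y) = V y)
    {δ : ℝ} (hδ : 0 < δ) (y₀ : N) :
    ∃ C : ℝ, 0 ≤ C ∧ ∃ S ∈ nhds y₀,
      ∀ (Ω : Set (Eu n)) (A : Eu n → Eu n →L[ℝ] Eu k) (u : Eu n → N), IsOpen Ω →
        IsYMHField G h B V Ω A u → ∀ x ∈ Ω, u x ∈ S → ∀ p : ℝ,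
        (((n : ℝ) - 3) / ((n : ℝ) - 2) + δ ≤ p →
          Δ (fun y => Real.sqrt (curvatureNormSq G B A y + 1) ^ p) x
            ≥ -(C * p) * (covDerivNormSq G h A u x + Real.sqrt (curvatureNormSq G B A x + 1))
              * Real.sqrt (curvatureNormSq G B A x + 1) ^ p) ∧
        (((n : ℝ) - 2) / ((n : ℝ) - 1) + δ ≤ p →
          Δ (fun y => Real.sqrt (covDerivNormSq G h A u y + 1) ^ p) x
            ≥ -(C * p) * (curvatureNormSq G B A x + (covDerivNormSq G h A u x + 1))
              * Real.sqrt (covDerivNormSq G h A u x + 1) ^ p) := by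
  have H := isIsometricLieAction_chart (k := k) h_iso y₀
  have hP := isInvariantPotential_chart (k := k) h hV hV_inv y₀
  have hbr := isMetricLieBracket_lieBr (G := G) hB
  have hy₀ := mem_target (mem_chart_source (Eu d) y₀)
  -- A closed coordinate ball is compact inside the chart, so one bound `L` holds over it and
  -- depends only on the fibre data.
  obtain ⟨r, hr, hrU⟩ := Metric.nhds_basis_closedBall.mem_iff.1
    ((isOpen_target y₀).mem_nhds hy₀)
  obtain ⟨L, hL⟩ := exists_isFibreBound H hbr hP (isCompact_closedBall _ r) hrU
  have hL1 : 1 ≤ L := (hL _ (Metric.mem_closedBall_self hr.le)).one_le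
  -- `η = min δ 1` respects both `η ≤ δ` and the restriction `η ≤ 1` of the Kato inequalities.
  have hη : 0 < min δ 1 := lt_min hδ one_pos
  have hs := sectionConst_nonneg (n := n) hL1 hη
  have hc := curvatureConst_nonneg (n := n) hL1 hη
  have hn' : (4 : ℝ) ≤ n := by exact_mod_cast hn
  -- The sum of the two nonnegative constants serves both estimates.
  refine ⟨2 * sectionConst n L (min δ 1) + 2 * curvatureConst n L (min δ 1), by linarith,
    (chartAt (Eu d) y₀).source ∩ extChartAt (𝓡 d) y₀ ⁻¹' Metric.closedBall (extChartAt (𝓡 d) y₀ y₀) r,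
    Filter.inter_mem ((chartAt (Eu d) y₀).open_source.mem_nhds (mem_chart_source _ y₀))
      ((continuousAt_extChartAt (I := 𝓡 d) y₀).preimage_mem_nhds (Metric.closedBall_mem_nhds _ hr)),
    fun Ω A u hΩ hYM x hx hux p => ?_⟩
  have hC := isCoordYMH_chart h_iso hΩ hYM y₀
  have hx' : x ∈ Ω ∩ u ⁻¹' (chartAt (Eu d) y₀).source := ⟨hx, hux.1⟩
  have hdu : ∀ y ∈ Ω, MDifferentiableAt (𝓡 n) (𝓡 d) u y := fun y hy =>
    (hYM.smooth_section.contMDiffAt (hΩ.mem_nhds hy)).mdifferentiableAt (by simp)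
  have hqF := curvatureNormSq_nonneg hB A
  have hqu := covDerivNormSq_nonneg (G := G) h A u
  refine ⟨fun hp => ?_, fun hp => ?_⟩
  · have hp0 : 0 ≤ p := by
      have : 0 ≤ ((n : ℝ) - 3) / ((n : ℝ) - 2) := div_nonneg (by linarith) (by linarith)
      linarith
    refine le_trans (neg_mul_mono (by linarith) hp0
      (add_nonneg (hqu x) (Real.sqrt_nonneg _)) (Real.rpow_nonneg (Real.sqrt_nonneg _) _))
      (laplacian_curvature_ge hn hη (min_le_right _ _) (min_le_left _ _) H hbr hC hx' (hL _ hux.2)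
        hqF (fun y _ => two_mul_curvatureNormSq hB A y)
        (covDerivNormSq_chart (hdu x hx) hux.1) hp)
  · have hp0 : 0 ≤ p := by
      have : 0 ≤ ((n : ℝ) - 2) / ((n : ℝ) - 1) := div_nonneg (by linarith) (by linarith)
      linarith
    refine le_trans (neg_mul_mono (by linarith) hp0
      (add_nonneg (hqF x) (add_nonneg (hqu x) zero_le_one))
      (Real.rpow_nonneg (Real.sqrt_nonneg _) _))
      (laplacian_section_ge hn hη (min_le_right _ _) (min_le_left _ _) H hbr hP hC hx' (hL _ hux.2)
        hqu (fun y hy => covDerivNormSq_chart (hdu y hy.1) hy.2)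
        (two_mul_curvatureNormSq hB A x) hp)

end YMH

theorem proposition2p5 (n d k : ℕ) (hn : 4 ≤ n)
    (N : Type*) [TopologicalSpace N] [T2Space N] [CompactSpace N]
    [ChartedSpace (Eu d) N] [IsManifold (𝓡 d) ∞ N]
    (G : Type*) [TopologicalSpace G] [T2Space G] [CompactSpace G] [ConnectedSpace G]
    [ChartedSpace (Eu k) G] [Group G] [LieGroup (𝓡 k) ∞ G]
    [MulAction G N] [ContMDiffSMul (𝓡 k) (𝓡 d) ∞ G N] [FaithfulSMul G N]
    (h : YMH.Metric d N) (h_iso : YMH.IsIsometricAction G h)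
    (B : Eu k →L[ℝ] Eu k →L[ℝ] ℝ) (hB : YMH.IsInvariantInner G B)
    (V : N → ℝ) (hV : ContMDiff (𝓡 d) 𝓘(ℝ) ∞ V) (hV_inv : ∀ (g : G) (y : N), V (g • y) = V y)
    (δ : ℝ) (hδ : 0 < δ) :
    ∃ C : ℝ, 0 < C ∧
      ∀ (R : ℝ) (_ : 0 < R) (A : Eu n → Eu n →L[ℝ] Eu k) (u : Eu n → N),
        YMH.IsYMHField G h B V (YMH.puncturedBall n R) A u →
        (∀ p : ℝ, ((n : ℝ) - 3) / ((n : ℝ) - 2) + δ ≤ p →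
          let f : Eu n → ℝ := fun x => Real.sqrt (YMH.curvatureNormSq G B A x + 1)
          ∀ x ∈ YMH.puncturedBall n R,
            Δ (fun y => f y ^ p) x
              ≥ -(C * p) * (YMH.covDerivNormSq G h A u x + f x) * f x ^ p) ∧
        (∀ p : ℝ, ((n : ℝ) - 2) / ((n : ℝ) - 1) + δ ≤ p →
          let f : Eu n → ℝ := fun x => Real.sqrt (YMH.covDerivNormSq G h A u x + 1)
          ∀ x ∈ YMH.puncturedBall n R,
            Δ (fun y => f y ^ p) x
              ≥ -(C * p) * (YMH.curvatureNormSq G B A x + f x ^ 2) * f x ^ p) := by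
  choose C hC S hS hest using
    fun y₀ : N => YMH.exists_local_const hn h_iso hB hV hV_inv hδ y₀
  -- The local estimates are pointwise and uniform in the domain, the field and `p`. Finitely many
  -- of them therefore give a constant for every field and radius. The `1 +` below makes it
  -- positive, since the local constants are only nonnegative.
  obtain ⟨t, ht⟩ := CompactSpace.elim_nhds_subcover S hS
  have hle : ∀ y ∈ t, C y ≤ 1 + ∑ y ∈ t, C y := fun y hy => by
    have := Finset.single_le_sum (fun y _ => hC y) hy
    linarith
  have hn' : (4 : ℝ) ≤ n := by exact_mod_cast hn
  refine ⟨1 + ∑ y ∈ t, C y, by linarith [Finset.sum_nonneg fun y (_ : y ∈ t) => hC y],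
    fun R _ A u hYM => ⟨?_, ?_⟩⟩
  all_goals
    intro p hp f x hx
    obtain ⟨y, hy, hxy⟩ : ∃ y ∈ t, u x ∈ S y := by
      have : u x ∈ ⋃ y ∈ t, S y := by rw [ht]; trivial
      simpa using this
    have hqF := YMH.curvatureNormSq_nonneg hB A x
    have hqu := YMH.covDerivNormSq_nonneg (G := G) h A u x
    have he := hest y _ A u (YMH.isOpen_puncturedBall n R) hYM x hx hxy p
  · have hp0 : 0 ≤ p := by
      have : 0 ≤ ((n : ℝ) - 3) / ((n : ℝ) - 2) := div_nonneg (by linarith) (by linarith)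
      linarith
    exact le_trans (YMH.neg_mul_mono (hle y hy) hp0 (add_nonneg hqu (Real.sqrt_nonneg _))
      (Real.rpow_nonneg (Real.sqrt_nonneg _) _)) (he.1 hp)
  · have hp0 : 0 ≤ p := by
      have : 0 ≤ ((n : ℝ) - 2) / ((n : ℝ) - 1) := div_nonneg (by linarith) (by linarith)
      linarith
    have hf : f x ^ 2 = YMH.covDerivNormSq G h A u x + 1 := Real.sq_sqrt (by linarith)
    rw [hf]
    exact le_trans (YMH.neg_mul_mono (hle y hy) hp0 (by linarith)
      (Real.rpow_nonneg (Real.sqrt_nonneg _) _)) (he.2 hp)
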